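/- Let $\mathbb{R}^m_s$ be $\mathbb{R}^m$ with $\langle u,v\rangle_s=-\sum_{i\le s}u_iv_i+\sum_{i>s}u_iv_i$, and for $c\in\{0,1,-1\}$ let $M^{n+1}_1(c)$ be the Lorentzian space form $\mathbb{R}^{n+1}_1$, $\{u\in\mathbb{R}^{n+2}_1:\langle u,u\rangle_1=1\}$, $\{u\in\mathbb{R}^{n+2}_2:\langle u,u\rangle_2=-1\}$, respectively. Let $x:M^n\to M^{n+1}_1(c)$ be a spacelike hypersurface, i.e. a smooth map from a smooth $n$-manifold whose induced metric $I=\langle dx,dx\rangle$ is positive definite, with smooth unit normal field $\nu$, $\langle\nu,\nu\rangle=-1$. Let $\mathcal{A}$ be its shape operator, $\langle dx(\mathcal{A}X),dx(Z)\rangle=\langle d\nu(X),dx(Z)\rangle$, with eigenvalues the principal curvatures $\lambda_1\le\dots\le\lambda_n$. Suppose that $x$ is a Dupin hypersurface: for every connected embedded submanifold $S\subset M$ whose tangent space at each point is an eigenspace of $\mathcal{A}$ (a curvature surface), the associated principal curvature is constant along $S$. Suppose that $x$ has $r\ge 3$ distinct principal curvatures at each point ($r$ need not be assumed to be constant on $M$).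 The Möbius curvatures are $\mathbb{M}_{ijk}=\dfrac{\lambda_i-\lambda_j}{\lambda_i-\lambda_k}$, $1\le i,j,k\le n$, where $\lambda_i\ne\lambda_k$. The conformal invariants are defined as follows. Let $y:M\to\mathbb{R}^{n+3}_2$ be the lift to the light cone given by $y=\big(\tfrac{\langle x,x\rangle+1}{2},x,\tfrac{\langle x,x\rangle-1}{2}\big)$, $y=(1,x)$, $y=(x,1)$ for $c=0,1,-1$. The conformal metric is $g=-(\langle\Delta y,\Delta y\rangle-n^2\kappa)\langle dy,dy\rangle$, with $\Delta$ and $\kappa$ the Laplacian and the normalized scalar curvature of $\langle dy,dy\rangle$; it is positive definite here, and the conformal position vector $Y$ is the positive multiple of $y$ with $\langle dY,dY\rangle=g$. Let $N=-\frac1n\Delta_gY-\frac1{2n^2}\langle\Delta_gY,\Delta_gY\rangle Y$, and let $\xi$ be the smooth field with $\langle\xi,\xi\rangle=-1$ that is orthogonal to $Y$, $N$ and $dY(TM)$, its sign being chosen so that $\langle\xi,\nu^*\rangle<0$, where $\nu^*$ is the image of $\nu$ under the differential of the map that sends a point of $M^{n+1}_1(c)$ to its lift. With a local $g$-orthonormal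 frame $E_i$, dual coframe $\omega_i$, and $Y_i=E_i(Y)$, write $$d\xi=\sum_iC_i\omega_i\,Y+\sum_{i,j}B_{ij}\omega_j\,Y_i .$$ Then $C=\sum_iC_i\omega_i$ is the conformal $1$-form, and the conformal principal curvatures $b_1\le\dots\le b_n$ are the eigenvalues of $(B_{ij})$. Theorem. The Möbius curvatures $\mathbb{M}_{ijk}$ are all constant on $M$ if and only if $C=0$ and the conformal principal curvatures $b_1,\dots,b_n$ are all constant on $M$. -/

import Mathlib

open scoped Manifold ContDiff

namespace LorentzDupin

noncomputable section

/-! ### Semi-Euclidean spaces and Lorentzian space forms -/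

/-- The product `⟨u, v⟩_s = -∑_{i ≤ s} u_i v_i + ∑_{i > s} u_i v_i` of `ℝ^m_s`. -/
def dot {m : ℕ} (s : ℕ) (u v : Fin m → ℝ) : ℝ :=
  ∑ i : Fin m, (if (i : ℕ) < s then (-1 : ℝ) else 1) * (u i * v i)

/-- The dimension of the vector space that contains `M^{n+1}_1(c)`, for `c = 0, 1, -1`. -/
def ambientDim (n : ℕ) : SignType → ℕ
  | .zero => n + 1
  | .pos => n + 2
  | .neg => n + 2

/-- The index of the vector space that contains `M^{n+1}_1(c)`. -/
def ambientIndex : SignType → ℕ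
  | .zero => 1
  | .pos => 1
  | .neg => 2

/-- The vector space that contains `M^{n+1}_1(c)`: it is `ℝ^{n+1}_1`, `ℝ^{n+2}_1`, `ℝ^{n+2}_2`
for `c = 0, 1, -1`. -/
abbrev Ambient (n : ℕ) (c : SignType) : Type := Fin (ambientDim n c) → ℝ

/-- The Lorentzian space form `M^{n+1}_1(c)`: the Minkowski space `ℝ^{n+1}_1` for `c = 0`, the
de Sitter space `⟨u, u⟩_1 = 1` for `c = 1`, the anti-de Sitter space `⟨u, u⟩_2 = -1` for
`c = -1`. -/
def spaceForm (n : ℕ) (c : SignType) : Set (Ambient n c) :=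
  {u | c ≠ 0 → dot (ambientIndex c) u u = (c : ℝ)}

/-- The canonical lift to the light cone of `ℝ^{n+3}_2` of the conformal embedding
`σ_c : M^{n+1}_1(c) → ℚ^{n+1}_1`. -/
def coneLift (n : ℕ) : (c : SignType) → Ambient n c → (Fin (n + 3) → ℝ)
  | .zero => fun (u : Fin (n + 1) → ℝ) =>
      Fin.cons (α := fun _ : Fin (n + 3) => ℝ) ((dot 1 u u + 1) / 2)
        (Fin.snoc (α := fun _ : Fin (n + 2) => ℝ) u ((dot 1 u u - 1) / 2))
  | .pos => fun (u : Fin (n + 2) → ℝ) => Fin.cons (α := fun _ : Fin (n + 3) => ℝ) 1 u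
  | .neg => fun (u : Fin (n + 2) → ℝ) => Fin.snoc (α := fun _ : Fin (n + 3) => ℝ) u 1

/-! ### Metrics in local coordinates -/

/-- The model space of an `n`-dimensional manifold. -/
abbrev E (n : ℕ) : Type := EuclideanSpace ℝ (Fin n)

section Coordinates

variable {n m : ℕ}

/-- The `i`-th partial derivative. -/
def pderiv {W : Type*} [NormedAddCommGroup W] [NormedSpace ℝ W] (i : Fin n) (f : E n → W)
    (u : E n) : W :=
  fderiv ℝ f u (EuclideanSpace.single i 1)

/-- The coefficients `⟨∂_i y, ∂_j y⟩_s` of the metric `⟨dy, dy⟩_s`. -/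
def coordMetric (s : ℕ) (y : E n → Fin m → ℝ) (u : E n) : Matrix (Fin n) (Fin n) ℝ :=
  Matrix.of fun i j => dot s (pderiv i y u) (pderiv j y u)

/-- The Christoffel symbols `Γ^k_{ij}` of a metric with coefficients `G`. -/
def christoffel (G : E n → Matrix (Fin n) (Fin n) ℝ) (k i j : Fin n) (u : E n) : ℝ :=
  1 / 2 * ∑ l, (G u)⁻¹ k l * (pderiv i (fun v => G v j l) u + pderiv j (fun v => G v i l) u
    - pderiv l (fun v => G v i j) u)

/-- The Laplace operator of a metric with coefficients `G`, on vector-valued functions: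
`Δ f = G^{ij} (∂_i ∂_j f - Γ^k_{ij} ∂_k f)`. -/
def laplacian (G : E n → Matrix (Fin n) (Fin n) ℝ) (f : E n → Fin m → ℝ) (u : E n) :
    Fin m → ℝ :=
  ∑ i, ∑ j, (G u)⁻¹ i j •
    (pderiv i (pderiv j f) u - ∑ k, christoffel G k i j u • pderiv k f u)

/-- The Ricci curvature `Ric_{jk} = ∂_i Γ^i_{jk} - ∂_j Γ^i_{ik} + Γ^i_{im} Γ^m_{jk}
- Γ^i_{jm} Γ^m_{ik}`. -/
def ricci (G : E n → Matrix (Fin n) (Fin n) ℝ) (j k : Fin n) (u : E n) : ℝ :=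
  ∑ i, (pderiv i (christoffel G i j k) u - pderiv j (christoffel G i i k) u
    + ∑ l, (christoffel G i i l u * christoffel G l j k u
      - christoffel G i j l u * christoffel G l i k u))

/-- The normalized scalar curvature: the trace of the Ricci curvature divided by `n (n - 1)`. -/
def normalizedScalarCurvature (G : E n → Matrix (Fin n) (Fin n) ℝ) (u : E n) : ℝ :=
  (∑ j, ∑ k, (G u)⁻¹ j k * ricci G j k u) / ((n : ℝ) * ((n : ℝ) - 1))

/-- The endomorphism `T` with `g (T X) Z = h X Z`, for an inner product `g` and a bilinear form
`h` on the tangent space: its matrix is the inverse Gram matrix of `g` times the matrix of `h`. -/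
def raiseIndex (g h : E n → E n → ℝ) : Module.End ℝ (E n) :=
  let e := (EuclideanSpace.basisFun (Fin n) ℝ).toBasis
  Matrix.toLin e e ((Matrix.of fun i j => g (e i) (e j))⁻¹ * Matrix.of fun i j => h (e j) (e i))

/-- The eigenvalues `μ_1 ≤ ⋯ ≤ μ_n`, in increasing order and repeated according to their
multiplicity, of an endomorphism that has `n` real eigenvalues (such as one that is self-adjoint
for some inner product). -/
def orderedEigenvalue (T : Module.End ℝ (E n)) (i : Fin n) : ℝ :=
  (T.charpoly.roots.sort (· ≤ ·)).getD i 0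

end Coordinates

/-! ### Spacelike hypersurfaces -/

section Hypersurface

variable {n : ℕ} {M : Type*} [TopologicalSpace M] [ChartedSpace (E n) M]

/-- The differential `d f_p (X)` of a vector-valued function on `M`. -/
def diff {m : ℕ} (f : M → Fin m → ℝ) (p : M) (X : TangentSpace 𝓘(ℝ, E n) p) : Fin m → ℝ :=
  mfderiv 𝓘(ℝ, E n) 𝓘(ℝ, Fin m → ℝ) f p X

/-- A spacelike hypersurface `x : M^n → M^{n+1}_1(c)`: a smooth map whose induced metric
`⟨dx, dx⟩` is positive definite. -/
structure IsSpacelikeHypersurface (c : SignType) (x : M → Ambient n c) : Prop where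
  smooth : ContMDiff 𝓘(ℝ, E n) 𝓘(ℝ, Ambient n c) ∞ x
  mem_spaceForm : ∀ p, x p ∈ spaceForm n c
  spacelike : ∀ (p : M) (X : TangentSpace 𝓘(ℝ, E n) p), X ≠ 0 →
    0 < dot (ambientIndex c) (diff x p X) (diff x p X)

/-- A smooth unit (timelike) normal field of `x` in `M^{n+1}_1(c)`. -/
structure IsUnitNormal (c : SignType) (x ν : M → Ambient n c) : Prop where
  smooth : ContMDiff 𝓘(ℝ, E n) 𝓘(ℝ, Ambient n c) ∞ ν
  tangent_spaceForm : ∀ p, c ≠ 0 → dot (ambientIndex c) (x p) (ν p) = 0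
  normal : ∀ (p : M) (X : TangentSpace 𝓘(ℝ, E n) p),
    dot (ambientIndex c) (diff x p X) (ν p) = 0
  unit : ∀ p, dot (ambientIndex c) (ν p) (ν p) = -1

/-- The shape operator `𝓐`: `⟨dx (𝓐 X), dx Z⟩ = h(X, Z) = ⟨dν X, dx Z⟩`. -/
def shapeOperator (c : SignType) (x ν : M → Ambient n c) (p : M) :
    Module.End ℝ (TangentSpace 𝓘(ℝ, E n) p) :=
  raiseIndex (fun X Z => dot (ambientIndex c) (diff x p X) (diff x p Z))
    (fun X Z => dot (ambientIndex c) (diff ν p X) (diff x p Z))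

/-- The principal curvatures `λ_1 ≤ ⋯ ≤ λ_n`. -/
def principalCurvature (c : SignType) (x ν : M → Ambient n c) (i : Fin n) (p : M) : ℝ :=
  orderedEigenvalue (shapeOperator c x ν p) i

/-- The number of distinct principal curvatures at `p`. -/
def numPrincipalCurvatures (c : SignType) (x ν : M → Ambient n c) (p : M) : ℕ :=
  {l : ℝ | (shapeOperator c x ν p).HasEigenvalue l}.ncard

/-- `ι : S → M` is a curvature surface whose associated principal curvature is `l`:
a connected embedded submanifold such that, for each `q ∈ S`, the number `l q` is a principal
curvature at `ι q` and the tangent space of `S` is the corresponding principal space. -/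
structure IsCurvatureSurface (c : SignType) (x ν : M → Ambient n c) (k : ℕ) {S : Type}
    [TopologicalSpace S] [ChartedSpace (E k) S] (ι : S → M) (l : S → ℝ) : Prop where
  connected : ConnectedSpace S
  smooth : ContMDiff 𝓘(ℝ, E k) 𝓘(ℝ, E n) ∞ ι
  immersion : ∀ q, Function.Injective (mfderiv 𝓘(ℝ, E k) 𝓘(ℝ, E n) ι q)
  isEmbedding : Topology.IsEmbedding ι
  hasEigenvalue : ∀ q, (shapeOperator c x ν (ι q)).HasEigenvalue (l q)
  tangent : ∀ q, LinearMap.range (mfderiv 𝓘(ℝ, E k) 𝓘(ℝ, E n) ι q).toLinearMap =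
    (shapeOperator c x ν (ι q)).eigenspace (l q)

/-- Dupin hypersurfaces: along each curvature surface, the associated principal curvature is
constant. -/
def IsDupin (c : SignType) (x ν : M → Ambient n c) : Prop :=
  ∀ (k : ℕ) (S : Type) [TopologicalSpace S] [ChartedSpace (E k) S] [IsManifold 𝓘(ℝ, E k) ∞ S]
    (ι : S → M) (l : S → ℝ), IsCurvatureSurface c x ν k ι l → ∀ q q' : S, l q = l q'

/-- The Möbius curvatures `𝕄_{ijk} = (λ_i - λ_j) / (λ_i - λ_k)`. -/
def mobiusCurvature (c : SignType) (x ν : M → Ambient n c) (i j k : Fin n) (p : M) : ℝ :=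
  (principalCurvature c x ν i p - principalCurvature c x ν j p) /
    (principalCurvature c x ν i p - principalCurvature c x ν k p)

/-- All Möbius curvatures are constant, where they are defined, i.e. where `λ_i ≠ λ_k`. -/
def HasConstantMobiusCurvatures (c : SignType) (x ν : M → Ambient n c) : Prop :=
  ∀ i j k : Fin n, ∃ a : ℝ, ∀ p : M,
    principalCurvature c x ν i p ≠ principalCurvature c x ν k p →
      mobiusCurvature c x ν i j k p = a

/-! ### Conformal invariants -/

/-- A function on `M`, written in the coordinates around `p`. -/
def inCoords {W : Type*} (p : M) (f : M → W) : E n → W :=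
  f ∘ (extChartAt 𝓘(ℝ, E n) p).symm

/-- The local lift `y` of `σ_c ∘ x` to the light cone, given by the canonical lift of `σ_c`. -/
def lift (c : SignType) (x : M → Ambient n c) (p : M) : Fin (n + 3) → ℝ :=
  coneLift n c (x p)

/-- The factor `-(⟨Δy, Δy⟩ - n² κ)` in the conformal metric
`g = -(⟨Δy, Δy⟩ - n² κ) ⟨dy, dy⟩`, where `Δ` and `κ` are the Laplace operator and the normalized
scalar curvature of `⟨dy, dy⟩`. -/
def conformalFactor (c : SignType) (x : M → Ambient n c) (p : M) : ℝ :=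
  let y : E n → Fin (n + 3) → ℝ := inCoords p (lift c x)
  let G := coordMetric 2 y
  let u := extChartAt 𝓘(ℝ, E n) p p
  (n : ℝ) ^ 2 * normalizedScalarCurvature G u - dot 2 (laplacian G y u) (laplacian G y u)

/-- The conformal position vector `Y`: the positive multiple of the lift `y` with
`⟨dY, dY⟩ = g`. -/
def positionVector (c : SignType) (x : M → Ambient n c) (p : M) : Fin (n + 3) → ℝ :=
  Real.sqrt (conformalFactor c x p) • lift c x p

/-- The conformal metric `g = ⟨dY, dY⟩`. -/
def conformalMetric (c : SignType) (x : M → Ambient n c) (p : M)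
    (X Z : TangentSpace 𝓘(ℝ, E n) p) : ℝ :=
  dot 2 (diff (positionVector c x) p X) (diff (positionVector c x) p Z)

/-- `ΔY`, for the Laplace operator `Δ` of the conformal metric. -/
def laplacianPosition (c : SignType) (x : M → Ambient n c) (p : M) : Fin (n + 3) → ℝ :=
  let Y : E n → Fin (n + 3) → ℝ := inCoords p (positionVector c x)
  laplacian (coordMetric 2 Y) Y (extChartAt 𝓘(ℝ, E n) p p)

/-- The vector `N = -(1/n) ΔY - (1/(2n²)) ⟨ΔY, ΔY⟩ Y`. -/
def nullNormal (c : SignType) (x : M → Ambient n c) (p : M) : Fin (n + 3) → ℝ :=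
  (-(1 / (n : ℝ))) • laplacianPosition c x p
    - (1 / (2 * (n : ℝ) ^ 2) * dot 2 (laplacianPosition c x p) (laplacianPosition c x p)) •
      positionVector c x p

/-- `ξ` is the unit section, `⟨ξ, ξ⟩ = -1`, of the conformal normal bundle, the orthogonal
complement of `Y`, `N` and the image of `dY` in `ℝ^{n+3}_2`. These conditions determine `ξ` up to
sign; its sign is the one that fits the unit normal `ν` of `x`: the vector `dσ_c(ν)` and `ξ` have
negative product (as `⟨ν, ν⟩ = -1`), so that the conformal principal curvatures are positive
multiples of the principal curvatures minus the mean curvature. -/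
structure IsConformalNormal (c : SignType) (x ν : M → Ambient n c)
    (ξ : M → Fin (n + 3) → ℝ) : Prop where
  smooth : ContMDiff 𝓘(ℝ, E n) 𝓘(ℝ, Fin (n + 3) → ℝ) ∞ ξ
  orth_position : ∀ p, dot 2 (ξ p) (positionVector c x p) = 0
  orth_nullNormal : ∀ p, dot 2 (ξ p) (nullNormal c x p) = 0
  orth_tangent : ∀ (p : M) (X : TangentSpace 𝓘(ℝ, E n) p),
    dot 2 (ξ p) (diff (positionVector c x) p X) = 0
  unit : ∀ p, dot 2 (ξ p) (ξ p) = -1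
  orientation : ∀ p, dot 2 (ξ p) (fderiv ℝ (coneLift n c) (x p) (ν p)) < 0

/-- The conformal second fundamental form `B`: in the structure equation
`dξ = ∑ C_i ω_i Y + ∑ B_{ij} ω_j Y_i` one has `B(X, Z) = ⟨dξ(X), dY(Z)⟩`, since
`⟨Y, Y_j⟩ = 0` and `⟨Y_i, Y_j⟩ = δ_{ij}`. -/
def conformalSecondForm (c : SignType) (x : M → Ambient n c) (ξ : M → Fin (n + 3) → ℝ) (p : M)
    (X Z : TangentSpace 𝓘(ℝ, E n) p) : ℝ :=
  dot 2 (diff ξ p X) (diff (positionVector c x) p Z)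

/-- The conformal 1-form `C`: in the structure equation
`dξ = ∑ C_i ω_i Y + ∑ B_{ij} ω_j Y_i` one has `C(X) = ⟨dξ(X), N⟩`, since `⟨Y, N⟩ = 1` and
`⟨Y_i, N⟩ = 0`. -/
def conformalOneForm (c : SignType) (x : M → Ambient n c) (ξ : M → Fin (n + 3) → ℝ) (p : M)
    (X : TangentSpace 𝓘(ℝ, E n) p) : ℝ :=
  dot 2 (diff ξ p X) (nullNormal c x p)

/-- The conformal principal curvatures `b_1 ≤ ⋯ ≤ b_n`: the eigenvalues of `B` with respect to
the conformal metric `g`. -/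
def conformalPrincipalCurvature (c : SignType) (x : M → Ambient n c) (ξ : M → Fin (n + 3) → ℝ)
    (i : Fin n) (p : M) : ℝ :=
  orderedEigenvalue (raiseIndex (conformalMetric c x p) (conformalSecondForm c x ξ p)) i

end Hypersurface

end

end LorentzDupin

/-! All invariants are computed on the canonical lift `y` in the light cone. Let `w` be the image of
`ν` under the differential of the lift. Each of the three space forms supplies a constant vector `q`
such that `⟨y, q⟩` is a nonzero constant and `⟨w, q⟩ = 0`. The tangent vectors of `y` together with
`w`, `y`, `q` span `ℝ^{n+3}_2`, so a vector is determined by its products with them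
(`ConeFrame.ext`). This treats `c = 0, 1, -1` uniformly (`IsLocalCone`), and it gives the Weingarten
formula `dw = dy ∘ A` and a Gauss formula.

Write `H` for the mean curvature and `ρ` for the square root of the conformal factor. The Gauss
equation yields `ρ² = n/(n-1) ∑ (λ_i - H)²` (`factor_eq`, `conformalFactor_eq`), which is positive
as soon as two principal curvatures differ. Moreover `Y = ρ y` and `ξ = w - H y`
(`conformalNormal_eq`). Hence `b_i = (λ_i - H)/ρ` (`conformalPrincipalCurvature_eq`) and `C(X) =
-ρ⁻² dρ(AX - HX) - ρ⁻¹ dH(X)` (`conformalOneForm_eq`).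

Both the `b_i` and the Möbius curvatures are unchanged when all `λ_i` undergo the same increasing
affine map. The `b_i` can be computed from the numbers `𝕄_{1jn}`, and conversely `𝕄_{ijk} = (b_i -
b_j)/(b_i - b_k)`. So constancy of one family is constancy of the other
(`HasConstantMobiusCurvatures.exists_eq`, `hasConstantMobiusCurvatures_of_eq_add_mul`).

It remains to derive `C = 0` from constant `b_i`. On a principal vector `e_i` the formula for `C`
becomes `C(e_i) = -ρ⁻¹ (dH + b_i dρ)(e_i) = -ρ⁻¹ e_i(λ_i)`, so what is needed is that each principal
curvature is stationary along its own directions (`IsDupin.fderiv_principalCurvature`). The operator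
`ρ⁻¹(A - H)` has constant eigenvalues, so its eigenprojections are fixed polynomials in it and
principal vectors extend to smooth principal fields. For a multiple principal curvature the Codazzi
equation then suffices. For a simple one, an integral curve of the principal field is an embedded
curvature surface, along which the Dupin condition makes `λ_i` constant. -/

namespace LorentzDupin

/-! ### The semi-Euclidean product -/

section Dot

variable {m s : ℕ}

lemma dot_comm (u v : Fin m → ℝ) : dot s u v = dot s v u := by
  simp only [dot, mul_comm]

lemma dot_add_left (u u' v : Fin m → ℝ) : dot s (u + u') v = dot s u v + dot s u' v := by
  simp only [dot, ← Finset.sum_add_distrib, Pi.add_apply]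
  exact Finset.sum_congr rfl fun i _ => by ring

lemma dot_smul_left (a : ℝ) (u v : Fin m → ℝ) : dot s (a • u) v = a * dot s u v := by
  simp only [dot, Finset.mul_sum, Pi.smul_apply, smul_eq_mul]
  exact Finset.sum_congr rfl fun i _ => by ring

lemma dot_add_right (u v v' : Fin m → ℝ) : dot s u (v + v') = dot s u v + dot s u v' := by
  rw [dot_comm, dot_add_left, dot_comm v, dot_comm v']

lemma dot_smul_right (a : ℝ) (u v : Fin m → ℝ) : dot s u (a • v) = a * dot s u v := by
  rw [dot_comm, dot_smul_left, dot_comm v]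

/-- The product `⟨u, v⟩_s` as a continuous bilinear map. -/
noncomputable def dotL (m s : ℕ) : (Fin m → ℝ) →L[ℝ] (Fin m → ℝ) →L[ℝ] ℝ :=
  LinearMap.toContinuousBilinearMap
    (LinearMap.mk₂ ℝ (dot s) dot_add_left dot_smul_left dot_add_right dot_smul_right)

lemma dotL_apply (u v : Fin m → ℝ) : dotL m s u v = dot s u v := rfl

lemma dot_zero_left (v : Fin m → ℝ) : dot s 0 v = 0 := by
  simp [dot]

lemma dot_zero_right (v : Fin m → ℝ) : dot s v 0 = 0 := by
  simp [dot]

lemma dot_sub_left (u u' v : Fin m → ℝ) : dot s (u - u') v = dot s u v - dot s u' v := by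
  simp [← dotL_apply]

lemma dot_sub_right (u v v' : Fin m → ℝ) : dot s u (v - v') = dot s u v - dot s u v' := by
  simp [← dotL_apply]

lemma dot_sum_left {ι : Type*} (t : Finset ι) (f : ι → Fin m → ℝ) (v : Fin m → ℝ) :
    dot s (∑ i ∈ t, f i) v = ∑ i ∈ t, dot s (f i) v := by
  simp [← dotL_apply]

lemma dot_sum_right {ι : Type*} (t : Finset ι) (f : ι → Fin m → ℝ) (v : Fin m → ℝ) :
    dot s v (∑ i ∈ t, f i) = ∑ i ∈ t, dot s v (f i) := by
  simp [← dotL_apply]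

lemma eq_zero_of_forall_dot_eq_zero {u : Fin m → ℝ} (h : ∀ v, dot s u v = 0) : u = 0 := by
  funext i
  have := h (Pi.single i 1)
  simp only [dot, Pi.single_apply, mul_ite, mul_one, mul_zero, Finset.sum_ite_eq',
    Finset.mem_univ, if_true] at this
  by_cases hi : (i : ℕ) < s <;> simpa [hi] using this

variable {F : Type*} [NormedAddCommGroup F] [NormedSpace ℝ F]

lemma contDiffAt_dot {k : WithTop ℕ∞} {f g : F → Fin m → ℝ} {u : F}
    (hf : ContDiffAt ℝ k f u) (hg : ContDiffAt ℝ k g u) :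
    ContDiffAt ℝ k (fun v => dot s (f v) (g v)) u := by
  simp only [← dotL_apply]
  exact ((dotL m s).contDiff.contDiffAt.comp u hf).clm_apply hg

lemma differentiableAt_dot {f g : F → Fin m → ℝ} {u : F}
    (hf : DifferentiableAt ℝ f u) (hg : DifferentiableAt ℝ g u) :
    DifferentiableAt ℝ (fun v => dot s (f v) (g v)) u := by
  simp only [← dotL_apply]
  exact ((dotL m s).differentiableAt.comp u hf).clm_apply hg

lemma fderiv_dot {f g : F → Fin m → ℝ} {u : F}
    (hf : DifferentiableAt ℝ f u) (hg : DifferentiableAt ℝ g u) (X : F) :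
    fderiv ℝ (fun v => dot s (f v) (g v)) u X =
      dot s (fderiv ℝ f u X) (g u) + dot s (f u) (fderiv ℝ g u X) := by
  simp only [← dotL_apply]
  rw [ContinuousLinearMap.fderiv_of_bilinear _ hf hg]
  simp [add_comm]

end Dot

/-! ### Partial derivatives -/

section PartialDerivatives

variable {n m s : ℕ} {W : Type*} [NormedAddCommGroup W] [NormedSpace ℝ W]

lemma ContDiffAt.pderiv {f : E n → W} {u : E n} (hf : ContDiffAt ℝ ∞ f u) (i : Fin n) :
    ContDiffAt ℝ ∞ (pderiv i f) u :=
  (hf.fderiv_right (m := ∞) (by simp)).clm_apply contDiffAt_const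

lemma pderiv_comm {f : E n → W} {u : E n} (hf : ContDiffAt ℝ ∞ f u) (i j : Fin n) :
    pderiv i (pderiv j f) u = pderiv j (pderiv i f) u := by
  have h := hf.isSymmSndFDerivAt (by
    rw [minSmoothness_of_isRCLikeNormedField]
    exact WithTop.coe_le_coe.2 (le_top : (2 : ℕ∞) ≤ ⊤))
  have hd : DifferentiableAt ℝ (fderiv ℝ f) u :=
    (hf.fderiv_right (m := ∞) (by simp)).differentiableAt (by simp)
  have key : ∀ i j : Fin n, pderiv i (pderiv j f) u =
      fderiv ℝ (fderiv ℝ f) u (EuclideanSpace.single i 1) (EuclideanSpace.single j 1) := by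
    intro i j
    change fderiv ℝ (fun v => fderiv ℝ f v (EuclideanSpace.single j 1)) u _ = _
    rw [fderiv_clm_apply hd (differentiableAt_const _)]
    simp
  rw [key, key, h.eq]

lemma pderiv_dot {f g : E n → Fin m → ℝ} {u : E n} (hf : DifferentiableAt ℝ f u)
    (hg : DifferentiableAt ℝ g u) (i : Fin n) :
    pderiv i (fun v => dot s (f v) (g v)) u =
      dot s (pderiv i f u) (g u) + dot s (f u) (pderiv i g u) :=
  fderiv_dot hf hg _

lemma pderiv_congr {f g : E n → W} {u : E n} (h : f =ᶠ[nhds u] g) (i : Fin n) :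
    pderiv i f u = pderiv i g u := by
  rw [pderiv, pderiv, h.fderiv_eq]

lemma pderiv_const (i : Fin n) (a : W) (u : E n) : pderiv i (fun _ => a) u = 0 := by
  simp [pderiv]

lemma pderiv_smul {a : E n → ℝ} {f : E n → W} {u : E n} (ha : DifferentiableAt ℝ a u)
    (hf : DifferentiableAt ℝ f u) (i : Fin n) :
    pderiv i (fun v => a v • f v) u = a u • pderiv i f u + pderiv i a u • f u := by
  rw [pderiv, fderiv_fun_smul ha hf]
  simp [pderiv]

lemma fderiv_eq_sum_pderiv (f : E n → W) (u X : E n) :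
    fderiv ℝ f u X = ∑ i, X i • pderiv i f u := by
  conv_lhs => rw [← (EuclideanSpace.basisFun (Fin n) ℝ).sum_repr X]
  simp [pderiv]

end PartialDerivatives

/-! ### Smoothness of inverse matrices -/

section Inverse

variable {n : ℕ} {F : Type*} [NormedAddCommGroup F] [NormedSpace ℝ F]

lemma contDiffAt_det {k : WithTop ℕ∞} {G : F → Matrix (Fin n) (Fin n) ℝ} {u : F}
    (hG : ∀ i j, ContDiffAt ℝ k (fun v => G v i j) u) :
    ContDiffAt ℝ k (fun v => (G v).det) u := by
  simp only [Matrix.det_apply]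
  refine ContDiffAt.sum fun σ _ => ?_
  simp only [Units.smul_def, zsmul_eq_mul]
  exact contDiffAt_const.mul (contDiffAt_prod fun i _ => hG _ _)

lemma contDiffAt_inv_apply {k : WithTop ℕ∞} {G : F → Matrix (Fin n) (Fin n) ℝ} {u : F}
    (hG : ∀ i j, ContDiffAt ℝ k (fun v => G v i j) u) (hu : (G u).det ≠ 0) (i j : Fin n) :
    ContDiffAt ℝ k (fun v => (G v)⁻¹ i j) u := by
  simp only [Matrix.inv_def, Matrix.smul_apply, Ring.inverse_eq_inv', smul_eq_mul,
    Matrix.adjugate_apply]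
  refine ((contDiffAt_det hG).inv hu).mul (contDiffAt_det fun a b => ?_)
  -- The `(i, j)` entry of the adjugate is the determinant of `G` with row `j` replaced by a
  -- standard basis vector, and that row is constant.
  by_cases h : a = j
  · subst h
    simpa using contDiffAt_const
  · simpa [Matrix.updateRow_ne h] using hG a b

end Inverse

/-! ### The Gauss formula and the Gauss equation in coordinates -/

section Gauss

variable {n m s : ℕ} {y : E n → Fin m → ℝ} {u : E n}

/-- The second fundamental form `∂_i ∂_j y - Γ^k_{ij} ∂_k y` of the metric `⟨dy, dy⟩`. -/
noncomputable def secondForm (s : ℕ) (y : E n → Fin m → ℝ) (i j : Fin n) (u : E n) : Fin m → ℝ :=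
  pderiv i (pderiv j y) u - ∑ k, christoffel (coordMetric s y) k i j u • pderiv k y u

/-- The vectors `G^{kl} ∂_l y`, dual to the coordinate vectors. -/
noncomputable def dualFrame (s : ℕ) (y : E n → Fin m → ℝ) (k : Fin n) (u : E n) : Fin m → ℝ :=
  ∑ l, (coordMetric s y u)⁻¹ k l • pderiv l y u

lemma coordMetric_apply (i j : Fin n) :
    coordMetric s y u i j = dot s (pderiv i y u) (pderiv j y u) := rfl

lemma coordMetric_comm (i j : Fin n) : coordMetric s y u i j = coordMetric s y u j i :=
  dot_comm _ _

lemma coordMetric_inv_comm (i j : Fin n) :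
    (coordMetric s y u)⁻¹ i j = (coordMetric s y u)⁻¹ j i := by
  have h : (coordMetric s y u).IsSymm := by
    ext i j
    exact coordMetric_comm _ _
  have h2 : ((coordMetric s y u)⁻¹).transpose = (coordMetric s y u)⁻¹ := by
    rw [Matrix.transpose_nonsing_inv, h.eq]
  exact congrFun (congrFun h2 j) i

lemma contDiffAt_coordMetric (hy : ContDiffAt ℝ ∞ y u) (i j : Fin n) :
    ContDiffAt ℝ ∞ (fun v => coordMetric s y v i j) u :=
  contDiffAt_dot (ContDiffAt.pderiv hy i) (ContDiffAt.pderiv hy j)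

lemma sum_inv_mul_coordMetric (hG : (coordMetric s y u).det ≠ 0) (k l : Fin n) :
    ∑ j, (coordMetric s y u)⁻¹ k j * coordMetric s y u j l = if k = l then 1 else 0 := by
  rw [← Matrix.mul_apply, Matrix.nonsing_inv_mul _ hG.isUnit, Matrix.one_apply]

/-- In the Koszul combination of derivatives of `⟨∂_b y, ∂_c y⟩` everything cancels except `2 ⟨∂_i
∂_j y, ∂_l y⟩`, because second derivatives commute. -/
lemma christoffel_eq (hy : ContDiffAt ℝ ∞ y u) (k i j : Fin n) :
    christoffel (coordMetric s y) k i j u =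
      dot s (pderiv i (pderiv j y) u) (dualFrame s y k u) := by
  have hd : ∀ i, DifferentiableAt ℝ (pderiv i y) u := fun i =>
    (ContDiffAt.pderiv hy i).differentiableAt (by simp)
  have hG : ∀ a b c : Fin n, pderiv a (fun v => coordMetric s y v b c) u =
      dot s (pderiv a (pderiv b y) u) (pderiv c y u) +
        dot s (pderiv b y u) (pderiv a (pderiv c y) u) := fun a b c =>
    pderiv_dot (hd b) (hd c) a
  simp only [christoffel, hG, dualFrame, dot_sum_right, dot_smul_right, Finset.mul_sum]
  refine Finset.sum_congr rfl fun l _ => ?_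
  rw [pderiv_comm hy j i, pderiv_comm hy l i, pderiv_comm hy l j,
    dot_comm (pderiv j y u) (pderiv i (pderiv l y) u),
    dot_comm (pderiv i y u) (pderiv j (pderiv l y) u)]
  ring

lemma dot_pderiv_dualFrame (hG : (coordMetric s y u).det ≠ 0) (i k : Fin n) :
    dot s (pderiv i y u) (dualFrame s y k u) = if k = i then 1 else 0 := by
  simp only [dualFrame, dot_sum_right, dot_smul_right, ← sum_inv_mul_coordMetric hG k i]
  exact Finset.sum_congr rfl fun l _ => by rw [coordMetric_apply, dot_comm]

lemma sum_dot_dualFrame_mul (hG : (coordMetric s y u).det ≠ 0) (v : Fin m → ℝ) (l : Fin n) :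
    ∑ k, dot s v (dualFrame s y k u) * coordMetric s y u k l = dot s v (pderiv l y u) := by
  simp only [dualFrame, dot_sum_right, dot_smul_right, Finset.sum_mul]
  rw [Finset.sum_comm]
  have : ∀ j, ∑ k, (coordMetric s y u)⁻¹ k j * dot s v (pderiv j y u) * coordMetric s y u k l
      = (if j = l then 1 else 0) * dot s v (pderiv j y u) := by
    intro j
    rw [← sum_inv_mul_coordMetric hG j l, Finset.sum_mul]
    exact Finset.sum_congr rfl fun k _ => by rw [coordMetric_inv_comm k j]; ring
  simp [this]

/-- The Christoffel symbols are the coefficients of the tangential part of `∂_i ∂_j y`, so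
subtracting them leaves the normal part. -/
lemma dot_secondForm_pderiv (hy : ContDiffAt ℝ ∞ y u) (hG : (coordMetric s y u).det ≠ 0)
    (i j l : Fin n) : dot s (secondForm s y i j u) (pderiv l y u) = 0 := by
  simp only [secondForm, dot_sub_left, dot_sum_left, dot_smul_left, christoffel_eq hy]
  rw [← sum_dot_dualFrame_mul hG (pderiv i (pderiv j y) u) l]
  simp [coordMetric_apply]

lemma dot_secondForm_eq {v : Fin m → ℝ} (hv : ∀ k, dot s (pderiv k y u) v = 0) (i j : Fin n) :
    dot s (secondForm s y i j u) v = dot s (pderiv i (pderiv j y) u) v := by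
  simp [secondForm, dot_sub_left, dot_sum_left, dot_smul_left, hv]

lemma contDiffAt_dualFrame (hy : ContDiffAt ℝ ∞ y u) (hG : (coordMetric s y u).det ≠ 0)
    (k : Fin n) : ContDiffAt ℝ ∞ (dualFrame s y k) u :=
  ContDiffAt.sum fun l _ =>
    (contDiffAt_inv_apply (contDiffAt_coordMetric hy) hG k l).smul (ContDiffAt.pderiv hy l)

lemma pderiv_pderiv_eq (i j : Fin n) : pderiv i (pderiv j y) u =
    secondForm s y i j u + ∑ k, christoffel (coordMetric s y) k i j u • pderiv k y u := by
  simp [secondForm]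

/-- Obtained by differentiating the duality relation `⟨∂_p y, y^a⟩ = δ_{ap}`, which holds near `u`
because the Gram determinant stays nonzero there. -/
lemma dot_pderiv_pderiv_dualFrame (hy : ContDiffAt ℝ ∞ y u)
    (hG : (coordMetric s y u).det ≠ 0) (i p a : Fin n) :
    dot s (pderiv p y u) (pderiv i (dualFrame s y a) u) =
      -christoffel (coordMetric s y) a i p u := by
  have hd : DifferentiableAt ℝ (pderiv p y) u :=
    (ContDiffAt.pderiv hy p).differentiableAt (by simp)
  have hd' : DifferentiableAt ℝ (dualFrame s y a) u :=
    (contDiffAt_dualFrame hy hG a).differentiableAt (by simp)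
  have hev : (fun v => dot s (pderiv p y v) (dualFrame s y a v)) =ᶠ[nhds u]
      fun _ => if a = p then 1 else 0 := by
    have : ∀ᶠ v in nhds u, (coordMetric s y v).det ≠ 0 :=
      (contDiffAt_det (contDiffAt_coordMetric hy)).continuousAt.eventually_ne hG
    filter_upwards [this] with v hv using dot_pderiv_dualFrame hv p a
  have h := pderiv_dot (s := s) hd hd' i
  rw [pderiv_congr hev, pderiv_const, ← christoffel_eq hy] at h
  linarith

/-- The derivatives of the coefficients of the dual frame multiply tangent vectors, which are
orthogonal to the second fundamental form. Only the normal part of `∂_i ∂_l y` survives. -/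
lemma dot_secondForm_pderiv_dualFrame (hy : ContDiffAt ℝ ∞ y u)
    (hG : (coordMetric s y u).det ≠ 0) (i j k a : Fin n) :
    dot s (secondForm s y j k u) (pderiv i (dualFrame s y a) u) =
      ∑ l, (coordMetric s y u)⁻¹ a l * dot s (secondForm s y j k u) (secondForm s y i l u) := by
  have h1 : pderiv i (dualFrame s y a) u = ∑ l, ((coordMetric s y u)⁻¹ a l • pderiv i (pderiv l y) u
      + pderiv i (fun v => (coordMetric s y v)⁻¹ a l) u • pderiv l y u) := by
    have hl : ∀ l, HasFDerivAt (fun v => (coordMetric s y v)⁻¹ a l • pderiv l y v) _ u := fun l =>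
      (((contDiffAt_inv_apply (contDiffAt_coordMetric hy) hG a l).differentiableAt
        (by simp)).smul ((ContDiffAt.pderiv hy l).differentiableAt (by simp))).hasFDerivAt
    have := (HasFDerivAt.fun_sum (u := Finset.univ) fun l _ => hl l).fderiv
    change fderiv ℝ (fun v => ∑ l, (coordMetric s y v)⁻¹ a l • pderiv l y v) u _ = _
    rw [this, _root_.sum_apply]
    refine Finset.sum_congr rfl fun l _ => ?_
    exact pderiv_smul ((contDiffAt_inv_apply (contDiffAt_coordMetric hy) hG a l).differentiableAt
      (by simp)) ((ContDiffAt.pderiv hy l).differentiableAt (by simp)) i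
  rw [h1]
  simp only [dot_sum_right, dot_add_right, dot_smul_right, dot_secondForm_pderiv hy hG, mul_zero,
    add_zero]
  refine Finset.sum_congr rfl fun l _ => ?_
  rw [pderiv_pderiv_eq (s := s) i l]
  simp [dot_add_right, dot_sum_right, dot_smul_right, dot_secondForm_pderiv hy hG]

/-- The product rule applied to `Γ^a_{jk} = ⟨∂_j ∂_k y, y^a⟩`, with `∂_j ∂_k y` split into normal
and tangential parts in the second term. The terms are grouped for the Ricci curvature: the third
derivative is symmetric in `i, j`, and the `ΓΓ` sum is the one that the formula for the Ricci
curvature adds back. -/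
lemma pderiv_christoffel (hev : ∀ᶠ v in nhds u, ContDiffAt ℝ ∞ y v)
    (hG : (coordMetric s y u).det ≠ 0)
    (i a j k : Fin n) :
    pderiv i (christoffel (coordMetric s y) a j k) u =
      dot s (pderiv i (pderiv j (pderiv k y)) u) (dualFrame s y a u)
      - ∑ l, christoffel (coordMetric s y) a i l u * christoffel (coordMetric s y) l j k u
      + ∑ l, (coordMetric s y u)⁻¹ a l *
        dot s (secondForm s y j k u) (secondForm s y i l u) := by
  have hy := hev.self_of_nhds
  have hchr : christoffel (coordMetric s y) a j k =ᶠ[nhds u]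
      fun v => dot s (pderiv j (pderiv k y) v) (dualFrame s y a v) := by
    filter_upwards [hev] with v hv using christoffel_eq hv a j k
  rw [pderiv_congr hchr, pderiv_dot
    ((ContDiffAt.pderiv (ContDiffAt.pderiv hy k) j).differentiableAt (by simp))
    ((contDiffAt_dualFrame hy hG a).differentiableAt (by simp))]
  rw [pderiv_pderiv_eq (s := s) j k, dot_add_left, dot_sum_left,
    dot_secondForm_pderiv_dualFrame hy hG]
  simp only [dot_smul_left, dot_pderiv_pderiv_dualFrame hy hG]
  have : ∑ x, christoffel (coordMetric s y) x j k u * -christoffel (coordMetric s y) a i x u =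
      -∑ l, christoffel (coordMetric s y) a i l u * christoffel (coordMetric s y) l j k u := by
    rw [← Finset.sum_neg_distrib]
    exact Finset.sum_congr rfl fun l _ => by ring
  rw [this]
  ring

lemma ricci_eq (hev : ∀ᶠ v in nhds u, ContDiffAt ℝ ∞ y v)
    (hG : (coordMetric s y u).det ≠ 0) (j k : Fin n) :
    ricci (coordMetric s y) j k u = ∑ i, ∑ l, (coordMetric s y u)⁻¹ i l *
      (dot s (secondForm s y j k u) (secondForm s y i l u)
        - dot s (secondForm s y i k u) (secondForm s y j l u)) := by
  unfold ricci
  refine Finset.sum_congr rfl fun i _ => ?_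
  rw [pderiv_christoffel hev hG, pderiv_christoffel hev hG,
    pderiv_comm (ContDiffAt.pderiv hev.self_of_nhds k) j i]
  simp only [mul_sub, Finset.sum_sub_distrib]
  ring

lemma laplacian_eq : laplacian (coordMetric s y) y u =
    ∑ i, ∑ j, (coordMetric s y u)⁻¹ i j • secondForm s y i j u := rfl

/-- The contracted Gauss equation. -/
lemma sum_inv_mul_ricci (hev : ∀ᶠ v in nhds u, ContDiffAt ℝ ∞ y v)
    (hG : (coordMetric s y u).det ≠ 0) :
    ∑ j, ∑ k, (coordMetric s y u)⁻¹ j k * ricci (coordMetric s y) j k u =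
      dot s (laplacian (coordMetric s y) y u) (laplacian (coordMetric s y) y u)
      - ∑ j, ∑ k, ∑ i, ∑ l, (coordMetric s y u)⁻¹ j k * (coordMetric s y u)⁻¹ i l *
        dot s (secondForm s y i k u) (secondForm s y j l u) := by
  simp only [ricci_eq hev hG, laplacian_eq, dot_sum_left, dot_sum_right, dot_smul_left,
    dot_smul_right, ← Finset.sum_sub_distrib, Finset.mul_sum]
  refine Finset.sum_congr rfl fun j _ => Finset.sum_congr rfl fun k _ =>
    Finset.sum_congr rfl fun i _ => Finset.sum_congr rfl fun l _ => ?_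
  rw [dot_comm (secondForm s y i l u) (secondForm s y j k u)]
  ring

lemma dot_laplacian_pderiv (hy : ContDiffAt ℝ ∞ y u) (hG : (coordMetric s y u).det ≠ 0)
    (l : Fin n) : dot s (laplacian (coordMetric s y) y u) (pderiv l y u) = 0 := by
  simp [laplacian_eq, dot_sum_left, dot_smul_left, dot_secondForm_pderiv hy hG]

lemma dot_laplacian_eq {v : Fin m → ℝ} (hv : ∀ k, dot s (pderiv k y u) v = 0) :
    dot s (laplacian (coordMetric s y) y u) v =
      ∑ i, ∑ j, (coordMetric s y u)⁻¹ i j * dot s (pderiv i (pderiv j y) u) v := by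
  simp [laplacian_eq, dot_sum_left, dot_smul_left, dot_secondForm_eq hv]

end Gauss

/-! ### Eigenbases and ordered eigenvalues -/

section Eigenbasis

variable {n m s : ℕ}

/-- An endomorphism that is self-adjoint for some inner product has an eigenbasis. -/
lemma exists_eigenbasis {V : Type*} [AddCommGroup V] [Module ℝ V] [FiniteDimensional ℝ V]
    (hn : Module.finrank ℝ V = n) (I : V →ₗ[ℝ] V →ₗ[ℝ] ℝ) (hI : ∀ x y, I x y = I y x)
    (hpos : ∀ x, x ≠ 0 → 0 < I x x) (T : Module.End ℝ V) (hT : ∀ x y, I (T x) y = I x (T y)) :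
    ∃ (b : Module.Basis (Fin n) ℝ V) (d : Fin n → ℝ), ∀ i, T (b i) = d i • b i := by
  -- The form `I` itself becomes the inner product. For it `T` is symmetric, so the spectral theorem
  -- applies.
  let core : InnerProductSpace.Core ℝ V :=
    { inner := fun x y => I x y
      conj_inner_symm := fun x y => by simp [hI x y]
      re_inner_nonneg := fun x => by
        by_cases hx : x = 0
        · simp [hx]
        · simpa using (hpos x hx).le
      add_left := fun x y z => by simp
      smul_left := fun x y r => by simp
      definite := fun x hx => by
        by_contra h
        exact (hpos x h).ne' hx }
  let _ : NormedAddCommGroup V := core.toNormedAddCommGroup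
  let _ : InnerProductSpace ℝ V := InnerProductSpace.ofCore core.toCore
  have hsym : T.IsSymmetric := hT
  exact ⟨(hsym.eigenvectorBasis hn).toBasis, hsym.eigenvalues hn, fun i => by
    simp [hsym.apply_eigenvectorBasis hn i]⟩

lemma toMatrix_eq_diagonal {V : Type*} [AddCommGroup V] [Module ℝ V]
    {T : Module.End ℝ V} {b : Module.Basis (Fin n) ℝ V} {d : Fin n → ℝ}
    (h : ∀ i, T (b i) = d i • b i) : LinearMap.toMatrix b b T = Matrix.diagonal d := by
  ext i j
  rw [LinearMap.toMatrix_apply, h]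
  by_cases hij : i = j
  · subst hij; simp
  · simp [hij]

lemma trace_eq_sum {V : Type*} [AddCommGroup V] [Module ℝ V]
    {T : Module.End ℝ V} {b : Module.Basis (Fin n) ℝ V} {d : Fin n → ℝ}
    (h : ∀ i, T (b i) = d i • b i) : LinearMap.trace ℝ V T = ∑ i, d i := by
  rw [LinearMap.trace_eq_matrix_trace ℝ b, toMatrix_eq_diagonal h, Matrix.trace_diagonal]

lemma trace_mul_self_eq_sum {V : Type*} [AddCommGroup V] [Module ℝ V]
    {T : Module.End ℝ V} {b : Module.Basis (Fin n) ℝ V} {d : Fin n → ℝ}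
    (h : ∀ i, T (b i) = d i • b i) : LinearMap.trace ℝ V (T * T) = ∑ i, d i ^ 2 :=
  trace_eq_sum fun i => by
    rw [Module.End.mul_apply, h, map_smul, h, smul_smul, sq]

/-- In an eigenbasis the characteristic polynomial is the product of the factors `X - d i`. Its
sorted list of roots and the list of the monotone `d` are sorted permutations of each other, hence
equal. -/
lemma orderedEigenvalue_eq {T : Module.End ℝ (E n)} {b : Module.Basis (Fin n) ℝ (E n)}
    {d : Fin n → ℝ} (h : ∀ i, T (b i) = d i • b i) (hd : Monotone d) (i : Fin n) :
    orderedEigenvalue T i = d i := by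
  have hroots : T.charpoly.roots = Multiset.map d Finset.univ.val := by
    rw [← LinearMap.charpoly_toMatrix T b, toMatrix_eq_diagonal h, Matrix.charpoly_diagonal,
      Polynomial.roots_prod _ _ (by simp [Finset.prod_ne_zero_iff, Polynomial.X_sub_C_ne_zero])]
    simp
  have hsort : T.charpoly.roots.sort (· ≤ ·) = List.ofFn d := by
    have hval : Multiset.map d Finset.univ.val = (List.ofFn d : Multiset ℝ) := by
      rw [Fin.univ_val_map]
    rw [hroots, hval]
    exact List.Perm.eq_of_pairwise' (Multiset.pairwise_sort _ _) hd.sortedLE_ofFn.pairwise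
      (Multiset.coe_eq_coe.1 (Multiset.sort_eq _ _))
  simp [orderedEigenvalue, hsort]

lemma exists_ordered_eigenbasis {T : Module.End ℝ (E n)} {b : Module.Basis (Fin n) ℝ (E n)}
    {d : Fin n → ℝ} (h : ∀ i, T (b i) = d i • b i) :
    Monotone (orderedEigenvalue T) ∧
      ∃ b : Module.Basis (Fin n) ℝ (E n), ∀ i, T (b i) = orderedEigenvalue T i • b i := by
  have h' : ∀ i, T ((b.reindex (Tuple.sort d).symm) i) =
      (d ∘ Tuple.sort d) i • (b.reindex (Tuple.sort d).symm) i := fun i => by simp [h]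
  have key := fun i => orderedEigenvalue_eq h' (Tuple.monotone_sort d) i
  refine ⟨fun i j hij => ?_, b.reindex (Tuple.sort d).symm, fun i => ?_⟩
  · rw [key, key]
    exact Tuple.monotone_sort d hij
  · rw [key, h']

lemma repr_apply {V : Type*} [AddCommGroup V] [Module ℝ V]
    {T : Module.End ℝ V} {b : Module.Basis (Fin n) ℝ V} {d : Fin n → ℝ}
    (h : ∀ i, T (b i) = d i • b i) (x : V) (i : Fin n) :
    b.repr (T x) i = d i * b.repr x i := by
  have : (b.coord i).comp T = d i • b.coord i := by
    refine b.ext fun j => ?_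
    by_cases hij : j = i
    · subst hij; simp [h]
    · simp [h, hij]
  exact LinearMap.congr_fun this x

lemma hasEigenvalue_iff {V : Type*} [AddCommGroup V] [Module ℝ V]
    {T : Module.End ℝ V} {b : Module.Basis (Fin n) ℝ V} {d : Fin n → ℝ}
    (h : ∀ i, T (b i) = d i • b i) (l : ℝ) : T.HasEigenvalue l ↔ ∃ i, d i = l := by
  constructor
  · intro hl
    obtain ⟨x, hx⟩ := hl.exists_hasEigenvector
    have hx0 := hx.2
    have hT := hx.apply_eq_smul
    by_contra! hne
    apply hx0
    refine b.ext_elem fun i => ?_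
    have h2 := repr_apply h x i
    rw [hT] at h2
    simp only [map_smul, Finsupp.smul_apply, smul_eq_mul] at h2
    have : (d i - l) * b.repr x i = 0 := by linarith
    simpa [sub_ne_zero.2 (hne i)] using this
  · rintro ⟨i, rfl⟩
    exact Module.End.hasEigenvalue_of_hasEigenvector
      (Module.End.hasEigenvector_iff.2 ⟨Module.End.mem_eigenspace_iff.2 (h i), b.ne_zero i⟩)

lemma repr_eq_zero_of_apply_eq_smul {V : Type*} [AddCommGroup V] [Module ℝ V]
    {T : Module.End ℝ V} {b : Module.Basis (Fin n) ℝ V} {d : Fin n → ℝ}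
    (h : ∀ i, T (b i) = d i • b i) {l : ℝ} {x : V} (hx : T x = l • x) {i : Fin n}
    (hi : d i ≠ l) : b.repr x i = 0 := by
  have h1 := repr_apply h x i
  rw [hx] at h1
  simp only [map_smul, Finsupp.smul_apply, smul_eq_mul] at h1
  have : (d i - l) * b.repr x i = 0 := by linarith
  simpa [sub_ne_zero.2 hi] using this

lemma aeval_apply_eigenvector {V : Type*} [AddCommGroup V] [Module ℝ V]
    {T : Module.End ℝ V} {x : V} {l : ℝ} (hx : T x = l • x) (p : Polynomial ℝ) :
    Polynomial.aeval T p x = p.eval l • x := by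
  by_cases h0 : x = 0
  · simp [h0]
  · exact Module.End.aeval_apply_of_hasEigenvector
      (Module.End.hasEigenvector_iff.2 ⟨Module.End.mem_eigenspace_iff.2 hx, h0⟩)

/-- For an endomorphism with an eigenbasis, the image and the kernel of `T - l` are
independent. -/
lemma eq_zero_of_sub_smul {V : Type*} [AddCommGroup V] [Module ℝ V]
    {T : Module.End ℝ V} {b : Module.Basis (Fin n) ℝ V} {d : Fin n → ℝ}
    (h : ∀ i, T (b i) = d i • b i) {l : ℝ} {x z : V} (hx : T x = l • x)
    (hz : T z - l • z = x) : x = 0 := by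
  refine b.ext_elem fun i => ?_
  by_cases hi : d i = l
  · rw [← hz]
    simp [repr_apply h, hi]
  · simpa using repr_eq_zero_of_apply_eq_smul h hx hi

end Eigenbasis

/-! ### Raising an index -/

section RaiseIndex

variable {n m s : ℕ} {D D' : E n →ₗ[ℝ] (Fin m → ℝ)}

/-- The Gram matrix of a positive definite form is invertible. -/
lemma det_gram_ne_zero (hD : ∀ X, X ≠ 0 → 0 < dot s (D X) (D X)) :
    (Matrix.of fun i j : Fin n =>
      dot s (D (EuclideanSpace.single i 1)) (D (EuclideanSpace.single j 1))).det ≠ 0 := by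
  intro h
  obtain ⟨v, hv, hv0⟩ := Matrix.exists_mulVec_eq_zero_iff.2 h
  let X : E n := WithLp.toLp 2 v
  have hX : X ≠ 0 := by simpa [X] using hv
  have hDX : D X = ∑ i, v i • D (EuclideanSpace.single i 1) := by
    conv_lhs => rw [← (EuclideanSpace.basisFun (Fin n) ℝ).sum_repr X]
    simp [X]
  have : dot s (D X) (D X) = 0 := by
    have h2 : ∀ i, dot s (D (EuclideanSpace.single i 1)) (D X) = 0 := by
      intro i
      have := congrFun hv0 i
      simp only [Matrix.mulVec, dotProduct, Matrix.of_apply, Pi.zero_apply] at this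
      rw [hDX, dot_sum_right]
      simp only [dot_smul_right]
      rw [← this]
      exact Finset.sum_congr rfl fun j _ => mul_comm _ _
    nth_rewrite 1 [hDX]
    simp [dot_sum_left, dot_smul_left, h2]
  exact (hD X hX).ne' this

lemma ext_of_dot (hD : ∀ X, X ≠ 0 → 0 < dot s (D X) (D X)) {X Y : E n}
    (h : ∀ Z, dot s (D X) (D Z) = dot s (D Y) (D Z)) : X = Y := by
  by_contra hne
  have := hD (X - Y) (sub_ne_zero.2 hne)
  rw [map_sub, dot_sub_left, ← map_sub, h (X - Y)] at this
  simp at this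

lemma injective_of_dot_pos (hD : ∀ X, X ≠ 0 → 0 < dot s (D X) (D X)) : Function.Injective D :=
  fun _ _ h => ext_of_dot hD fun _ => by rw [h]

/-- Replaces the matrix definition of `raiseIndex` by its coordinate-free characterisation. On basis
vectors it amounts to `G (G⁻¹ A) = A`. -/
lemma raiseIndex_spec (hD : ∀ X, X ≠ 0 → 0 < dot s (D X) (D X)) (X Z : E n) :
    dot s (D (raiseIndex (fun X Z => dot s (D X) (D Z)) (fun X Z => dot s (D' X) (D Z)) X)) (D Z)
      = dot s (D' X) (D Z) := by
  set T := raiseIndex (fun X Z => dot s (D X) (D Z)) (fun X Z => dot s (D' X) (D Z)) with hT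
  let e := (EuclideanSpace.basisFun (Fin n) ℝ).toBasis
  let G : Matrix (Fin n) (Fin n) ℝ := Matrix.of fun i j => dot s (D (e i)) (D (e j))
  let A : Matrix (Fin n) (Fin n) ℝ := Matrix.of fun i j => dot s (D' (e j)) (D (e i))
  have hG : G.det ≠ 0 := by simpa [G, e] using det_gram_ne_zero hD
  let B1 : E n →ₗ[ℝ] E n →ₗ[ℝ] ℝ := ((dotL m s).toLinearMap₁₂.comp (D ∘ₗ T)).compl₂ D
  let B2 : E n →ₗ[ℝ] E n →ₗ[ℝ] ℝ := ((dotL m s).toLinearMap₁₂.comp D').compl₂ D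
  have key : B1 = B2 := by
    refine e.ext fun j => e.ext fun k => ?_
    change dot s (D (T (e j))) (D (e k)) = dot s (D' (e j)) (D (e k))
    have h1 : T (e j) = ∑ i, (G⁻¹ * A) i j • e i := by
      change Matrix.toLin e e (G⁻¹ * A) (e j) = _
      rw [Matrix.toLin_self]
    have h2 : (G * (G⁻¹ * A)) k j = A k j := by
      rw [← Matrix.mul_assoc, Matrix.mul_nonsing_inv _ hG.isUnit, Matrix.one_mul]
    rw [h1, map_sum, dot_sum_left]
    change _ = A k j
    rw [← h2, Matrix.mul_apply]
    refine Finset.sum_congr rfl fun i _ => ?_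
    rw [map_smul, dot_smul_left, dot_comm, mul_comm]
    rfl
  exact LinearMap.congr_fun (LinearMap.congr_fun key X) Z

lemma raiseIndex_unique (hD : ∀ X, X ≠ 0 → 0 < dot s (D X) (D X)) {T : Module.End ℝ (E n)}
    (hT : ∀ X Z, dot s (D (T X)) (D Z) = dot s (D' X) (D Z)) :
    raiseIndex (fun X Z => dot s (D X) (D Z)) (fun X Z => dot s (D' X) (D Z)) = T := by
  refine LinearMap.ext fun X => ext_of_dot hD fun Z => ?_
  rw [raiseIndex_spec hD, hT]

lemma exists_eigenbasis_raiseIndex (hD : ∀ X, X ≠ 0 → 0 < dot s (D X) (D X))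
    (hsymm : ∀ X Z, dot s (D' X) (D Z) = dot s (D' Z) (D X)) :
    ∃ (b : Module.Basis (Fin n) ℝ (E n)) (d : Fin n → ℝ), ∀ i,
      raiseIndex (fun X Z => dot s (D X) (D Z)) (fun X Z => dot s (D' X) (D Z)) (b i) =
        d i • b i := by
  refine exists_eigenbasis (by simp) (((dotL m s).toLinearMap₁₂.comp D).compl₂ D)
    (fun X Z => dot_comm _ _) (fun X hX => hD X hX) _ fun X Z => ?_
  change dot s (D _) (D _) = dot s (D _) (D _)
  rw [raiseIndex_spec hD, dot_comm (D X), raiseIndex_spec hD, hsymm]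

end RaiseIndex

/-! ### Frames adapted to a spacelike hypersurface in the light cone -/

section Frame

variable {n : ℕ}

/-- The data of a spacelike hypersurface at a point, in terms of the light cone: the vector `y` of
the light cone, its differential `D`, the unit normal `w`, and a constant vector `q` that fixes
the lift to the light cone. -/
structure ConeFrame (D : E n →ₗ[ℝ] (Fin (n + 3) → ℝ)) (w y q : Fin (n + 3) → ℝ) (κ : ℝ) :
    Prop where
  pos : ∀ X, X ≠ 0 → 0 < dot 2 (D X) (D X)
  yy : dot 2 y y = 0
  ww : dot 2 w w = -1
  wy : dot 2 w y = 0
  wD : ∀ X, dot 2 w (D X) = 0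
  yD : ∀ X, dot 2 y (D X) = 0
  qD : ∀ X, dot 2 q (D X) = 0
  wq : dot 2 w q = 0
  yq : dot 2 y q = κ
  κ_ne : κ ≠ 0

variable {D : E n →ₗ[ℝ] (Fin (n + 3) → ℝ)} {w y q : Fin (n + 3) → ℝ} {κ : ℝ}

/-- The image of `D` and the vectors `w`, `y`, `q` span: they are independent and their number is `n
+ 3`. The claim follows since the product is nondegenerate. It reduces every vector identity below
to a few scalar ones. -/
lemma ConeFrame.ext (h : ConeFrame D w y q κ) {v v' : Fin (n + 3) → ℝ}
    (hD : ∀ X, dot 2 v (D X) = dot 2 v' (D X)) (hw : dot 2 v w = dot 2 v' w)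
    (hy : dot 2 v y = dot 2 v' y) (hq : dot 2 v q = dot 2 v' q) : v = v' := by
  let K : (E n × (Fin 3 → ℝ)) →ₗ[ℝ] (Fin (n + 3) → ℝ) :=
    D.coprod (Fintype.linearCombination ℝ ![w, y, q])
  have hK : ∀ p, K p = D p.1 + (p.2 0 • w + p.2 1 • y + p.2 2 • q) := by
    intro p
    simp [K, Fintype.linearCombination_apply, Fin.sum_univ_three]
  have hinj : Function.Injective K := by
    rw [← LinearMap.ker_eq_bot, LinearMap.ker_eq_bot']
    rintro ⟨X, a⟩ h0
    rw [hK] at h0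
    -- In a vanishing combination, the product with `y` isolates the coefficient of `q`, then the
    -- product with `q` that of `y`. The product with `w` gives that of `w`, and positivity removes
    -- `X`.
    have h1 := congrArg (dot 2 y) h0
    have h2 := congrArg (dot 2 q) h0
    have h3 := congrArg (dot 2 w) h0
    have h4 := congrArg (dot 2 (D X)) h0
    simp only [dot_add_right, dot_smul_right, dot_zero_right, h.yD, h.qD, h.wD, h.yy, h.ww, h.yq,
      h.wq, h.wy, dot_comm y w, dot_comm q w, dot_comm q y, dot_comm (D X) w, dot_comm (D X) y,
      dot_comm (D X) q] at h1 h2 h3 h4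
    have ha2 : a 2 = 0 := by simpa [h.κ_ne] using h1
    have ha1 : a 1 = 0 := by simpa [h.κ_ne, ha2] using h2
    have ha0 : a 0 = 0 := by simpa using h3
    have hX : X = 0 := by
      by_contra hX
      have := h.pos X hX
      simp at h4
      linarith
    refine Prod.ext hX ?_
    funext i
    fin_cases i <;> simp [ha0, ha1, ha2]
  have hsurj : Function.Surjective K :=
    (LinearMap.injective_iff_surjective_of_finrank_eq_finrank (by simp)).1 hinj
  refine sub_eq_zero.1 (eq_zero_of_forall_dot_eq_zero (s := 2) fun z => ?_)
  obtain ⟨p, rfl⟩ := hsurj z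
  rw [hK]
  simp only [dot_sub_left, dot_add_right, dot_smul_right, hD, hw, hy, hq]
  ring

/-- The second fundamental form of a spacelike hypersurface in the light cone is determined by its
products with `w` and `y`. -/
lemma ConeFrame.eq_of_dot (h : ConeFrame D w y q κ) {v : Fin (n + 3) → ℝ} {a b : ℝ}
    (hD : ∀ X, dot 2 v (D X) = 0) (hw : dot 2 v w = -a) (hy : dot 2 v y = -b)
    (hq : dot 2 v q = 0) :
    v = a • w + b • ((dot 2 q q / κ ^ 2) • y - κ⁻¹ • q) := by
  have hκ := h.κ_ne
  -- The vector multiplied by `b` is chosen to have product `-1` with `y` and product `0` with `w`,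
  -- `q` and all tangent vectors.
  refine h.ext (fun X => ?_) ?_ ?_ ?_ <;>
  simp only [dot_add_left, dot_sub_left, dot_smul_left, hD, hw, hy, hq, h.yD, h.qD, h.wD, h.yy,
    h.ww, h.yq, h.wq, h.wy, dot_comm y w, dot_comm q w, dot_comm q y] <;> field_simp <;> ring

/-- The conformal normal is determined by its orthogonality properties and its sign. -/
lemma ConeFrame.normal_eq (h : ConeFrame D w y q κ) {ξ L : Fin (n + 3) → ℝ} {ρ t : ℝ}
    (hρ : 0 < ρ) (hn : n ≠ 0) (hξy : dot 2 ξ y = 0) (hξD : ∀ X, dot 2 ξ (D X) = 0)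
    (hξL : dot 2 ξ L = 0) (hξξ : dot 2 ξ ξ = -1) (hξw : dot 2 ξ w < 0)
    (hLy : dot 2 L y = -n / ρ) (hLw : dot 2 L w = -t / ρ) :
    ξ = w - (t / n) • y := by
  have hκ := h.κ_ne
  have hn' : (n : ℝ) ≠ 0 := by exact_mod_cast hn
  -- Being orthogonal to `y` and to the tangent vectors, `ξ` lies in the span of `w` and `y`. Its
  -- norm and sign then fix the coefficient of `w`, and orthogonality to `L` fixes that of `y`.
  have h1 : ξ = (-dot 2 ξ w) • w + (dot 2 ξ q / κ) • y := by
    refine h.ext (fun X => ?_) ?_ ?_ ?_ <;>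
    simp only [dot_add_left, dot_smul_left, hξy, hξD, h.yD, h.wD, h.yy,
      h.ww, h.yq, h.wq, h.wy, dot_comm y w] <;> field_simp <;> ring
  have h2 : dot 2 ξ w = -1 := by
    have : dot 2 ξ ξ = -(dot 2 ξ w) ^ 2 := by
      nth_rewrite 2 [h1]
      simp only [dot_add_right, dot_smul_right, hξy]
      ring
    nlinarith
  have h3 : dot 2 ξ q / κ = -(t / n) := by
    have : dot 2 ξ L = -t / ρ + (dot 2 ξ q / κ) * (-n / ρ) := by
      nth_rewrite 1 [h1]
      simp only [dot_add_left, dot_smul_left, dot_comm w L, dot_comm y L, hLy, hLw, h2]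
      ring
    rw [hξL] at this
    have h4 : ρ ≠ 0 := hρ.ne'
    generalize dot 2 ξ q / κ = c at this ⊢
    field_simp at this ⊢
    linarith
  rw [h1, h2, h3]
  module

end Frame

/-! ### Spacelike hypersurfaces in the light cone, in coordinates -/

section LocalCone

variable {n : ℕ}

/-- A spacelike hypersurface in the light cone with unit normal `w`, on an open set of
coordinates. -/
structure IsLocalCone (y w : E n → Fin (n + 3) → ℝ) (q : Fin (n + 3) → ℝ) (κ : ℝ)
    (U : Set (E n)) : Prop where
  isOpen : IsOpen U
  smooth_y : ∀ u ∈ U, ContDiffAt ℝ ∞ y u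
  smooth_w : ∀ u ∈ U, ContDiffAt ℝ ∞ w u
  yy : ∀ u ∈ U, dot 2 (y u) (y u) = 0
  ww : ∀ u ∈ U, dot 2 (w u) (w u) = -1
  wy : ∀ u ∈ U, dot 2 (w u) (y u) = 0
  wdy : ∀ u ∈ U, ∀ X, dot 2 (w u) (fderiv ℝ y u X) = 0
  pos : ∀ u ∈ U, ∀ X, X ≠ 0 → 0 < dot 2 (fderiv ℝ y u X) (fderiv ℝ y u X)
  wq : ∀ u ∈ U, dot 2 (w u) q = 0
  yq : ∀ u ∈ U, dot 2 (y u) q = κ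
  κ_ne : κ ≠ 0

/-- The shape operator in coordinates. -/
noncomputable def coordShape (y w : E n → Fin (n + 3) → ℝ) (u : E n) : Module.End ℝ (E n) :=
  raiseIndex (fun X Z => dot 2 (fderiv ℝ y u X) (fderiv ℝ y u Z))
    (fun X Z => dot 2 (fderiv ℝ w u X) (fderiv ℝ y u Z))

/-- The coefficients of the second fundamental form `⟨dw, dy⟩`. -/
noncomputable def coordSecond (y w : E n → Fin (n + 3) → ℝ) (u : E n) :
    Matrix (Fin n) (Fin n) ℝ :=
  Matrix.of fun i j => dot 2 (pderiv i w u) (pderiv j y u)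

variable {y w : E n → Fin (n + 3) → ℝ} {q : Fin (n + 3) → ℝ} {κ : ℝ} {U : Set (E n)} {u : E n}

lemma fderiv_dot_eq_zero {F : Type*} [NormedAddCommGroup F] [NormedSpace ℝ F] {m s : ℕ}
    {f g : F → Fin m → ℝ} {U : Set F} {u : F} {a : ℝ} (hU : IsOpen U) (hu : u ∈ U)
    (hf : DifferentiableAt ℝ f u) (hg : DifferentiableAt ℝ g u)
    (h : ∀ v ∈ U, dot s (f v) (g v) = a) (X : F) :
    dot s (fderiv ℝ f u X) (g u) + dot s (f u) (fderiv ℝ g u X) = 0 := by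
  have hev : (fun v => dot s (f v) (g v)) =ᶠ[nhds u] fun _ => a :=
    Filter.eventuallyEq_of_mem (hU.mem_nhds hu) h
  rw [← fderiv_dot hf hg, hev.fderiv_eq]
  simp

namespace IsLocalCone

lemma diff_y (h : IsLocalCone y w q κ U) (hu : u ∈ U) : DifferentiableAt ℝ y u :=
  (h.smooth_y u hu).differentiableAt (by simp)

lemma diff_w (h : IsLocalCone y w q κ U) (hu : u ∈ U) : DifferentiableAt ℝ w u :=
  (h.smooth_w u hu).differentiableAt (by simp)

lemma eventually (h : IsLocalCone y w q κ U) (hu : u ∈ U) :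
    ∀ᶠ v in nhds u, ContDiffAt ℝ ∞ y v :=
  Filter.eventually_of_mem (h.isOpen.mem_nhds hu) h.smooth_y

lemma ydy (h : IsLocalCone y w q κ U) (hu : u ∈ U) (X : E n) :
    dot 2 (y u) (fderiv ℝ y u X) = 0 := by
  have := fderiv_dot_eq_zero h.isOpen hu (h.diff_y hu) (h.diff_y hu) h.yy X
  rw [dot_comm (y u)] at this ⊢
  linarith

lemma qdy (h : IsLocalCone y w q κ U) (hu : u ∈ U) (X : E n) :
    dot 2 q (fderiv ℝ y u X) = 0 := by
  have := fderiv_dot_eq_zero h.isOpen hu (h.diff_y hu) (differentiableAt_const q) h.yq X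
  simpa [dot_zero_right, dot_comm q] using this

lemma frame (h : IsLocalCone y w q κ U) (hu : u ∈ U) :
    ConeFrame (fderiv ℝ y u).toLinearMap (w u) (y u) q κ where
  pos := h.pos u hu
  yy := h.yy u hu
  ww := h.ww u hu
  wy := h.wy u hu
  wD := h.wdy u hu
  yD := h.ydy hu
  qD := h.qdy hu
  wq := h.wq u hu
  yq := h.yq u hu
  κ_ne := h.κ_ne

lemma coordShape_spec (h : IsLocalCone y w q κ U) (hu : u ∈ U) (X Z : E n) :
    dot 2 (fderiv ℝ y u (coordShape y w u X)) (fderiv ℝ y u Z) =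
      dot 2 (fderiv ℝ w u X) (fderiv ℝ y u Z) :=
  raiseIndex_spec (D := (fderiv ℝ y u).toLinearMap) (D' := (fderiv ℝ w u).toLinearMap)
    (h.pos u hu) X Z

lemma dwy (h : IsLocalCone y w q κ U) (hu : u ∈ U) (X : E n) :
    dot 2 (fderiv ℝ w u X) (y u) = 0 := by
  have := fderiv_dot_eq_zero h.isOpen hu (h.diff_w hu) (h.diff_y hu) h.wy X
  rwa [h.wdy u hu, add_zero] at this

/-- The Weingarten formula. -/
lemma fderiv_w (h : IsLocalCone y w q κ U) (hu : u ∈ U) (X : E n) :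
    fderiv ℝ w u X = fderiv ℝ y u (coordShape y w u X) := by
  have hf := h.frame hu
  -- The products with tangent vectors agree by definition of the shape operator. Those with `w`,
  -- `y`, `q` vanish on both sides, since the products of `w` with these vectors are constant and
  -- `w` is normal.
  refine hf.ext (fun Z => (h.coordShape_spec hu X Z).symm) ?_ ?_ ?_
  · have := fderiv_dot_eq_zero h.isOpen hu (h.diff_w hu) (h.diff_w hu) h.ww X
    rw [dot_comm (w u)] at this
    rw [dot_comm (fderiv ℝ y u _), h.wdy u hu]
    linarith
  · rw [h.dwy hu, dot_comm, h.ydy hu]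
  · have := fderiv_dot_eq_zero h.isOpen hu (h.diff_w hu) (differentiableAt_const q) h.wq X
    rw [dot_comm _ q, dot_comm _ q, h.qdy hu]
    simpa [dot_zero_right, dot_comm q] using this

lemma dot_pderiv_pderiv_w (h : IsLocalCone y w q κ U) (hu : u ∈ U) (i j : Fin n) :
    dot 2 (pderiv i (pderiv j y) u) (w u) = -dot 2 (pderiv i w u) (pderiv j y u) := by
  have := fderiv_dot_eq_zero h.isOpen hu (h.diff_w hu)
    ((ContDiffAt.pderiv (h.smooth_y u hu) j).differentiableAt (by simp))
    (fun v hv => h.wdy v hv _) (EuclideanSpace.single i 1)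
  rw [dot_comm]
  exact eq_neg_of_add_eq_zero_right this

/-- Both entries equal `-⟨∂_i ∂_j y, w⟩`, and partial derivatives commute. -/
lemma coordSecond_comm (h : IsLocalCone y w q κ U) (hu : u ∈ U) (i j : Fin n) :
    coordSecond y w u i j = coordSecond y w u j i := by
  have h1 := h.dot_pderiv_pderiv_w hu i j
  rw [pderiv_comm (h.smooth_y u hu), h.dot_pderiv_pderiv_w hu j i] at h1
  simpa [coordSecond] using h1.symm

lemma dot_dw_dy_comm (h : IsLocalCone y w q κ U) (hu : u ∈ U) (X Z : E n) :
    dot 2 (fderiv ℝ w u X) (fderiv ℝ y u Z) = dot 2 (fderiv ℝ w u Z) (fderiv ℝ y u X) := by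
  simp only [fderiv_eq_sum_pderiv, dot_sum_left, dot_sum_right, dot_smul_left, dot_smul_right,
    Finset.mul_sum]
  rw [Finset.sum_comm]
  refine Finset.sum_congr rfl fun j _ => Finset.sum_congr rfl fun i _ => ?_
  have := h.coordSecond_comm hu j i
  simp only [coordSecond, Matrix.of_apply] at this
  rw [this]
  ring

lemma det_ne_zero (h : IsLocalCone y w q κ U) (hu : u ∈ U) : (coordMetric 2 y u).det ≠ 0 :=
  det_gram_ne_zero (D := (fderiv ℝ y u).toLinearMap) (h.pos u hu)

lemma exists_eigenbasis (h : IsLocalCone y w q κ U) (hu : u ∈ U) :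
    ∃ (b : Module.Basis (Fin n) ℝ (E n)) (d : Fin n → ℝ), ∀ i,
      coordShape y w u (b i) = d i • b i :=
  exists_eigenbasis_raiseIndex (D := (fderiv ℝ y u).toLinearMap)
    (D' := (fderiv ℝ w u).toLinearMap) (h.pos u hu) (h.dot_dw_dy_comm hu)

lemma toMatrix_coordShape (h : IsLocalCone y w q κ U) (hu : u ∈ U) :
    LinearMap.toMatrix (EuclideanSpace.basisFun (Fin n) ℝ).toBasis
      (EuclideanSpace.basisFun (Fin n) ℝ).toBasis (coordShape y w u) =
      (coordMetric 2 y u)⁻¹ * coordSecond y w u := by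
  have h1 : coordShape y w u = Matrix.toLin (EuclideanSpace.basisFun (Fin n) ℝ).toBasis
      (EuclideanSpace.basisFun (Fin n) ℝ).toBasis
      ((coordMetric 2 y u)⁻¹ * (coordSecond y w u).transpose) := by
    simp only [coordShape, raiseIndex, OrthonormalBasis.coe_toBasis,
      EuclideanSpace.basisFun_apply]
    rfl
  have h2 : (coordSecond y w u).transpose = coordSecond y w u := by
    ext i j
    exact h.coordSecond_comm hu j i
  rw [h1, LinearMap.toMatrix_toLin, h2]

lemma trace_coordShape (h : IsLocalCone y w q κ U) (hu : u ∈ U) :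
    LinearMap.trace ℝ (E n) (coordShape y w u) =
      ((coordMetric 2 y u)⁻¹ * coordSecond y w u).trace := by
  rw [LinearMap.trace_eq_matrix_trace ℝ (EuclideanSpace.basisFun (Fin n) ℝ).toBasis,
    h.toMatrix_coordShape hu]

lemma trace_coordShape_mul_self (h : IsLocalCone y w q κ U) (hu : u ∈ U) :
    LinearMap.trace ℝ (E n) (coordShape y w u * coordShape y w u) =
      ((coordMetric 2 y u)⁻¹ * coordSecond y w u *
        ((coordMetric 2 y u)⁻¹ * coordSecond y w u)).trace := by
  rw [LinearMap.trace_eq_matrix_trace ℝ (EuclideanSpace.basisFun (Fin n) ℝ).toBasis,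
    LinearMap.toMatrix_mul, h.toMatrix_coordShape hu]

/-- The Gauss formula for a spacelike hypersurface in the light cone. -/
lemma secondForm_eq (h : IsLocalCone y w q κ U) (hu : u ∈ U) (i j : Fin n) :
    secondForm 2 y i j u = coordSecond y w u i j • w u +
      coordMetric 2 y u i j • ((dot 2 q q / κ ^ 2) • y u - κ⁻¹ • q) := by
  have hy := h.smooth_y u hu
  have hd : DifferentiableAt ℝ (pderiv j y) u :=
    (ContDiffAt.pderiv hy j).differentiableAt (by simp)
  refine (h.frame hu).eq_of_dot (fun X => ?_) ?_ ?_ ?_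
  · change dot 2 _ (fderiv ℝ y u X) = 0
    simp [fderiv_eq_sum_pderiv, dot_sum_right, dot_smul_right,
      dot_secondForm_pderiv hy (h.det_ne_zero hu)]
  · rw [dot_secondForm_eq fun k => by rw [dot_comm]; exact h.wdy u hu _,
      h.dot_pderiv_pderiv_w hu]
    rfl
  · rw [dot_secondForm_eq fun k => by rw [dot_comm]; exact h.ydy hu _]
    have := fderiv_dot_eq_zero h.isOpen hu (h.diff_y hu) hd
      (fun v hv => h.ydy hv _) (EuclideanSpace.single i 1)
    rw [dot_comm]
    exact eq_neg_of_add_eq_zero_right this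
  · rw [dot_secondForm_eq fun k => by rw [dot_comm]; exact h.qdy hu _]
    have := fderiv_dot_eq_zero h.isOpen hu (differentiableAt_const q) hd
      (fun v hv => h.qdy hv _) (EuclideanSpace.single i 1)
    rw [dot_comm]
    change dot 2 q (fderiv ℝ (pderiv j y) u (EuclideanSpace.single i 1)) = 0
    simpa [dot_zero_left] using this

end IsLocalCone

lemma sum_mul_eq_trace (A P : Matrix (Fin n) (Fin n) ℝ) (hP : ∀ i j, P i j = P j i) :
    ∑ i, ∑ j, A i j * P i j = (A * P).trace := by
  simp only [Matrix.trace, Matrix.diag, Matrix.mul_apply]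
  exact Finset.sum_congr rfl fun i _ => Finset.sum_congr rfl fun j _ => by rw [hP]

lemma sum_mul_mul_eq_trace (A P : Matrix (Fin n) (Fin n) ℝ) (hP : ∀ i j, P i j = P j i) :
    ∑ j, ∑ k, ∑ i, ∑ l, A j k * A i l * (P i k * P j l) = (A * P * (A * P)).trace := by
  simp only [Matrix.trace, Matrix.diag, Matrix.mul_apply, Finset.sum_mul_sum]
  refine Finset.sum_congr rfl fun j _ => ?_
  rw [Finset.sum_comm]
  refine Finset.sum_congr rfl fun i _ => Finset.sum_congr rfl fun k _ =>
    Finset.sum_congr rfl fun l _ => ?_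
  rw [hP i k, hP j l]
  ring

namespace IsLocalCone

/-- The factor of the conformal metric in terms of the shape operator. -/
lemma factor_eq (h : IsLocalCone y w q κ U) (hu : u ∈ U) (hn : 2 ≤ n) :
    (n : ℝ) ^ 2 * normalizedScalarCurvature (coordMetric 2 y) u
      - dot 2 (laplacian (coordMetric 2 y) y u) (laplacian (coordMetric 2 y) y u) =
      n / (n - 1) * (LinearMap.trace ℝ (E n) (coordShape y w u * coordShape y w u)
        - (LinearMap.trace ℝ (E n) (coordShape y w u)) ^ 2 / n) := by
  have hf := h.frame hu
  have hκ := h.κ_ne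
  have hG := h.det_ne_zero hu
  -- Here `e` is the normal vector that multiplies the metric in the Gauss formula. It is orthogonal
  -- to `w`, so the products of the second fundamental form split into a part from `A` and a
  -- multiple of `⟨e, e⟩`.
  set e : Fin (n + 3) → ℝ := (dot 2 q q / κ ^ 2) • y u - κ⁻¹ • q with he
  have hew : dot 2 (w u) e = 0 := by
    simp [he, dot_sub_right, dot_smul_right, hf.wy, hf.wq]
  set G := coordMetric 2 y u with hGdef
  set P := coordSecond y w u with hPdef
  have hGs : ∀ i j, G i j = G j i := coordMetric_comm
  have hPs : ∀ i j, P i j = P j i := h.coordSecond_comm hu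
  have hinv : G⁻¹ * G = 1 := Matrix.nonsing_inv_mul _ hG.isUnit
  have h1 : laplacian (coordMetric 2 y) y u = (G⁻¹ * P).trace • w u + (n : ℝ) • e := by
    rw [laplacian_eq, ← sum_mul_eq_trace _ _ hPs]
    have : (n : ℝ) = ∑ i, ∑ j, G⁻¹ i j * G i j := by
      rw [sum_mul_eq_trace _ _ hGs, hinv]
      simp
    rw [this]
    simp only [h.secondForm_eq hu, smul_add, Finset.sum_add_distrib, Finset.sum_smul, mul_smul]
    rfl
  have h2 : ∀ i j k l, dot 2 (secondForm 2 y i j u) (secondForm 2 y k l u) =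
      -(P i j * P k l) + dot 2 e e * (G i j * G k l) := by
    intro i j k l
    rw [h.secondForm_eq hu, h.secondForm_eq hu, ← he]
    simp only [dot_add_left, dot_add_right, dot_smul_left, dot_smul_right, hf.ww, hew,
      dot_comm e (w u)]
    ring
  have h3 : ∑ j, ∑ k, ∑ i, ∑ l, G⁻¹ j k * G⁻¹ i l *
        dot 2 (secondForm 2 y i k u) (secondForm 2 y j l u) =
      -(G⁻¹ * P * (G⁻¹ * P)).trace + dot 2 e e * n := by
    rw [← sum_mul_mul_eq_trace _ _ hPs]
    have : (n : ℝ) = ∑ j, ∑ k, ∑ i, ∑ l, G⁻¹ j k * G⁻¹ i l * (G i k * G j l) := by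
      rw [sum_mul_mul_eq_trace _ _ hGs, hinv]
      simp
    rw [this]
    simp only [Finset.mul_sum, ← Finset.sum_neg_distrib, ← Finset.sum_add_distrib, h2]
    refine Finset.sum_congr rfl fun j _ => Finset.sum_congr rfl fun k _ =>
      Finset.sum_congr rfl fun i _ => Finset.sum_congr rfl fun l _ => ?_
    ring
  -- The scalar curvature contributes `(n² - n) ⟨e, e⟩` before normalisation, hence `n² ⟨e, e⟩` to
  -- the factor, and this cancels against `⟨Δy, Δy⟩`. The result therefore does not depend on `q`.
  rw [h.trace_coordShape hu, h.trace_coordShape_mul_self hu, normalizedScalarCurvature,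
    sum_inv_mul_ricci (h.eventually hu) hG, h3, h1]
  simp only [dot_add_left, dot_add_right, dot_smul_left, dot_smul_right, hf.ww, hew,
    dot_comm e (w u)]
  have hn0 : (n : ℝ) ≠ 0 := by positivity
  have hn1 : (n : ℝ) - 1 ≠ 0 := by
    have : (2 : ℝ) ≤ n := by exact_mod_cast hn
    linarith
  field_simp
  ring

/-! ### Smooth dependence of the shape operator and its traces on the point -/

lemma contDiffAt_coordSecond (h : IsLocalCone y w q κ U) (hu : u ∈ U) (i j : Fin n) :
    ContDiffAt ℝ ∞ (fun v => coordSecond y w v i j) u :=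
  contDiffAt_dot (ContDiffAt.pderiv (h.smooth_w u hu) i) (ContDiffAt.pderiv (h.smooth_y u hu) j)

lemma contDiffAt_matrix (h : IsLocalCone y w q κ U) (hu : u ∈ U) (i j : Fin n) :
    ContDiffAt ℝ ∞ (fun v => ((coordMetric 2 y v)⁻¹ * coordSecond y w v) i j) u := by
  simp only [Matrix.mul_apply]
  exact ContDiffAt.sum fun k _ => (contDiffAt_inv_apply (contDiffAt_coordMetric (h.smooth_y u hu))
    (h.det_ne_zero hu) i k).mul (h.contDiffAt_coordSecond hu k j)

/-- Single principal curvatures need not be smooth where they meet, so the smoothness of `H` and `ρ`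
is drawn from traces. -/
lemma contDiffAt_trace (h : IsLocalCone y w q κ U) (hu : u ∈ U) :
    ContDiffAt ℝ ∞ (fun v => LinearMap.trace ℝ (E n) (coordShape y w v)) u := by
  refine ContDiffAt.congr_of_eventuallyEq
    (f := fun v => ((coordMetric 2 y v)⁻¹ * coordSecond y w v).trace) ?_
    (Filter.eventuallyEq_of_mem (h.isOpen.mem_nhds hu) fun v hv => h.trace_coordShape hv)
  exact ContDiffAt.sum fun i _ => h.contDiffAt_matrix hu i i

lemma contDiffAt_trace_mul_self (h : IsLocalCone y w q κ U) (hu : u ∈ U) :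
    ContDiffAt ℝ ∞
      (fun v => LinearMap.trace ℝ (E n) (coordShape y w v * coordShape y w v)) u := by
  refine ContDiffAt.congr_of_eventuallyEq
    (f := fun v => ((coordMetric 2 y v)⁻¹ * coordSecond y w v *
      ((coordMetric 2 y v)⁻¹ * coordSecond y w v)).trace) ?_
    (Filter.eventuallyEq_of_mem (h.isOpen.mem_nhds hu) fun v hv => h.trace_coordShape_mul_self hv)
  refine ContDiffAt.sum fun i _ => ?_
  simp only [Matrix.diag, Matrix.mul_apply (M := (coordMetric 2 y _)⁻¹ * coordSecond y w _)]
  exact ContDiffAt.sum fun k _ => (h.contDiffAt_matrix hu i k).mul (h.contDiffAt_matrix hu k i)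

lemma contDiffAt_coordShape_apply (h : IsLocalCone y w q κ U) (hu : u ∈ U) {f : E n → E n}
    (hf : ContDiffAt ℝ ∞ f u) : ContDiffAt ℝ ∞ (fun v => coordShape y w v (f v)) u := by
  have hform : ∀ v ∈ U, coordShape y w v (f v) = ∑ i, ∑ j,
      (((coordMetric 2 y v)⁻¹ * coordSecond y w v) i j * f v j) •
        (EuclideanSpace.single i 1 : E n) := by
    intro v hv
    rw [← h.toMatrix_coordShape hv]
    conv_lhs => rw [← (EuclideanSpace.basisFun (Fin n) ℝ).toBasis.sum_repr
      (coordShape y w v (f v))]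
    refine Finset.sum_congr rfl fun i _ => ?_
    rw [← Finset.sum_smul]
    congr 1
    · rw [← LinearMap.toMatrix_mulVec_repr (EuclideanSpace.basisFun (Fin n) ℝ).toBasis
        (EuclideanSpace.basisFun (Fin n) ℝ).toBasis]
      rfl
    · simp
  refine ContDiffAt.congr_of_eventuallyEq ?_
    (Filter.eventuallyEq_of_mem (h.isOpen.mem_nhds hu) hform)
  refine ContDiffAt.sum fun i _ => ContDiffAt.sum fun j _ => ?_
  exact ((h.contDiffAt_matrix hu i j).mul ((contDiffAt_euclidean.1 hf) j)).smul contDiffAt_const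

end IsLocalCone

end LocalCone

/-! ### The conformal position vector in coordinates -/

namespace IsLocalCone

variable {n : ℕ} {y w : E n → Fin (n + 3) → ℝ} {q : Fin (n + 3) → ℝ} {κ : ℝ} {U : Set (E n)}
  {u : E n} {ρ : E n → ℝ}

lemma fderiv_smul_y (h : IsLocalCone y w q κ U) (hu : u ∈ U) (hρ : DifferentiableAt ℝ ρ u)
    (X : E n) : fderiv ℝ (fun v => ρ v • y v) u X =
      ρ u • fderiv ℝ y u X + fderiv ℝ ρ u X • y u := by
  rw [fderiv_fun_smul hρ (h.diff_y hu)]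
  simp

/-- Since `y` is null and orthogonal to `dy`, the term `dρ y` contributes nothing: rescaling a
light-cone lift changes its metric conformally. -/
lemma dot_fderiv_smul_y (h : IsLocalCone y w q κ U) (hu : u ∈ U) (hρ : DifferentiableAt ℝ ρ u)
    (X Z : E n) : dot 2 (fderiv ℝ (fun v => ρ v • y v) u X) (fderiv ℝ (fun v => ρ v • y v) u Z) =
      ρ u ^ 2 * dot 2 (fderiv ℝ y u X) (fderiv ℝ y u Z) := by
  rw [h.fderiv_smul_y hu hρ, h.fderiv_smul_y hu hρ]
  simp only [dot_add_left, dot_add_right, dot_smul_left, dot_smul_right, h.yy u hu, h.ydy hu,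
    dot_comm (fderiv ℝ y u X) (y u)]
  ring

lemma coordMetric_smul_y (h : IsLocalCone y w q κ U) (hu : u ∈ U)
    (hρ : DifferentiableAt ℝ ρ u) :
    coordMetric 2 (fun v => ρ v • y v) u = ρ u ^ 2 • coordMetric 2 y u := by
  ext i j
  exact h.dot_fderiv_smul_y hu hρ _ _

lemma det_smul_y_ne_zero (h : IsLocalCone y w q κ U) (hu : u ∈ U)
    (hρ : DifferentiableAt ℝ ρ u) (h0 : ρ u ≠ 0) :
    (coordMetric 2 (fun v => ρ v • y v) u).det ≠ 0 := by
  rw [h.coordMetric_smul_y hu hρ, Matrix.det_smul]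
  exact mul_ne_zero (pow_ne_zero _ (pow_ne_zero _ h0)) (h.det_ne_zero hu)

lemma coordMetric_smul_y_inv (h : IsLocalCone y w q κ U) (hu : u ∈ U)
    (hρ : DifferentiableAt ℝ ρ u) (h0 : ρ u ≠ 0) :
    (coordMetric 2 (fun v => ρ v • y v) u)⁻¹ = (ρ u ^ 2)⁻¹ • (coordMetric 2 y u)⁻¹ := by
  rw [h.coordMetric_smul_y hu hρ]
  refine Matrix.inv_eq_right_inv ?_
  rw [Matrix.smul_mul, Matrix.mul_smul, smul_smul, mul_inv_cancel₀ (pow_ne_zero _ h0),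
    Matrix.mul_nonsing_inv _ (h.det_ne_zero hu).isUnit, one_smul]

lemma dot_smul_y_fderiv (h : IsLocalCone y w q κ U) (hu : u ∈ U)
    (hρ : DifferentiableAt ℝ ρ u) (X : E n) :
    dot 2 (y u) (fderiv ℝ (fun v => ρ v • y v) u X) = 0 := by
  rw [h.fderiv_smul_y hu hρ]
  simp [dot_add_right, dot_smul_right, h.ydy hu, h.yy u hu]

lemma dot_w_fderiv_smul_y (h : IsLocalCone y w q κ U) (hu : u ∈ U)
    (hρ : DifferentiableAt ℝ ρ u) (X : E n) :
    dot 2 (w u) (fderiv ℝ (fun v => ρ v • y v) u X) = 0 := by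
  rw [h.fderiv_smul_y hu hρ]
  simp [dot_add_right, dot_smul_right, h.wdy u hu, h.wy u hu]

/-- The products of the Laplacian of `ρ y` with `y`, `w` and `dy`, for the metric `ρ² ⟨dy, dy⟩`. -/
lemma dot_laplacian_smul_y (h : IsLocalCone y w q κ U) (hu : u ∈ U)
    (hρ : ∀ v ∈ U, ContDiffAt ℝ ∞ ρ v) (h0 : ρ u ≠ 0) :
    dot 2 (laplacian (coordMetric 2 fun v => ρ v • y v) (fun v => ρ v • y v) u) (y u)
      = -n / ρ u ∧
    dot 2 (laplacian (coordMetric 2 fun v => ρ v • y v) (fun v => ρ v • y v) u) (w u)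
      = -LinearMap.trace ℝ (E n) (coordShape y w u) / ρ u ∧
    ∀ X, dot 2 (laplacian (coordMetric 2 fun v => ρ v • y v) (fun v => ρ v • y v) u)
      (fderiv ℝ y u X) = n / ρ u ^ 2 * fderiv ℝ ρ u X := by
  have hρd : ∀ v ∈ U, DifferentiableAt ℝ ρ v := fun v hv => (hρ v hv).differentiableAt (by simp)
  set Y : E n → Fin (n + 3) → ℝ := fun v => ρ v • y v with hYdef
  have hY : ContDiffAt ℝ ∞ Y u := (hρ u hu).smul (h.smooth_y u hu)
  have hdY : ∀ j, DifferentiableAt ℝ (pderiv j Y) u := fun j =>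
    (ContDiffAt.pderiv hY j).differentiableAt (by simp)
  have hinv := h.coordMetric_smul_y_inv hu (hρd u hu) h0
  have hGG : (coordMetric 2 y u)⁻¹ * coordMetric 2 y u = 1 :=
    Matrix.nonsing_inv_mul _ (h.det_ne_zero hu).isUnit
  have hpd : ∀ j, pderiv j Y u = ρ u • pderiv j y u + fderiv ℝ ρ u (EuclideanSpace.single j 1) • y u :=
    fun j => h.fderiv_smul_y hu (hρd u hu) _
  have h1 : dot 2 (laplacian (coordMetric 2 Y) Y u) (y u) = -n / ρ u := by
    -- Differentiating `⟨y, ∂_j Y⟩ = 0` gives the second derivative's product with `y`. The trace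
    -- uses the inverse metric `ρ⁻² G⁻¹`, hence the quotient by `ρ`. The product with `w` below is
    -- found in the same way.
    have hij : ∀ i j, dot 2 (pderiv i (pderiv j Y) u) (y u) = -(ρ u * coordMetric 2 y u i j) := by
      intro i j
      have := fderiv_dot_eq_zero h.isOpen hu (h.diff_y hu) (hdY j)
        (fun v hv => h.dot_smul_y_fderiv hv (hρd v hv) _) (EuclideanSpace.single i 1)
      rw [dot_comm]
      refine (eq_neg_of_add_eq_zero_right this).trans ?_
      rw [hpd, dot_add_right, dot_smul_right, dot_smul_right, dot_comm _ (y u), h.ydy hu,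
        mul_zero, add_zero]
      rfl
    rw [dot_laplacian_eq fun k => by rw [dot_comm]; exact h.dot_smul_y_fderiv hu (hρd u hu) _, hinv]
    have hn : (n : ℝ) = ∑ i, ∑ j, (coordMetric 2 y u)⁻¹ i j * coordMetric 2 y u i j := by
      rw [sum_mul_eq_trace _ _ coordMetric_comm, hGG]
      simp
    rw [hn, neg_div, Finset.sum_div, ← Finset.sum_neg_distrib]
    refine Finset.sum_congr rfl fun i _ => ?_
    rw [Finset.sum_div, ← Finset.sum_neg_distrib]
    refine Finset.sum_congr rfl fun j _ => ?_
    rw [hij, Matrix.smul_apply, smul_eq_mul]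
    field_simp
  refine ⟨h1, ?_, fun X => ?_⟩
  · have hij : ∀ i j, dot 2 (pderiv i (pderiv j Y) u) (w u) = -(ρ u * coordSecond y w u i j) := by
      intro i j
      have := fderiv_dot_eq_zero h.isOpen hu (h.diff_w hu) (hdY j)
        (fun v hv => h.dot_w_fderiv_smul_y hv (hρd v hv) _) (EuclideanSpace.single i 1)
      rw [dot_comm]
      refine (eq_neg_of_add_eq_zero_right this).trans ?_
      rw [hpd, dot_add_right, dot_smul_right, dot_smul_right, h.dwy hu, mul_zero, add_zero]
      rfl
    rw [dot_laplacian_eq fun k => by rw [dot_comm]; exact h.dot_w_fderiv_smul_y hu (hρd u hu) _,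
      hinv, h.trace_coordShape hu, ← sum_mul_eq_trace _ _ (h.coordSecond_comm hu), neg_div,
      Finset.sum_div, ← Finset.sum_neg_distrib]
    refine Finset.sum_congr rfl fun i _ => ?_
    rw [Finset.sum_div, ← Finset.sum_neg_distrib]
    refine Finset.sum_congr rfl fun j _ => ?_
    rw [hij, Matrix.smul_apply, smul_eq_mul]
    field_simp
  · have h2 : dot 2 (laplacian (coordMetric 2 Y) Y u) (fderiv ℝ Y u X) = 0 := by
      simp [fderiv_eq_sum_pderiv, dot_sum_right, dot_smul_right,
        dot_laplacian_pderiv hY (h.det_smul_y_ne_zero hu (hρd u hu) h0)]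
    rw [h.fderiv_smul_y hu (hρd u hu), dot_add_right, dot_smul_right, dot_smul_right, h1] at h2
    field_simp at h2 ⊢
    linarith

/-- The differential of the conformal normal `w - H y`. -/
lemma fderiv_normal (h : IsLocalCone y w q κ U) (hu : u ∈ U) {H : E n → ℝ}
    (hH : DifferentiableAt ℝ H u) (X : E n) :
    fderiv ℝ (fun v => w v - H v • y v) u X =
      fderiv ℝ y u (coordShape y w u X - H u • X) - fderiv ℝ H u X • y u := by
  rw [fderiv_fun_sub (h.diff_w hu) (hH.fun_smul (h.diff_y hu)), fderiv_fun_smul hH (h.diff_y hu)]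
  simp [h.fderiv_w hu, sub_sub]

/-- The conformal second fundamental form in terms of the shape operator. -/
lemma dot_fderiv_normal_fderiv (h : IsLocalCone y w q κ U) (hu : u ∈ U) {H : E n → ℝ}
    (hH : DifferentiableAt ℝ H u) (hρ : DifferentiableAt ℝ ρ u) (X Z : E n) :
    dot 2 (fderiv ℝ (fun v => w v - H v • y v) u X) (fderiv ℝ (fun v => ρ v • y v) u Z) =
      ρ u * dot 2 (fderiv ℝ y u (coordShape y w u X - H u • X)) (fderiv ℝ y u Z) := by
  rw [h.fderiv_normal hu hH, h.fderiv_smul_y hu hρ]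
  simp only [dot_sub_left, dot_add_right, dot_smul_left, dot_smul_right, h.yy u hu, h.ydy hu,
    dot_comm (fderiv ℝ y u _) (y u)]
  ring

/-- The conformal `1`-form in terms of the shape operator. -/
lemma dot_fderiv_normal_laplacian (h : IsLocalCone y w q κ U) (hu : u ∈ U) {H : E n → ℝ}
    (hH : DifferentiableAt ℝ H u) (hρ : ∀ v ∈ U, ContDiffAt ℝ ∞ ρ v) (h0 : ρ u ≠ 0)
    (hn : n ≠ 0) (a : ℝ) (X : E n) :
    dot 2 (fderiv ℝ (fun v => w v - H v • y v) u X)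
      ((-(1 / (n : ℝ))) • laplacian (coordMetric 2 fun v => ρ v • y v) (fun v => ρ v • y v) u
        - a • ρ u • y u) =
      -((ρ u ^ 2)⁻¹ * fderiv ℝ ρ u (coordShape y w u X - H u • X))
        - (ρ u)⁻¹ * fderiv ℝ H u X := by
  obtain ⟨h1, -, h3⟩ := h.dot_laplacian_smul_y hu hρ h0
  have hn' : (n : ℝ) ≠ 0 := by exact_mod_cast hn
  rw [h.fderiv_normal hu hH]
  -- The differential of `w - H y` is orthogonal to `y`, so the coefficient `a` of `Y` in `N` drops
  -- out.
  simp only [dot_sub_left, dot_sub_right, dot_smul_left, dot_smul_right, h.yy u hu,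
    dot_comm _ (laplacian _ _ _), h1, h3, dot_comm (fderiv ℝ y u _) (y u), h.ydy hu]
  field_simp
  ring

end IsLocalCone

/-! ### Principal directions and curvature lines in coordinates -/

namespace IsLocalCone

variable {n : ℕ} {y w : E n → Fin (n + 3) → ℝ} {q : Fin (n + 3) → ℝ} {κ : ℝ} {U : Set (E n)}
  {u : E n}

/-- The Codazzi equation for two principal vector fields with the same principal curvature. -/
lemma codazzi (h : IsLocalCone y w q κ U) (hu : u ∈ U) {X Y : E n → E n} {l : E n → ℝ}
    (hX : DifferentiableAt ℝ X u) (hY : DifferentiableAt ℝ Y u) (hl : DifferentiableAt ℝ l u)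
    (hAX : ∀ v ∈ U, coordShape y w v (X v) = l v • X v)
    (hAY : ∀ v ∈ U, coordShape y w v (Y v) = l v • Y v) :
    ∃ Z, coordShape y w u Z - l u • Z = fderiv ℝ l u (Y u) • X u - fderiv ℝ l u (X u) • Y u := by
  have hdy : DifferentiableAt ℝ (fderiv ℝ y) u :=
    ((h.smooth_y u hu).fderiv_right (m := ∞) (by simp)).differentiableAt (by simp)
  have hdw : DifferentiableAt ℝ (fderiv ℝ w) u :=
    ((h.smooth_w u hu).fderiv_right (m := ∞) (by simp)).differentiableAt (by simp)
  have hs : ∀ f : E n → Fin (n + 3) → ℝ, ContDiffAt ℝ ∞ f u → ∀ A B,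
      fderiv ℝ (fderiv ℝ f) u A B = fderiv ℝ (fderiv ℝ f) u B A := fun f hf A B =>
    (hf.isSymmSndFDerivAt (by
      rw [minSmoothness_of_isRCLikeNormedField]
      exact WithTop.coe_le_coe.2 (le_top : (2 : ℕ∞) ≤ ⊤))).eq A B
  -- The relation `dw(F) = l dy(F)`, differentiated in the direction `V`.
  have key : ∀ (F : E n → E n), DifferentiableAt ℝ F u →
      (∀ v ∈ U, coordShape y w v (F v) = l v • F v) → ∀ V : E n,
      fderiv ℝ (fderiv ℝ w) u V (F u) + fderiv ℝ w u (fderiv ℝ F u V) =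
        l u • (fderiv ℝ (fderiv ℝ y) u V (F u) + fderiv ℝ y u (fderiv ℝ F u V)) +
          fderiv ℝ l u V • fderiv ℝ y u (F u) := by
    intro F hF hAF V
    have hev : (fun v => fderiv ℝ w v (F v)) =ᶠ[nhds u] fun v => l v • fderiv ℝ y v (F v) := by
      refine Filter.eventuallyEq_of_mem (h.isOpen.mem_nhds hu) fun v hv => ?_
      rw [h.fderiv_w hv, hAF v hv, map_smul]
    have := congrArg (fun L : E n →L[ℝ] (Fin (n + 3) → ℝ) => L V) hev.fderiv_eq
    rw [fderiv_clm_apply hdw hF, fderiv_fun_smul hl (hdy.clm_apply hF),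
      fderiv_clm_apply hdy hF] at this
    simpa [add_comm] using this
  have h1 := key X hX hAX (Y u)
  have h2 := key Y hY hAY (X u)
  rw [hs w (h.smooth_w u hu), hs y (h.smooth_y u hu)] at h1
  -- The witness is the Lie bracket `[Y, X]`. The second derivatives of `w` and `y` are symmetric
  -- and disappear from the difference of the two relations.
  refine ⟨fderiv ℝ X u (Y u) - fderiv ℝ Y u (X u), injective_of_dot_pos (D := (fderiv ℝ y u).toLinearMap)
    (h.pos u hu) ?_⟩
  change fderiv ℝ y u _ = fderiv ℝ y u _
  rw [map_sub, ← h.fderiv_w hu]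
  simp only [map_sub, map_smul]
  have h3 := congrArg₂ (· - ·) h1 h2
  have e1 : fderiv ℝ w u (fderiv ℝ X u (Y u)) - fderiv ℝ w u (fderiv ℝ Y u (X u)) =
      (fderiv ℝ (fderiv ℝ w) u (X u) (Y u) + fderiv ℝ w u (fderiv ℝ X u (Y u))) -
      (fderiv ℝ (fderiv ℝ w) u (X u) (Y u) + fderiv ℝ w u (fderiv ℝ Y u (X u))) := by abel
  rw [e1, h3]
  module

variable {H ρ : E n → ℝ} {b : Fin n → ℝ}

/-! ### Smooth principal vector fields -/

lemma contDiffAt_aeval (h : IsLocalCone y w q κ U) (hu : u ∈ U) (hH : ContDiffAt ℝ ∞ H u)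
    (hρ : ContDiffAt ℝ ∞ ρ u) (h0 : ρ u ≠ 0) (p : Polynomial ℝ) (X : E n) :
    ContDiffAt ℝ ∞
      (fun v => Polynomial.aeval ((ρ v)⁻¹ • (coordShape y w v - H v • 1)) p X) u := by
  induction p using Polynomial.induction_on with
  | C a => simpa using contDiffAt_const
  | add p q hp hq => simpa using hp.add hq
  | monomial k a ih =>
    have hform : ∀ v, Polynomial.aeval ((ρ v)⁻¹ • (coordShape y w v - H v • 1))
        (Polynomial.C a * Polynomial.X ^ (k + 1)) X =
        (ρ v)⁻¹ • (coordShape y w v (Polynomial.aeval ((ρ v)⁻¹ • (coordShape y w v - H v • 1))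
          (Polynomial.C a * Polynomial.X ^ k) X)
          - H v • Polynomial.aeval ((ρ v)⁻¹ • (coordShape y w v - H v • 1))
          (Polynomial.C a * Polynomial.X ^ k) X) := by
      intro v
      have : Polynomial.C a * Polynomial.X ^ (k + 1) =
          Polynomial.X * (Polynomial.C a * Polynomial.X ^ k) := by ring
      rw [this, map_mul, Polynomial.aeval_X, Module.End.mul_apply]
      simp
      module
    simp only [hform]
    exact (hρ.inv h0).smul ((h.contDiffAt_coordShape_apply hu ih).sub (hH.smul ih))

/-- If the conformal principal curvatures are constant, principal vectors extend to principal
vector fields. -/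
lemma exists_eigenfield (h : IsLocalCone y w q κ U) (hH : ∀ v ∈ U, ContDiffAt ℝ ∞ H v)
    (hρ : ∀ v ∈ U, ContDiffAt ℝ ∞ ρ v) (h0 : ∀ v ∈ U, ρ v ≠ 0)
    (hb : ∀ v ∈ U, ∃ e : Module.Basis (Fin n) ℝ (E n), ∀ i,
      coordShape y w v (e i) = (H v + ρ v * b i) • e i)
    (hu : u ∈ U) (β : ℝ) {X₀ : E n} (hX₀ : coordShape y w u X₀ = (H u + ρ u * β) • X₀) :
    ∃ X : E n → E n, (∀ v ∈ U, ContDiffAt ℝ ∞ X v) ∧ X u = X₀ ∧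
      ∀ v ∈ U, coordShape y w v (X v) = (H v + ρ v * β) • X v := by
  -- With `T = ρ⁻¹(A - H)`, the operator `p(T)/p(β)` is the projection onto the eigenspace of `β`:
  -- it kills the other eigenvectors and fixes `X₀`. Its coefficients are constant because the `b j`
  -- are, so it varies smoothly with `v`.
  let p : Polynomial ℝ := ∏ j with b j ≠ β, (Polynomial.X - Polynomial.C (b j))
  have hT : ∀ v ∈ U, ∀ (x : E n) (c : ℝ), coordShape y w v x = (H v + ρ v * c) • x →
      ((ρ v)⁻¹ • (coordShape y w v - H v • (1 : Module.End ℝ (E n)))) x = c • x := by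
    intro v hv x c hx
    simp only [LinearMap.smul_apply, LinearMap.sub_apply, hx, Module.End.one_apply, ← sub_smul,
      smul_smul]
    congr 1
    field_simp [h0 v hv]
    ring
  have hp : p.eval β ≠ 0 := by
    simp only [p, Polynomial.eval_prod, Polynomial.eval_sub, Polynomial.eval_X, Polynomial.eval_C,
      Finset.prod_ne_zero_iff, Finset.mem_filter, Finset.mem_univ, true_and]
    exact fun j hj => sub_ne_zero.2 (Ne.symm hj)
  refine ⟨fun v => (p.eval β)⁻¹ •
    Polynomial.aeval ((ρ v)⁻¹ • (coordShape y w v - H v • 1)) p X₀, fun v hv => ?_, ?_,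
    fun v hv => ?_⟩
  · exact (h.contDiffAt_aeval hv (hH v hv) (hρ v hv) (h0 v hv) p X₀).const_smul _
  · simp only
    rw [aeval_apply_eigenvector (hT u hu X₀ β hX₀), smul_smul, inv_mul_cancel₀ hp, one_smul]
  · obtain ⟨e, he⟩ := hb v hv
    set T := (ρ v)⁻¹ • (coordShape y w v - H v • (1 : Module.End ℝ (E n))) with hTdef
    have hz : Polynomial.aeval T ((Polynomial.X - Polynomial.C β) * p) = 0 := by
      refine e.ext fun i => ?_
      rw [aeval_apply_eigenvector (hT v hv _ _ (he i)), Polynomial.eval_mul]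
      by_cases hi : b i = β
      · simp [hi]
      · have : p.eval (b i) = 0 := by
          simp only [p, Polynomial.eval_prod]
          exact Finset.prod_eq_zero (i := i) (by simp [hi]) (by simp)
        simp [this]
    have hz' := LinearMap.congr_fun hz X₀
    rw [map_mul, Module.End.mul_apply, map_sub, Polynomial.aeval_X, Polynomial.aeval_C] at hz'
    set Z := Polynomial.aeval T p X₀
    have h4 : (ρ v)⁻¹ • (coordShape y w v Z - H v • Z) = β • Z := by
      simpa [hTdef, sub_eq_zero, Module.algebraMap_end_apply] using hz'
    have h5 : coordShape y w v Z = (H v + ρ v * β) • Z := by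
      have := congrArg (fun z => ρ v • z) h4
      simp only [smul_smul, mul_inv_cancel₀ (h0 v hv), one_smul] at this
      rw [sub_eq_iff_eq_add.1 this]
      module
    change coordShape y w v ((p.eval β)⁻¹ • Z) = _ • (p.eval β)⁻¹ • Z
    rw [map_smul, h5, smul_comm]

/-- Along the principal directions of a principal curvature of multiplicity at least two, this
principal curvature is stationary. -/
lemma fderiv_principalCurvature_of_multiple (h : IsLocalCone y w q κ U)
    (hH : ∀ v ∈ U, ContDiffAt ℝ ∞ H v)
    (hρ : ∀ v ∈ U, ContDiffAt ℝ ∞ ρ v) (h0 : ∀ v ∈ U, ρ v ≠ 0)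
    (hb : ∀ v ∈ U, ∃ e : Module.Basis (Fin n) ℝ (E n), ∀ i,
      coordShape y w v (e i) = (H v + ρ v * b i) • e i)
    (hu : u ∈ U) {e : Module.Basis (Fin n) ℝ (E n)}
    (he : ∀ i, coordShape y w u (e i) = (H u + ρ u * b i) • e i) {i j : Fin n} (hij : i ≠ j)
    (hbij : b i = b j) : fderiv ℝ (fun v => H v + ρ v * b i) u (e i) = 0 := by
  obtain ⟨X, hX, hXu, hAX⟩ := h.exists_eigenfield hH hρ h0 hb hu (b i) (he i)
  obtain ⟨Y, hY, hYu, hAY⟩ := h.exists_eigenfield hH hρ h0 hb hu (b i) (hbij ▸ he j)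
  have hl : DifferentiableAt ℝ (fun v => H v + ρ v * b i) u :=
    ((hH u hu).add ((hρ u hu).mul contDiffAt_const)).differentiableAt (by simp)
  obtain ⟨Z, hZ⟩ := h.codazzi hu ((hX u hu).differentiableAt (by simp))
    ((hY u hu).differentiableAt (by simp)) hl hAX hAY
  rw [hXu, hYu] at hZ
  set α := fderiv ℝ (fun v => H v + ρ v * b i) u (e i)
  set α' := fderiv ℝ (fun v => H v + ρ v * b i) u (e j)
  -- By Codazzi the vector `α' e_i - α e_j` lies in the image of `A - λ`, and it also lies in its
  -- kernel. It therefore vanishes, and its `e_j`-coefficient is `-α`.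
  have hker := eq_zero_of_sub_smul he (x := α' • e i - α • e j) (l := H u + ρ u * b i) (z := Z)
    (by rw [map_sub, map_smul, map_smul, he, he, ← hbij]; module) hZ
  have := congrArg (fun x => e.repr x j) hker
  simpa [hij] using this

end IsLocalCone

/-! ### Integral curves -/

section IntegralCurve

variable {n : ℕ} {U : Set (E n)} {u : E n} {X : E n → E n}

/-- Bootstrapping: if `γ` is `C^k`, then so is `γ' = X ∘ γ`, and `γ` is `C^{k+1}`. -/
lemma contDiffOn_integralCurve {γ : ℝ → E n} {J : Set ℝ} (hJ : IsOpen J)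
    (hX : ∀ v ∈ U, ContDiffAt ℝ ∞ X v) (hγU : ∀ t ∈ J, γ t ∈ U)
    (hγ : ∀ t ∈ J, HasDerivAt γ (X (γ t)) t) : ContDiffOn ℝ ∞ γ J := by
  rw [contDiffOn_infty]
  intro k
  induction k with
  | zero =>
    exact contDiffOn_zero.2 fun t ht => (hγ t ht).continuousAt.continuousWithinAt
  | succ k ih =>
    push_cast
    rw [contDiffOn_succ_iff_deriv_of_isOpen hJ]
    refine ⟨fun t ht => (hγ t ht).differentiableAt.differentiableWithinAt, by simp, ?_⟩
    refine ContDiffOn.congr (f := fun t => X (γ t)) (fun t ht => ?_) fun t ht => (hγ t ht).deriv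
    exact ((hX _ (hγU t ht)).of_le (by exact_mod_cast le_top)).comp_contDiffWithinAt t (ih t ht)

/-- Through a point at which a smooth vector field does not vanish there is an embedded integral
curve, up to the choice of the parameter. -/
lemma exists_embedded_integralCurve (hU : IsOpen U) (hX : ∀ v ∈ U, ContDiffAt ℝ ∞ X v)
    (hu : u ∈ U) (h0 : X u ≠ 0) :
    ∃ δ : ℝ → E n, ContDiff ℝ ∞ δ ∧ δ 0 = u ∧ (∀ t, δ t ∈ U) ∧ (∀ t, X (δ t) ≠ 0) ∧
      (∀ t, ∃ a : ℝ, a ≠ 0 ∧ HasDerivAt δ (a • X (δ t)) t) ∧ Topology.IsEmbedding δ := by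
  obtain ⟨r, hr, ε, hε, hex⟩ :=
    ((hX u hu).of_le (by exact_mod_cast le_top) :
      ContDiffAt ℝ 1 X u).exists_forall_mem_closedBall_exists_eq_forall_mem_Ioo_hasDerivAt 0
  obtain ⟨γ, hγ0, hγ⟩ := hex u (by simp [hr.le])
  have hc : ContinuousAt γ 0 := (hγ 0 (by simp [hε])).continuousAt
  -- Near `u` the field keeps a positive component along `X u`, which will make the height `⟨X u,
  -- ·⟩` strictly increasing along the curve.
  have hpos : ∀ᶠ v in nhds u, v ∈ U ∧ 0 < inner ℝ (X u) (X v) := by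
    have hU' : ∀ᶠ v in nhds u, v ∈ U := hU.mem_nhds hu
    refine hU'.and ?_
    have : ContinuousAt (fun v => inner ℝ (X u) (X v)) u :=
      continuousAt_const.inner (hX u hu).continuousAt
    refine this.eventually_const_lt ?_
    change 0 < inner ℝ (X u) (X u)
    rw [real_inner_self_eq_norm_sq]
    positivity
  rw [← hγ0] at hpos
  obtain ⟨ε', hε', hball⟩ := Metric.eventually_nhds_iff_ball.1 (hc.eventually hpos)
  rw [hγ0] at hball
  let η := min ε ε'
  have hη : 0 < η := lt_min hε hε'
  have hJ : ∀ t ∈ Set.Ioo (-η) η, (γ t ∈ U ∧ 0 < inner ℝ (X u) (X (γ t))) ∧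
      HasDerivAt γ (X (γ t)) t := by
    intro t ht
    refine ⟨hball t ?_, hγ t ?_⟩
    · rw [Metric.mem_ball, Real.dist_eq, sub_zero, abs_lt]
      exact ⟨by linarith [ht.1, min_le_right ε ε'], by linarith [ht.2, min_le_right ε ε']⟩
    · exact ⟨by linarith [ht.1, min_le_left ε ε'], by linarith [ht.2, min_le_left ε ε']⟩
  -- This reparametrises a short piece of the curve over all of `ℝ`. The values stay in `(-η, η)`
  -- because `π / 2 < 2`.
  let s : ℝ → ℝ := fun t => η / 2 * Real.arctan t
  have hs : ∀ t, s t ∈ Set.Ioo (-η) η := by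
    intro t
    have h1 := Real.arctan_lt_pi_div_two t
    have h2 := Real.neg_pi_div_two_lt_arctan t
    have h3 := Real.pi_lt_four
    constructor <;> simp only [s] <;> nlinarith
  have hsd : ∀ t, HasDerivAt s (η / 2 * (1 / (1 + t ^ 2))) t := fun t =>
    (Real.hasDerivAt_arctan t).const_mul _
  have hδ : ∀ t, HasDerivAt (fun t => γ (s t))
      ((η / 2 * (1 / (1 + t ^ 2))) • X (γ (s t))) t := fun t =>
    (hJ _ (hs t)).2.scomp t (hsd t)
  have hcd : ContDiff ℝ ∞ fun t => γ (s t) := by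
    have h1 := contDiffOn_integralCurve isOpen_Ioo hX (fun t ht => (hJ t ht).1.1)
      fun t ht => (hJ t ht).2
    rw [← contDiffOn_univ]
    exact h1.comp (contDiff_const.mul Real.contDiff_arctan).contDiffOn fun t _ => hs t
  refine ⟨fun t => γ (s t), hcd, by simp [s, hγ0], fun t => (hJ _ (hs t)).1.1, fun t h => ?_,
    fun t => ⟨_, ?_, hδ t⟩, ?_⟩
  · have := (hJ _ (hs t)).1.2
    rw [h, inner_zero_right] at this
    exact this.false
  · positivity
  · have hf : ∀ t, HasDerivAt (fun t => inner ℝ (X u) (γ (s t)))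
        (η / 2 * (1 / (1 + t ^ 2)) * inner ℝ (X u) (X (γ (s t)))) t := by
      intro t
      simpa [inner_smul_right] using (hasDerivAt_const t (X u)).inner ℝ (hδ t)
    have hcf : Continuous fun t => inner ℝ (X u) (γ (s t)) :=
      continuous_iff_continuousAt.2 fun t => (hf t).continuousAt
    have hmono : StrictMono fun t => inner ℝ (X u) (γ (s t)) := by
      refine strictMono_of_deriv_pos fun t => ?_
      rw [(hf t).deriv]
      have := (hJ _ (hs t)).1.2
      positivity
    -- The height along the curve is continuous and strictly monotone, hence an embedding into `ℝ`.
    -- So the curve is itself an embedding.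
    refine Topology.IsEmbedding.of_comp (g := fun v => inner ℝ (X u) v) hcd.continuous
      (by fun_prop) ?_
    exact hmono.isEmbedding_of_ordConnected (isPreconnected_range hcf).ordConnected

end IntegralCurve

/-! ### The canonical lift to the light cone -/

section ConeLift

variable {n : ℕ}

lemma dot_cons_snoc (a a' b b' : ℝ) (u v : Fin (n + 1) → ℝ) :
    dot 2 (Fin.cons (α := fun _ : Fin (n + 3) => ℝ) a
        (Fin.snoc (α := fun _ : Fin (n + 2) => ℝ) u b))
      (Fin.cons (α := fun _ : Fin (n + 3) => ℝ) a'
        (Fin.snoc (α := fun _ : Fin (n + 2) => ℝ) v b')) = -(a * a') + dot 1 u v + b * b' := by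
  simp [dot, Fin.sum_univ_succ (n := n + 2), Fin.sum_univ_castSucc (n := n + 1)]
  ring

lemma dot_cons (a a' : ℝ) (u v : Fin (n + 2) → ℝ) :
    dot 2 (Fin.cons (α := fun _ : Fin (n + 3) => ℝ) a u)
      (Fin.cons (α := fun _ : Fin (n + 3) => ℝ) a' v) = -(a * a') + dot 1 u v := by
  simp [dot, Fin.sum_univ_succ (n := n + 2)]

lemma dot_snoc (a a' : ℝ) (u v : Fin (n + 2) → ℝ) :
    dot 2 (Fin.snoc (α := fun _ : Fin (n + 3) => ℝ) u a)
      (Fin.snoc (α := fun _ : Fin (n + 3) => ℝ) v a') = dot 2 u v + a * a' := by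
  simp [dot, Fin.sum_univ_castSucc (n := n + 2)]

/-- The canonical lift is `u ↦ L u + ½ ⟨u, u⟩ q₀ + q₁`, for a linear isometry `L` and constant
vectors `q₀` and `q₁`; the vector `q` has a constant product with the lift. -/
structure IsConeModel (n : ℕ) (c : SignType) (L : Ambient n c →L[ℝ] (Fin (n + 3) → ℝ))
    (q₀ q₁ q : Fin (n + 3) → ℝ) (κ : ℝ) : Prop where
  coneLift_eq : coneLift n c =
    fun u => L u + (dot (ambientIndex c) u u / 2) • q₀ + q₁
  dot_L : ∀ u v, dot 2 (L u) (L v) = dot (ambientIndex c) u v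
  dot_L_q₀ : ∀ u, dot 2 (L u) q₀ = 0
  dot_L_q₁ : ∀ u, dot 2 (L u) q₁ = 0
  dot_L_q : ∀ u, dot 2 (L u) q = 0
  q₀q₀ : dot 2 q₀ q₀ = 0
  q₀q : dot 2 q₀ q = 0
  q₁q : dot 2 q₁ q = κ
  κ_ne : κ ≠ 0
  light : ∀ u ∈ spaceForm n c,
    dot (ambientIndex c) u u + dot (ambientIndex c) u u * dot 2 q₀ q₁ + dot 2 q₁ q₁ = 0
  tangent : ∀ u v : Ambient n c, (c ≠ 0 → dot (ambientIndex c) u v = 0) →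
    dot (ambientIndex c) u v + dot (ambientIndex c) u v * dot 2 q₀ q₁ = 0

/-- In the flat case `q = q₀` is the null vector `(1, 0, 1)`. The relation `⟨q₀, q₁⟩ = -1` makes the
lift null and gives it the constant product `-1` with `q`. -/
lemma exists_isConeModel_zero (n : ℕ) : ∃ L q₀ q₁ q κ, IsConeModel n .zero L q₀ q₁ q κ := by
  let L : (Fin (n + 1) → ℝ) →ₗ[ℝ] (Fin (n + 3) → ℝ) :=
    { toFun := fun u => Fin.cons (α := fun _ : Fin (n + 3) => ℝ) 0
        (Fin.snoc (α := fun _ : Fin (n + 2) => ℝ) u 0)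
      map_add' := fun u v => by
        funext i
        refine Fin.cases (by simp) (fun i => Fin.lastCases (by simp) (fun i => by simp) i) i
      map_smul' := fun a v => by
        funext i
        refine Fin.cases (by simp) (fun i => Fin.lastCases (by simp) (fun i => by simp) i) i }
  let q₀ : Fin (n + 3) → ℝ := Fin.cons (α := fun _ : Fin (n + 3) => ℝ) 1
    (Fin.snoc (α := fun _ : Fin (n + 2) => ℝ) 0 1)
  let q₁ : Fin (n + 3) → ℝ := Fin.cons (α := fun _ : Fin (n + 3) => ℝ) (1 / 2)
    (Fin.snoc (α := fun _ : Fin (n + 2) => ℝ) 0 (-1 / 2))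
  have hL : ∀ u, L u = Fin.cons (α := fun _ : Fin (n + 3) => ℝ) 0
        (Fin.snoc (α := fun _ : Fin (n + 2) => ℝ) u 0) := fun u => rfl
  have h01 : dot 2 q₀ q₁ = -1 := by
    simp only [q₀, q₁, dot_cons_snoc, dot_zero_left]; norm_num
  have hA : ∀ u : Fin (n + 1) → ℝ, (Fin.cons (α := fun _ : Fin (n + 3) => ℝ)
      ((dot 1 u u + 1) / 2) (Fin.snoc (α := fun _ : Fin (n + 2) => ℝ) u ((dot 1 u u - 1) / 2)) :
        Fin (n + 3) → ℝ) = L u + (dot 1 u u / 2) • q₀ + q₁ := by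
    intro u
    funext i
    rw [hL]
    refine Fin.cases ?_ (fun i => Fin.lastCases ?_ (fun i => ?_) i) i
    · simp [q₀, q₁]; ring
    · simp [q₀, q₁]; ring
    · simp [q₀, q₁]
  have hB : ∀ u v, dot 2 (L u) (L v) = dot 1 u v := fun u v => by simp [hL, dot_cons_snoc]
  have h0 : ∀ u, dot 2 (L u) q₀ = 0 := fun u => by
    simp [hL, q₀, dot_cons_snoc, dot_zero_right]
  have h1 : ∀ u, dot 2 (L u) q₁ = 0 := fun u => by
    simp [hL, q₁, dot_cons_snoc, dot_zero_right]
  have h00 : dot 2 q₀ q₀ = 0 := by simp [q₀, dot_cons_snoc, dot_zero_right]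
  refine ⟨LinearMap.toContinuousLinearMap L, q₀, q₁, q₀, -1, funext hA, hB, h0, h1, h0, h00, h00,
    dot_comm q₁ q₀ ▸ h01, by norm_num, fun u _ => ?_, fun u v _ => ?_⟩
  · have h11 : dot 2 q₁ q₁ = 0 := by
      simp only [q₁, dot_cons_snoc, dot_zero_right]
      norm_num
    rw [h01, h11]
    ring
  · rw [h01]
    ring

/-- No quadratic term is needed on the quadrics: `q₀ = 0`, and `q = q₁` is the unit vector of the
added coordinate. Its norm, opposite to `⟨u, u⟩`, makes the lift null. The case `c = -1` is
analogous. -/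
lemma exists_isConeModel_pos (n : ℕ) : ∃ L q₀ q₁ q κ, IsConeModel n .pos L q₀ q₁ q κ := by
  let L : (Fin (n + 2) → ℝ) →ₗ[ℝ] (Fin (n + 3) → ℝ) :=
    { toFun := fun u => Fin.cons (α := fun _ : Fin (n + 3) => ℝ) 0 u
      map_add' := fun u v => by
        funext i
        refine Fin.cases (by simp) (fun i => by simp) i
      map_smul' := fun a v => by
        funext i
        refine Fin.cases (by simp) (fun i => by simp) i }
  let q₁ : Fin (n + 3) → ℝ := Fin.cons (α := fun _ : Fin (n + 3) => ℝ) 1 0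
  have hL : ∀ u, L u = Fin.cons (α := fun _ : Fin (n + 3) => ℝ) 0 u := fun u => rfl
  have h1 : dot 2 q₁ q₁ = -1 := by simp [q₁, dot_cons, dot_zero_left]
  have hL1 : ∀ u, dot 2 (L u) q₁ = 0 := fun u => by simp [hL, q₁, dot_cons, dot_zero_right]
  have hA : ∀ u : Fin (n + 2) → ℝ, (Fin.cons (α := fun _ : Fin (n + 3) => ℝ) 1 u :
      Fin (n + 3) → ℝ) = L u + (dot 1 u u / 2) • 0 + q₁ := by
    intro u
    funext i
    rw [hL]
    refine Fin.cases ?_ (fun i => ?_) i <;> simp [q₁]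
  have hB : ∀ u v, dot 2 (L u) (L v) = dot 1 u v := fun u v => by simp [hL, dot_cons]
  refine ⟨LinearMap.toContinuousLinearMap L, 0, q₁, q₁, -1, funext hA, hB,
    fun u => dot_zero_right _, hL1, hL1, dot_zero_left _, dot_zero_left _, h1, by norm_num, ?_, ?_⟩
  · intro u hu
    have := hu (by decide)
    rw [this, h1, dot_zero_left]
    simp
  · intro u v h
    rw [h (by decide)]
    ring

lemma exists_isConeModel_neg (n : ℕ) : ∃ L q₀ q₁ q κ, IsConeModel n .neg L q₀ q₁ q κ := by
  let L : (Fin (n + 2) → ℝ) →ₗ[ℝ] (Fin (n + 3) → ℝ) :=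
    { toFun := fun u => Fin.snoc (α := fun _ : Fin (n + 3) => ℝ) u 0
      map_add' := fun u v => by
        funext i
        refine Fin.lastCases (by simp) (fun i => by simp) i
      map_smul' := fun a v => by
        funext i
        refine Fin.lastCases (by simp) (fun i => by simp) i }
  let q₁ : Fin (n + 3) → ℝ := Fin.snoc (α := fun _ : Fin (n + 3) => ℝ) 0 1
  have hL : ∀ u, L u = Fin.snoc (α := fun _ : Fin (n + 3) => ℝ) u 0 := fun u => rfl
  have h1 : dot 2 q₁ q₁ = 1 := by simp [q₁, dot_snoc, dot_zero_left]
  have hL1 : ∀ u, dot 2 (L u) q₁ = 0 := fun u => by simp [hL, q₁, dot_snoc, dot_zero_right]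
  have hA : ∀ u : Fin (n + 2) → ℝ, (Fin.snoc (α := fun _ : Fin (n + 3) => ℝ) u 1 :
      Fin (n + 3) → ℝ) = L u + (dot 2 u u / 2) • 0 + q₁ := by
    intro u
    funext i
    rw [hL]
    refine Fin.lastCases ?_ (fun i => ?_) i <;> simp [q₁]
  have hB : ∀ u v, dot 2 (L u) (L v) = dot 2 u v := fun u v => by simp [hL, dot_snoc]
  refine ⟨LinearMap.toContinuousLinearMap L, 0, q₁, q₁, 1, funext hA, hB,
    fun u => dot_zero_right _, hL1, hL1, dot_zero_left _, dot_zero_left _, h1, by norm_num, ?_, ?_⟩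
  · intro u hu
    have := hu (by decide)
    rw [this, h1, dot_zero_left]
    simp
  · intro u v h
    rw [h (by decide)]
    ring

lemma exists_isConeModel (n : ℕ) (c : SignType) :
    ∃ L q₀ q₁ q κ, IsConeModel n c L q₀ q₁ q κ := by
  cases c
  · exact exists_isConeModel_zero n
  · exact exists_isConeModel_neg n
  · exact exists_isConeModel_pos n

variable {c : SignType} {L : Ambient n c →L[ℝ] (Fin (n + 3) → ℝ)} {q₀ q₁ q : Fin (n + 3) → ℝ}
  {κ : ℝ}

lemma IsConeModel.fderiv_coneLift (h : IsConeModel n c L q₀ q₁ q κ) (u v : Ambient n c) :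
    fderiv ℝ (coneLift n c) u v = L v + dot (ambientIndex c) u v • q₀ := by
  have h2 : (fun u : Ambient n c => dot (ambientIndex c) u u / 2) =
      fun u => dot (ambientIndex c) u ((1 / 2 : ℝ) • u) := by
    funext u
    rw [dot_smul_right]
    ring
  have hid : DifferentiableAt ℝ (fun u : Ambient n c => u) u := differentiableAt_id
  have hhalf : DifferentiableAt ℝ (fun u : Ambient n c => (1 / 2 : ℝ) • u) u :=
    differentiableAt_id.fun_const_smul _
  have hd : DifferentiableAt ℝ (fun u : Ambient n c => dot (ambientIndex c) u u / 2) u := by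
    rw [h2]
    exact differentiableAt_dot hid hhalf
  have h1 : fderiv ℝ (fun u : Ambient n c => dot (ambientIndex c) u u / 2) u v =
      dot (ambientIndex c) u v := by
    rw [h2, fderiv_dot hid hhalf, fderiv_fun_const_smul hid]
    simp only [fderiv_fun_id, ContinuousLinearMap.id_apply, smul_apply,
      dot_smul_right, dot_smul_left, dot_comm v]
    ring
  rw [h.coneLift_eq, fderiv_add_const, fderiv_fun_add L.differentiableAt (hd.smul_const q₀),
    fderiv_smul_const hd]
  simp [h1]

/-- A spacelike hypersurface of a Lorentzian space form in coordinates gives a spacelike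
hypersurface in the light cone. -/
lemma IsConeModel.isLocalCone (h : IsConeModel n c L q₀ q₁ q κ) {U : Set (E n)} (hU : IsOpen U)
    {x ν : E n → Ambient n c} (hx : ∀ u ∈ U, ContDiffAt ℝ ∞ x u)
    (hν : ∀ u ∈ U, ContDiffAt ℝ ∞ ν u) (hmem : ∀ u ∈ U, x u ∈ spaceForm n c)
    (hpos : ∀ u ∈ U, ∀ X, X ≠ 0 → 0 < dot (ambientIndex c) (fderiv ℝ x u X) (fderiv ℝ x u X))
    (htan : ∀ u ∈ U, c ≠ 0 → dot (ambientIndex c) (x u) (ν u) = 0)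
    (hnor : ∀ u ∈ U, ∀ X, dot (ambientIndex c) (fderiv ℝ x u X) (ν u) = 0)
    (hunit : ∀ u ∈ U, dot (ambientIndex c) (ν u) (ν u) = -1) :
    IsLocalCone (fun u => coneLift n c (x u)) (fun u => fderiv ℝ (coneLift n c) (x u) (ν u))
      q κ U ∧
    ∀ u ∈ U, ∀ X Z,
      dot 2 (fderiv ℝ (fun u => coneLift n c (x u)) u X)
        (fderiv ℝ (fun u => coneLift n c (x u)) u Z) =
        dot (ambientIndex c) (fderiv ℝ x u X) (fderiv ℝ x u Z) ∧
      dot 2 (fderiv ℝ (fun u => fderiv ℝ (coneLift n c) (x u) (ν u)) u X)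
        (fderiv ℝ (fun u => coneLift n c (x u)) u Z) =
        dot (ambientIndex c) (fderiv ℝ ν u X) (fderiv ℝ x u Z) := by
  have hsm : ContDiff ℝ ∞ (coneLift n c) := by
    rw [h.coneLift_eq]
    have : ContDiff ℝ ∞ fun u : Ambient n c => dot (ambientIndex c) u u :=
      contDiff_iff_contDiffAt.2 fun u => contDiffAt_dot contDiffAt_id contDiffAt_id
    exact (L.contDiff.add ((this.div_const 2).smul contDiff_const)).add contDiff_const
  have hxd : ∀ u ∈ U, DifferentiableAt ℝ x u := fun u hu => (hx u hu).differentiableAt (by simp)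
  have hνd : ∀ u ∈ U, DifferentiableAt ℝ ν u := fun u hu => (hν u hu).differentiableAt (by simp)
  have hdy : ∀ u ∈ U, ∀ X, fderiv ℝ (fun u => coneLift n c (x u)) u X =
      L (fderiv ℝ x u X) + dot (ambientIndex c) (x u) (fderiv ℝ x u X) • q₀ := by
    intro u hu X
    rw [← h.fderiv_coneLift]
    have := fderiv_comp u (hsm.differentiable (by simp) (x u)) (hxd u hu)
    exact congrArg (fun F : E n →L[ℝ] (Fin (n + 3) → ℝ) => F X) this
  have hw : (fun u => fderiv ℝ (coneLift n c) (x u) (ν u)) =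
      fun u => L (ν u) + dot (ambientIndex c) (x u) (ν u) • q₀ :=
    funext fun u => h.fderiv_coneLift _ _
  have hdw : ∀ u ∈ U, ∀ X, fderiv ℝ (fun u => fderiv ℝ (coneLift n c) (x u) (ν u)) u X =
      L (fderiv ℝ ν u X) + dot (ambientIndex c) (x u) (fderiv ℝ ν u X) • q₀ := by
    intro u hu X
    have hL : HasFDerivAt (fun u => L (ν u)) (L.comp (fderiv ℝ ν u)) u :=
      L.hasFDerivAt.comp u (hνd u hu).hasFDerivAt
    have hd : DifferentiableAt ℝ (fun u => dot (ambientIndex c) (x u) (ν u)) u :=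
      differentiableAt_dot (hxd u hu) (hνd u hu)
    rw [hw, fderiv_fun_add hL.differentiableAt (hd.smul_const q₀), fderiv_smul_const hd, hL.fderiv]
    simp only [add_apply, ContinuousLinearMap.smulRight_apply,
      ContinuousLinearMap.comp_apply]
    rw [fderiv_dot (hxd u hu) (hνd u hu), hnor u hu, zero_add]
  have hyy : ∀ u ∈ U, ∀ X Z,
      dot 2 (fderiv ℝ (fun u => coneLift n c (x u)) u X)
        (fderiv ℝ (fun u => coneLift n c (x u)) u Z) =
        dot (ambientIndex c) (fderiv ℝ x u X) (fderiv ℝ x u Z) := by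
    intro u hu X Z
    -- Both differentials are `L` of a vector plus a multiple of `q₀`. As `q₀` is null and
    -- orthogonal to the image of `L`, only the isometric part contributes.
    rw [hdy u hu, hdy u hu]
    simp only [dot_add_left, dot_add_right, dot_smul_left, dot_smul_right, h.dot_L, h.dot_L_q₀,
      h.q₀q₀, dot_comm q₀ (L _)]
    ring
  refine ⟨⟨hU, fun u hu => hsm.contDiffAt.comp u (hx u hu), fun u hu => ?_, fun u hu => ?_,
    fun u hu => ?_, fun u hu => ?_, fun u hu X => ?_, fun u hu X hX => ?_, fun u hu => ?_,
    fun u hu => ?_, h.κ_ne⟩, fun u hu X Z => ⟨hyy u hu X Z, ?_⟩⟩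
  · rw [hw]
    exact (L.contDiff.contDiffAt.comp u (hν u hu)).add
      ((contDiffAt_dot (hx u hu) (hν u hu)).smul contDiffAt_const)
  · have := h.light _ (hmem u hu)
    rw [h.coneLift_eq]
    simp only [dot_add_left, dot_add_right, dot_smul_left, dot_smul_right, h.dot_L, h.dot_L_q₀,
      h.q₀q₀, h.dot_L_q₁, dot_comm q₀ (L _), dot_comm q₁ (L _), dot_comm q₁ q₀]
    linarith
  · simp only [h.fderiv_coneLift, dot_add_left, dot_add_right, dot_smul_left, dot_smul_right,
      h.dot_L, h.dot_L_q₀, h.q₀q₀, dot_comm q₀ (L _), hunit u hu]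
    ring
  · have := h.tangent _ _ (htan u hu)
    rw [h.fderiv_coneLift, h.coneLift_eq]
    simp only [dot_add_left, dot_add_right, dot_smul_left, dot_smul_right, h.dot_L, h.dot_L_q₀,
      h.q₀q₀, h.dot_L_q₁, dot_comm q₀ (L _), dot_comm (ν u) (x u)]
    linarith
  · rw [h.fderiv_coneLift, hdy u hu]
    simp only [dot_add_left, dot_add_right, dot_smul_left, dot_smul_right, h.dot_L, h.dot_L_q₀,
      h.q₀q₀, dot_comm q₀ (L _), dot_comm (ν u), hnor u hu]
    ring
  · rw [hyy u hu]
    exact hpos u hu X hX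
  · simp only [h.fderiv_coneLift, dot_add_left, dot_smul_left, h.dot_L_q, h.q₀q]
    ring
  · simp only [h.coneLift_eq, dot_add_left, dot_smul_left, h.dot_L_q, h.q₀q, h.q₁q]
    ring
  · rw [hdy u hu, hdw u hu]
    simp only [dot_add_left, dot_add_right, dot_smul_left, dot_smul_right, h.dot_L, h.dot_L_q₀,
      h.q₀q₀, dot_comm q₀ (L _)]
    ring

end ConeLift

/-! ### Functions on the manifold in coordinates -/

section Charts

variable {n m : ℕ} {M : Type*} [TopologicalSpace M] [ChartedSpace (E n) M]

lemma inCoords_apply_extChartAt {W : Type*} (p : M) (f : M → W) :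
    inCoords p f (extChartAt 𝓘(ℝ, E n) p p) = f p := by
  simp [inCoords]

lemma diff_eq_fderiv_inCoords {f : M → Fin m → ℝ} {p : M}
    (hf : MDifferentiableAt 𝓘(ℝ, E n) 𝓘(ℝ, Fin m → ℝ) f p) (X : E n) :
    diff f p X = fderiv ℝ (inCoords p f) (extChartAt 𝓘(ℝ, E n) p p) X := by
  have h1 := hf.mfderiv
  simp only [modelWithCornersSelf_coe, Set.range_id, fderivWithin_univ] at h1
  exact congrArg (fun F : E n →L[ℝ] (Fin m → ℝ) => F X) h1

variable [IsManifold 𝓘(ℝ, E n) ∞ M]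

lemma mdifferentiableAt_of_inCoords {f : M → Fin m → ℝ} {p : M}
    (hf : DifferentiableAt ℝ (inCoords p f) (extChartAt 𝓘(ℝ, E n) p p)) :
    MDifferentiableAt 𝓘(ℝ, E n) 𝓘(ℝ, Fin m → ℝ) f p := by
  have : IsManifold 𝓘(ℝ, E n) 1 M := IsManifold.of_le (n := ∞) (by exact_mod_cast le_top)
  have h1 : MDifferentiableAt 𝓘(ℝ, E n) 𝓘(ℝ, Fin m → ℝ)
      (inCoords p f ∘ extChartAt 𝓘(ℝ, E n) p) p :=
    hf.mdifferentiableAt.comp p (mdifferentiableAt_extChartAt (mem_chart_source _ _))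
  refine h1.congr_of_eventuallyEq ?_
  filter_upwards [extChartAt_source_mem_nhds (I := 𝓘(ℝ, E n)) p] with z hz
  exact congrArg f ((extChartAt 𝓘(ℝ, E n) p).left_inv hz).symm

lemma contDiffAt_inCoords {f : M → Fin m → ℝ} (hf : ContMDiff 𝓘(ℝ, E n) 𝓘(ℝ, Fin m → ℝ) ∞ f)
    (p : M) {u : E n} (hu : u ∈ (extChartAt 𝓘(ℝ, E n) p).target) :
    ContDiffAt ℝ ∞ (inCoords p f) u := by
  have h1 : ContMDiffOn 𝓘(ℝ, E n) 𝓘(ℝ, Fin m → ℝ) ∞ (inCoords p f)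
      (extChartAt 𝓘(ℝ, E n) p).target := hf.comp_contMDiffOn (contMDiffOn_extChartAt_symm p)
  exact (contMDiffOn_iff_contDiffOn.1 h1).contDiffAt ((isOpen_extChartAt_target p).mem_nhds hu)

lemma mdifferentiableAt_extChartAt_symm {p : M} {u : E n}
    (hu : u ∈ (extChartAt 𝓘(ℝ, E n) p).target) :
    MDifferentiableAt 𝓘(ℝ, E n) 𝓘(ℝ, E n) (extChartAt 𝓘(ℝ, E n) p).symm u :=
  ((contMDiffOn_extChartAt_symm (n := ∞) p).contMDiffAt
    ((isOpen_extChartAt_target p).mem_nhds hu)).mdifferentiableAt (by simp)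

/-- The differential of the inverse of a chart. -/
lemma exists_mfderiv_extChartAt_symm {p : M} {u : E n}
    (hu : u ∈ (extChartAt 𝓘(ℝ, E n) p).target) :
    ∃ J : E n ≃ₗ[ℝ] E n,
      (∀ X, J X = mfderiv 𝓘(ℝ, E n) 𝓘(ℝ, E n) (extChartAt 𝓘(ℝ, E n) p).symm u X) ∧
      ∀ {m : ℕ} {f : M → Fin m → ℝ}, ContMDiff 𝓘(ℝ, E n) 𝓘(ℝ, Fin m → ℝ) ∞ f → ∀ X,
        fderiv ℝ (inCoords p f) u X = diff f ((extChartAt 𝓘(ℝ, E n) p).symm u) (J X) := by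
  have : IsManifold 𝓘(ℝ, E n) 1 M := IsManifold.of_le (n := ∞) (by exact_mod_cast le_top)
  obtain ⟨J, hJ⟩ := isInvertible_mfderivWithin_extChartAt_symm (I := 𝓘(ℝ, E n)) hu
  simp only [modelWithCornersSelf_coe, Set.range_id, mfderivWithin_univ] at hJ
  have hJ' : ∀ X, J X = mfderiv 𝓘(ℝ, E n) 𝓘(ℝ, E n) (extChartAt 𝓘(ℝ, E n) p).symm u X :=
    fun X => by rw [← hJ]; rfl
  refine ⟨J.toLinearEquiv, hJ', fun {m f} hf X => ?_⟩
  have h1 := mfderiv_comp_apply u (hf.mdifferentiableAt (by simp))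
    (mdifferentiableAt_extChartAt_symm hu) X
  rw [mfderiv_eq_fderiv] at h1
  exact h1.trans (congrArg (fun Z => diff f _ Z) (hJ' X).symm)

end Charts

/-! ### Spacelike hypersurfaces and the light cone -/

section Hypersurfaces

variable {n : ℕ} {M : Type*} [TopologicalSpace M] [ChartedSpace (E n) M] {c : SignType}
  {x ν : M → Ambient n c}

/-- The image of the unit normal under the differential of the canonical lift. -/
noncomputable def normalLift (c : SignType) (x ν : M → Ambient n c) (p : M) : Fin (n + 3) → ℝ :=
  fderiv ℝ (coneLift n c) (x p) (ν p)

/-- The mean curvature. -/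
noncomputable def meanCurvature (c : SignType) (x ν : M → Ambient n c) (p : M) : ℝ :=
  (∑ i, principalCurvature c x ν i p) / n

/-- The square root of the factor of the conformal metric. -/
noncomputable def conformalScale (c : SignType) (x : M → Ambient n c) (p : M) : ℝ :=
  Real.sqrt (conformalFactor c x p)

variable [IsManifold 𝓘(ℝ, E n) ∞ M]

variable {L : Ambient n c →L[ℝ] (Fin (n + 3) → ℝ)} {q₀ q₁ q : Fin (n + 3) → ℝ} {κ : ℝ}

lemma IsConeModel.isLocalCone_inCoords (h : IsConeModel n c L q₀ q₁ q κ)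
    (hx : IsSpacelikeHypersurface c x) (hν : IsUnitNormal c x ν) (p : M) :
    IsLocalCone (inCoords p (lift c x)) (inCoords p (normalLift c x ν)) q κ
      (extChartAt 𝓘(ℝ, E n) p).target ∧
    ∀ u ∈ (extChartAt 𝓘(ℝ, E n) p).target, ∀ X Z,
      dot 2 (fderiv ℝ (inCoords p (lift c x)) u X) (fderiv ℝ (inCoords p (lift c x)) u Z) =
        dot (ambientIndex c) (fderiv ℝ (inCoords p x) u X) (fderiv ℝ (inCoords p x) u Z) ∧
      dot 2 (fderiv ℝ (inCoords p (normalLift c x ν)) u X)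
        (fderiv ℝ (inCoords p (lift c x)) u Z) =
        dot (ambientIndex c) (fderiv ℝ (inCoords p ν) u X) (fderiv ℝ (inCoords p x) u Z) := by
  refine h.isLocalCone (x := inCoords p x) (ν := inCoords p ν) (isOpen_extChartAt_target p)
    (fun u hu => contDiffAt_inCoords hx.smooth p hu)
    (fun u hu => contDiffAt_inCoords hν.smooth p hu) (fun u _ => hx.mem_spaceForm _) ?_
    (fun u _ => hν.tangent_spaceForm _) ?_ (fun u _ => hν.unit _)
  · intro u hu X hX
    obtain ⟨J, -, hJ⟩ := exists_mfderiv_extChartAt_symm hu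
    rw [hJ hx.smooth]
    exact hx.spacelike _ _ fun h0 => hX (J.map_eq_zero_iff.1 h0)
  · intro u hu X
    obtain ⟨J, -, hJ⟩ := exists_mfderiv_extChartAt_symm hu
    rw [hJ hx.smooth]
    exact hν.normal _ _

/-- The expressions of the shape operator in different coordinates are conjugate. -/
lemma shapeOperator_apply (hx : IsSpacelikeHypersurface c x) (hν : IsUnitNormal c x ν) {p : M}
    {u : E n} (hu : u ∈ (extChartAt 𝓘(ℝ, E n) p).target) :
    ∃ J : E n ≃ₗ[ℝ] E n,
      (∀ X, J X = mfderiv 𝓘(ℝ, E n) 𝓘(ℝ, E n) (extChartAt 𝓘(ℝ, E n) p).symm u X) ∧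
      ∀ X, shapeOperator c x ν ((extChartAt 𝓘(ℝ, E n) p).symm u) (J X) =
        J (coordShape (inCoords p (lift c x)) (inCoords p (normalLift c x ν)) u X) := by
  obtain ⟨L, q₀, q₁, q, κ, h⟩ := exists_isConeModel n c
  obtain ⟨hc, hdot⟩ := h.isLocalCone_inCoords hx hν p
  obtain ⟨J, hJm, hJ⟩ := exists_mfderiv_extChartAt_symm hu
  refine ⟨J, hJm, fun X => ?_⟩
  set p' := (extChartAt 𝓘(ℝ, E n) p).symm u
  let D : E n →ₗ[ℝ] Ambient n c := (mfderiv 𝓘(ℝ, E n) 𝓘(ℝ, Ambient n c) x p').toLinearMap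
  let D' : E n →ₗ[ℝ] Ambient n c := (mfderiv 𝓘(ℝ, E n) 𝓘(ℝ, Ambient n c) ν p').toLinearMap
  have hD : ∀ X, X ≠ 0 → 0 < dot (ambientIndex c) (D X) (D X) := hx.spacelike p'
  refine ext_of_dot hD fun Z => ?_
  obtain ⟨Z, rfl⟩ := J.surjective Z
  have h1 : dot (ambientIndex c) (D (shapeOperator c x ν p' (J X))) (D (J Z)) =
    dot (ambientIndex c) (D' (J X)) (D (J Z)) := raiseIndex_spec hD (J X) (J Z)
  rw [h1]
  have h2 : dot (ambientIndex c) (D' (J X)) (D (J Z)) =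
      dot (ambientIndex c) (fderiv ℝ (inCoords p ν) u X) (fderiv ℝ (inCoords p x) u Z) := by
    rw [hJ hν.smooth, hJ hx.smooth]
    rfl
  rw [h2, ← (hdot u hu X Z).2, ← hc.coordShape_spec hu, (hdot u hu _ Z).1, hJ hx.smooth,
    hJ hx.smooth]
  rfl

/-- At the centre of a chart the manifold derivative is the derivative in that chart, so no
conjugation is needed here. -/
lemma shapeOperator_eq_coordShape (hx : IsSpacelikeHypersurface c x) (hν : IsUnitNormal c x ν)
    (p : M) : (shapeOperator c x ν p : Module.End ℝ (E n)) =
      coordShape (inCoords p (lift c x)) (inCoords p (normalLift c x ν))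
        (extChartAt 𝓘(ℝ, E n) p p) := by
  obtain ⟨L, q₀, q₁, q, κ, h⟩ := exists_isConeModel n c
  obtain ⟨hc, hdot⟩ := h.isLocalCone_inCoords hx hν p
  have hu := mem_extChartAt_target (I := 𝓘(ℝ, E n)) p
  have hx' := fun X => diff_eq_fderiv_inCoords (hx.smooth.mdifferentiableAt (by simp) (x := p)) X
  have hν' := fun X => diff_eq_fderiv_inCoords (hν.smooth.mdifferentiableAt (by simp) (x := p)) X
  have e1 : (fun X Z : E n => dot (ambientIndex c) (diff x p X) (diff x p Z)) =
      fun X Z => dot 2 (fderiv ℝ (inCoords p (lift c x)) (extChartAt 𝓘(ℝ, E n) p p) X)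
        (fderiv ℝ (inCoords p (lift c x)) (extChartAt 𝓘(ℝ, E n) p p) Z) := by
    funext X Z
    rw [(hdot _ hu X Z).1, hx', hx']
  have e2 : (fun X Z : E n => dot (ambientIndex c) (diff ν p X) (diff x p Z)) =
      fun X Z => dot 2 (fderiv ℝ (inCoords p (normalLift c x ν)) (extChartAt 𝓘(ℝ, E n) p p) X)
        (fderiv ℝ (inCoords p (lift c x)) (extChartAt 𝓘(ℝ, E n) p p) Z) := by
    funext X Z
    rw [(hdot _ hu X Z).2, hν', hx']
  exact congrArg₂ raiseIndex e1 e2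

/-- The shape operator has an eigenbasis for the principal curvatures. -/
lemma exists_principalBasis (hx : IsSpacelikeHypersurface c x) (hν : IsUnitNormal c x ν) (p : M) :
    Monotone (fun i => principalCurvature c x ν i p) ∧
      ∃ e : Module.Basis (Fin n) ℝ (E n), ∀ i,
        shapeOperator c x ν p (e i) = principalCurvature c x ν i p • e i := by
  obtain ⟨L, q₀, q₁, q, κ, h⟩ := exists_isConeModel n c
  obtain ⟨hc, -⟩ := h.isLocalCone_inCoords hx hν p
  obtain ⟨e, d, he⟩ := hc.exists_eigenbasis (mem_extChartAt_target (I := 𝓘(ℝ, E n)) p)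
  rw [← shapeOperator_eq_coordShape hx hν] at he
  exact exists_ordered_eigenbasis he

lemma exists_centerBasis (hx : IsSpacelikeHypersurface c x) (hν : IsUnitNormal c x ν) (p : M) :
    Monotone (fun i => principalCurvature c x ν i p) ∧
      ∃ e : Module.Basis (Fin n) ℝ (E n), ∀ i,
        coordShape (inCoords p (lift c x)) (inCoords p (normalLift c x ν))
          (extChartAt 𝓘(ℝ, E n) p p) (e i) = principalCurvature c x ν i p • e i := by
  obtain ⟨hmono, e, he⟩ := exists_principalBasis hx hν p
  rw [shapeOperator_eq_coordShape hx hν] at he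
  exact ⟨hmono, e, he⟩

/-- The shape operator in coordinates has an eigenbasis for the principal curvatures. -/
lemma exists_coordBasis (hx : IsSpacelikeHypersurface c x) (hν : IsUnitNormal c x ν) {p : M}
    {u : E n} (hu : u ∈ (extChartAt 𝓘(ℝ, E n) p).target) :
    ∃ e : Module.Basis (Fin n) ℝ (E n), ∀ i,
      coordShape (inCoords p (lift c x)) (inCoords p (normalLift c x ν)) u (e i) =
        inCoords p (principalCurvature c x ν i) u • e i := by
  obtain ⟨J, -, hJ⟩ := shapeOperator_apply hx hν hu
  obtain ⟨-, e, he⟩ := exists_principalBasis hx hν ((extChartAt 𝓘(ℝ, E n) p).symm u)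
  refine ⟨e.map J.symm, fun i => J.injective ?_⟩
  rw [← hJ]
  simp only [Module.Basis.map_apply, LinearEquiv.apply_symm_apply, map_smul]
  exact he i

end Hypersurfaces

/-! ### The conformal invariants in terms of the principal curvatures -/

section Invariants

variable {n : ℕ} {M : Type*} [TopologicalSpace M] [ChartedSpace (E n) M] {c : SignType}
  {x ν : M → Ambient n c} [IsManifold 𝓘(ℝ, E n) ∞ M]

lemma setOf_hasEigenvalue_eq_range (hx : IsSpacelikeHypersurface c x) (hν : IsUnitNormal c x ν)
    (p : M) : {l : ℝ | (shapeOperator c x ν p).HasEigenvalue l} =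
      Set.range fun i => principalCurvature c x ν i p := by
  obtain ⟨-, e, he⟩ := exists_principalBasis hx hν p
  ext l
  exact hasEigenvalue_iff he l

lemma three_le (hx : IsSpacelikeHypersurface c x) (hν : IsUnitNormal c x ν) {p : M}
    (hr : 3 ≤ numPrincipalCurvatures c x ν p) : 3 ≤ n := by
  refine hr.trans ?_
  rw [numPrincipalCurvatures, setOf_hasEigenvalue_eq_range hx hν]
  have := Set.ncard_image_le (f := fun i : Fin n => principalCurvature c x ν i p) Set.finite_univ
  simpa [Set.ncard_univ] using this

lemma exists_principalCurvature_ne (hx : IsSpacelikeHypersurface c x) (hν : IsUnitNormal c x ν)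
    {p : M} (hr : 3 ≤ numPrincipalCurvatures c x ν p) (a : ℝ) :
    ∃ i, principalCurvature c x ν i p ≠ a := by
  by_contra! h
  have h1 : Set.range (fun i => principalCurvature c x ν i p) ⊆ {a} := by
    rintro _ ⟨i, rfl⟩
    exact h i
  rw [numPrincipalCurvatures, setOf_hasEigenvalue_eq_range hx hν] at hr
  have := Set.ncard_le_ncard h1
  rw [Set.ncard_singleton] at this
  omega

lemma sum_sq_sub_eq (a : Fin n → ℝ) (hn : n ≠ 0) :
    ∑ i, a i ^ 2 - (∑ i, a i) ^ 2 / n = ∑ i, (a i - (∑ j, a j) / n) ^ 2 := by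
  have hn' : (n : ℝ) ≠ 0 := by exact_mod_cast hn
  simp only [sub_sq, Finset.sum_add_distrib, Finset.sum_sub_distrib, ← Finset.sum_mul,
    ← Finset.mul_sum]
  simp
  field_simp
  ring

/-- The traces of `A` and `A²` combine to the sum of squared deviations of the principal curvatures
from their mean. It vanishes exactly at umbilic points. -/
lemma conformalFactor_eq (hx : IsSpacelikeHypersurface c x) (hν : IsUnitNormal c x ν) (p : M)
    (hn : 2 ≤ n) : conformalFactor c x p =
      n / (n - 1) * ∑ i, (principalCurvature c x ν i p - meanCurvature c x ν p) ^ 2 := by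
  obtain ⟨L, q₀, q₁, q, κ, h⟩ := exists_isConeModel n c
  obtain ⟨hc, -⟩ := h.isLocalCone_inCoords hx hν p
  obtain ⟨-, e, he⟩ := exists_centerBasis hx hν p
  have := hc.factor_eq (mem_extChartAt_target (I := 𝓘(ℝ, E n)) p) hn
  rw [trace_mul_self_eq_sum he, trace_eq_sum he, sum_sq_sub_eq _ (by omega)] at this
  exact this

lemma conformalFactor_pos (hx : IsSpacelikeHypersurface c x) (hν : IsUnitNormal c x ν) {p : M}
    (hr : 3 ≤ numPrincipalCurvatures c x ν p) : 0 < conformalFactor c x p := by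
  have hn := three_le hx hν hr
  have hn' : (3 : ℝ) ≤ n := by exact_mod_cast hn
  obtain ⟨i, hi⟩ := exists_principalCurvature_ne hx hν hr (meanCurvature c x ν p)
  rw [conformalFactor_eq hx hν p (by omega)]
  refine mul_pos (div_pos (by linarith) (by linarith)) ?_
  exact Finset.sum_pos' (fun _ _ => sq_nonneg _) ⟨i, Finset.mem_univ _,
    by have := sub_ne_zero.2 hi; positivity⟩

lemma conformalScale_pos (hx : IsSpacelikeHypersurface c x) (hν : IsUnitNormal c x ν) {p : M}
    (hr : 3 ≤ numPrincipalCurvatures c x ν p) : 0 < conformalScale c x p :=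
  Real.sqrt_pos.2 (conformalFactor_pos hx hν hr)

lemma inCoords_meanCurvature (hx : IsSpacelikeHypersurface c x) (hν : IsUnitNormal c x ν) {p : M}
    {u : E n} (hu : u ∈ (extChartAt 𝓘(ℝ, E n) p).target) :
    inCoords p (meanCurvature c x ν) u = LinearMap.trace ℝ (E n)
      (coordShape (inCoords p (lift c x)) (inCoords p (normalLift c x ν)) u) / n := by
  obtain ⟨e, he⟩ := exists_coordBasis hx hν hu
  rw [trace_eq_sum he]
  rfl

lemma contDiffAt_meanCurvature (hx : IsSpacelikeHypersurface c x) (hν : IsUnitNormal c x ν)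
    {p : M} {u : E n} (hu : u ∈ (extChartAt 𝓘(ℝ, E n) p).target) :
    ContDiffAt ℝ ∞ (inCoords p (meanCurvature c x ν)) u := by
  obtain ⟨L, q₀, q₁, q, κ, h⟩ := exists_isConeModel n c
  obtain ⟨hc, -⟩ := h.isLocalCone_inCoords hx hν p
  exact ((hc.contDiffAt_trace hu).div_const _).congr_of_eventuallyEq
    (Filter.eventuallyEq_of_mem ((isOpen_extChartAt_target p).mem_nhds hu)
      fun v hv => inCoords_meanCurvature hx hν hv)

/-- The factor is smooth as a polynomial in traces, and its square root is smooth because the factor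
is positive. -/
lemma contDiffAt_conformalScale (hx : IsSpacelikeHypersurface c x) (hν : IsUnitNormal c x ν)
    (hr : ∀ p, 3 ≤ numPrincipalCurvatures c x ν p)
    {p : M} {u : E n} (hu : u ∈ (extChartAt 𝓘(ℝ, E n) p).target) :
    ContDiffAt ℝ ∞ (inCoords p (conformalScale c x)) u := by
  obtain ⟨L, q₀, q₁, q, κ, h⟩ := exists_isConeModel n c
  obtain ⟨hc, -⟩ := h.isLocalCone_inCoords hx hν p
  have hn := three_le hx hν (hr p)
  have hf : ContDiffAt ℝ ∞ (inCoords p (conformalFactor c x)) u := by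
    refine (contDiffAt_const (c := (n : ℝ) / (n - 1)).mul ((hc.contDiffAt_trace_mul_self hu).sub
      (((hc.contDiffAt_trace hu).pow 2).div_const (n : ℝ)))).congr_of_eventuallyEq
      (Filter.eventuallyEq_of_mem ((isOpen_extChartAt_target p).mem_nhds hu) fun v hv => ?_)
    obtain ⟨e, he⟩ := exists_coordBasis hx hν hv
    simp only [trace_mul_self_eq_sum he, trace_eq_sum he]
    rw [sum_sq_sub_eq _ (by omega)]
    exact conformalFactor_eq hx hν _ (by omega)
  exact hf.sqrt (conformalFactor_pos hx hν (hr _)).ne'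

lemma mdifferentiableAt_positionVector (hx : IsSpacelikeHypersurface c x)
    (hν : IsUnitNormal c x ν) (hr : ∀ p, 3 ≤ numPrincipalCurvatures c x ν p) (p : M) :
    MDifferentiableAt 𝓘(ℝ, E n) 𝓘(ℝ, Fin (n + 3) → ℝ) (positionVector c x) p := by
  obtain ⟨L, q₀, q₁, q, κ, h⟩ := exists_isConeModel n c
  obtain ⟨hc, -⟩ := h.isLocalCone_inCoords hx hν p
  have hu := mem_extChartAt_target (I := 𝓘(ℝ, E n)) p
  exact mdifferentiableAt_of_inCoords
    (((contDiffAt_conformalScale hx hν hr hu).smul (hc.smooth_y _ hu)).differentiableAt (by simp))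

lemma diff_positionVector (hx : IsSpacelikeHypersurface c x)
    (hν : IsUnitNormal c x ν) (hr : ∀ p, 3 ≤ numPrincipalCurvatures c x ν p) (p : M) (X : E n) :
    diff (positionVector c x) p X = fderiv ℝ
      (fun v => inCoords p (conformalScale c x) v • inCoords p (lift c x) v)
      (extChartAt 𝓘(ℝ, E n) p p) X :=
  diff_eq_fderiv_inCoords (mdifferentiableAt_positionVector hx hν hr p) X

/-- The conformal normal is `ν* - H y`. -/
lemma conformalNormal_eq (hx : IsSpacelikeHypersurface c x) (hν : IsUnitNormal c x ν)
    (hr : ∀ p, 3 ≤ numPrincipalCurvatures c x ν p) {ξ : M → Fin (n + 3) → ℝ}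
    (hξ : IsConformalNormal c x ν ξ) (p : M) :
    ξ p = normalLift c x ν p - meanCurvature c x ν p • lift c x p := by
  obtain ⟨L, q₀, q₁, q, κ, h⟩ := exists_isConeModel n c
  obtain ⟨hc, -⟩ := h.isLocalCone_inCoords hx hν p
  have hu := mem_extChartAt_target (I := 𝓘(ℝ, E n)) p
  have hn := three_le hx hν (hr p)
  have hρ0 : 0 < conformalScale c x p := conformalScale_pos hx hν (hr p)
  have hρ : ∀ v ∈ (extChartAt 𝓘(ℝ, E n) p).target,
    ContDiffAt ℝ ∞ (inCoords p (conformalScale c x)) v := fun v hv =>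
      contDiffAt_conformalScale hx hν hr hv
  have hρu : inCoords p (conformalScale c x) (extChartAt 𝓘(ℝ, E n) p p) = conformalScale c x p :=
    inCoords_apply_extChartAt p _
  obtain ⟨h1, h2, -⟩ := hc.dot_laplacian_smul_y hu hρ (hρu ▸ hρ0.ne')
  -- As `Y = ρ y` and `N` is a combination of `ΔY` and `Y`, orthogonality of `ξ` to `Y`, `N` and
  -- `dY` becomes orthogonality to `y`, `ΔY` and `dy`.
  have hy : dot 2 (ξ p) (lift c x p) = 0 := by
    have := hξ.orth_position p
    rw [positionVector, dot_smul_right] at this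
    exact (mul_eq_zero.1 this).resolve_left hρ0.ne'
  have hL : dot 2 (ξ p) (laplacianPosition c x p) = 0 := by
    have := hξ.orth_nullNormal p
    rw [nullNormal, dot_sub_right, dot_smul_right, dot_smul_right, hξ.orth_position, mul_zero,
      sub_zero] at this
    refine (mul_eq_zero.1 this).resolve_left ?_
    have : (n : ℝ) ≠ 0 := by
      have : n ≠ 0 := by omega
      exact_mod_cast this
    simp [this]
  have hD : ∀ X, dot 2 (ξ p)
      (fderiv ℝ (inCoords p (lift c x)) (extChartAt 𝓘(ℝ, E n) p p) X) = 0 := by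
    intro X
    have := hξ.orth_tangent p X
    rw [diff_positionVector hx hν hr, hc.fderiv_smul_y hu ((hρ _ hu).differentiableAt (by simp)),
      dot_add_right, dot_smul_right, dot_smul_right, inCoords_apply_extChartAt,
      inCoords_apply_extChartAt, hy, mul_zero, add_zero] at this
    exact (mul_eq_zero.1 this).resolve_left hρ0.ne'
  have hfr := hc.frame hu
  rw [inCoords_apply_extChartAt, inCoords_apply_extChartAt] at hfr
  rw [inCoords_apply_extChartAt, hρu] at h1 h2
  have := hfr.normal_eq hρ0 (by omega) hy hD hL (hξ.unit p) (hξ.orientation p) h1 h2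
  rw [this, ← inCoords_meanCurvature hx hν hu, inCoords_apply_extChartAt]

lemma diff_conformalNormal (hx : IsSpacelikeHypersurface c x) (hν : IsUnitNormal c x ν)
    (hr : ∀ p, 3 ≤ numPrincipalCurvatures c x ν p) {ξ : M → Fin (n + 3) → ℝ}
    (hξ : IsConformalNormal c x ν ξ) (p : M) (X : E n) :
    diff ξ p X = fderiv ℝ (fun v => inCoords p (normalLift c x ν) v -
      inCoords p (meanCurvature c x ν) v • inCoords p (lift c x) v)
      (extChartAt 𝓘(ℝ, E n) p p) X := by
  rw [diff_eq_fderiv_inCoords (hξ.smooth.mdifferentiableAt (by simp) (x := p))]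
  congr 2
  funext v
  exact conformalNormal_eq hx hν hr hξ _

/-- The conformal `1`-form in terms of the shape operator. -/
lemma conformalOneForm_eq (hx : IsSpacelikeHypersurface c x) (hν : IsUnitNormal c x ν)
    (hr : ∀ p, 3 ≤ numPrincipalCurvatures c x ν p) {ξ : M → Fin (n + 3) → ℝ}
    (hξ : IsConformalNormal c x ν ξ) (p : M) (X : E n) :
    conformalOneForm c x ξ p X =
      -((conformalScale c x p ^ 2)⁻¹ *
        fderiv ℝ (inCoords p (conformalScale c x)) (extChartAt 𝓘(ℝ, E n) p p)
          (coordShape (inCoords p (lift c x)) (inCoords p (normalLift c x ν))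
            (extChartAt 𝓘(ℝ, E n) p p) X - meanCurvature c x ν p • X))
      - (conformalScale c x p)⁻¹ *
        fderiv ℝ (inCoords p (meanCurvature c x ν)) (extChartAt 𝓘(ℝ, E n) p p) X := by
  obtain ⟨L, q₀, q₁, q, κ, h⟩ := exists_isConeModel n c
  obtain ⟨hc, -⟩ := h.isLocalCone_inCoords hx hν p
  have hu := mem_extChartAt_target (I := 𝓘(ℝ, E n)) p
  have hn := three_le hx hν (hr p)
  have hρ0 : 0 < conformalScale c x p := conformalScale_pos hx hν (hr p)
  have hρu : inCoords p (conformalScale c x) (extChartAt 𝓘(ℝ, E n) p p) = conformalScale c x p :=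
    inCoords_apply_extChartAt p _
  have := hc.dot_fderiv_normal_laplacian hu
    ((contDiffAt_meanCurvature hx hν hu).differentiableAt (by simp))
    (fun v hv => contDiffAt_conformalScale hx hν hr hv) (hρu ▸ hρ0.ne') (by omega)
    (1 / (2 * (n : ℝ) ^ 2) * dot 2 (laplacianPosition c x p) (laplacianPosition c x p)) X
  rw [hρu, inCoords_apply_extChartAt, inCoords_apply_extChartAt] at this
  exact (congrArg (fun z => dot 2 z (nullNormal c x p))
    (diff_conformalNormal hx hν hr hξ p X)).trans this

/-- The conformal principal curvatures in terms of the principal curvatures. -/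
lemma conformalPrincipalCurvature_eq (hx : IsSpacelikeHypersurface c x)
    (hν : IsUnitNormal c x ν) (hr : ∀ p, 3 ≤ numPrincipalCurvatures c x ν p)
    {ξ : M → Fin (n + 3) → ℝ} (hξ : IsConformalNormal c x ν ξ) (i : Fin n) (p : M) :
    conformalPrincipalCurvature c x ξ i p =
      (principalCurvature c x ν i p - meanCurvature c x ν p) / conformalScale c x p := by
  obtain ⟨L, q₀, q₁, q, κ, h⟩ := exists_isConeModel n c
  obtain ⟨hc, -⟩ := h.isLocalCone_inCoords hx hν p
  have hu := mem_extChartAt_target (I := 𝓘(ℝ, E n)) p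
  have hρ0 : 0 < conformalScale c x p := conformalScale_pos hx hν (hr p)
  have hρd := (contDiffAt_conformalScale hx hν hr hu).differentiableAt (by simp)
  have hHd := (contDiffAt_meanCurvature hx hν hu).differentiableAt (by simp)
  obtain ⟨hmono, e, he⟩ := exists_centerBasis hx hν p
  set A := coordShape (inCoords p (lift c x)) (inCoords p (normalLift c x ν))
    (extChartAt 𝓘(ℝ, E n) p p) with hA
  let D : E n →ₗ[ℝ] (Fin (n + 3) → ℝ) := (fderiv ℝ
      (fun v => inCoords p (conformalScale c x) v • inCoords p (lift c x) v)
      (extChartAt 𝓘(ℝ, E n) p p)).toLinearMap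
  let D' : E n →ₗ[ℝ] (Fin (n + 3) → ℝ) := (fderiv ℝ
      (fun v => inCoords p (normalLift c x ν) v -
      inCoords p (meanCurvature c x ν) v • inCoords p (lift c x) v)
      (extChartAt 𝓘(ℝ, E n) p p)).toLinearMap
  have hD : ∀ X, X ≠ 0 → 0 < dot 2 (D X) (D X) := by
    intro X hX
    change 0 < dot 2 (fderiv ℝ _ _ X) (fderiv ℝ _ _ X)
    rw [hc.dot_fderiv_smul_y hu hρd, inCoords_apply_extChartAt]
    exact mul_pos (pow_pos hρ0 2) (hc.pos _ hu X hX)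
  -- The metric is `ρ² ⟨dy, dy⟩`, while `B` carries only one factor `ρ`. This leaves `ρ⁻¹(A - H)`.
  have hT : raiseIndex (conformalMetric c x p) (conformalSecondForm c x ξ p) =
      (conformalScale c x p)⁻¹ • (A - meanCurvature c x ν p • 1) := by
    have e1 : conformalMetric c x p = fun X Z => dot 2 (D X) (D Z) := by
      funext X Z
      exact congrArg₂ (dot 2) (diff_positionVector hx hν hr p X)
        (diff_positionVector hx hν hr p Z)
    have e2 : conformalSecondForm c x ξ p = fun X Z => dot 2 (D' X) (D Z) := by
      funext X Z
      exact congrArg₂ (dot 2) (diff_conformalNormal hx hν hr hξ p X)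
        (diff_positionVector hx hν hr p Z)
    rw [e1, e2]
    refine raiseIndex_unique hD fun X Z => ?_
    change dot 2 (fderiv ℝ _ _ _) (fderiv ℝ _ _ Z) = dot 2 (fderiv ℝ _ _ _) (fderiv ℝ _ _ Z)
    rw [hc.dot_fderiv_smul_y hu hρd, hc.dot_fderiv_normal_fderiv hu hHd hρd,
      inCoords_apply_extChartAt, inCoords_apply_extChartAt]
    simp only [LinearMap.smul_apply, LinearMap.sub_apply, Module.End.one_apply, map_smul,
      dot_smul_left]
    field_simp
    rfl
  have he' : ∀ i, raiseIndex (conformalMetric c x p) (conformalSecondForm c x ξ p) (e i) =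
      ((principalCurvature c x ν i p - meanCurvature c x ν p) / conformalScale c x p) • e i := by
    intro i
    rw [hT, LinearMap.smul_apply, LinearMap.sub_apply, LinearMap.smul_apply, Module.End.one_apply,
      he, ← sub_smul, smul_smul, div_eq_inv_mul]
  -- Division by `ρ > 0` preserves the order, so the `i`-th eigenvalue comes from the `i`-th
  -- principal curvature.
  refine orderedEigenvalue_eq he' (fun i j hij => ?_) i
  exact div_le_div_of_nonneg_right (sub_le_sub_right (hmono hij) _) hρ0.le

end Invariants

/-! ### Möbius curvatures and conformal principal curvatures -/

section Main

variable {n : ℕ} {M : Type*} [TopologicalSpace M] [ChartedSpace (E n) M] {c : SignType}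
  {x ν : M → Ambient n c}

/-- A ratio of differences is unchanged by a common affine map: `H` cancels in the differences and
`ρ` in the quotient. -/
lemma hasConstantMobiusCurvatures_of_eq_add_mul {H ρ : M → ℝ} {b : Fin n → ℝ}
    (hρ : ∀ p, ρ p ≠ 0) (hb : ∀ i p, principalCurvature c x ν i p = H p + ρ p * b i) :
    HasConstantMobiusCurvatures c x ν := by
  intro i j k
  refine ⟨(b i - b j) / (b i - b k), fun p _ => ?_⟩
  rw [mobiusCurvature, hb, hb, hb, ← mul_div_mul_left (b i - b j) (b i - b k) (hρ p)]
  congr 1 <;> ring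

variable [IsManifold 𝓘(ℝ, E n) ∞ M]

lemma HasConstantMobiusCurvatures.exists_eq (h : HasConstantMobiusCurvatures c x ν)
    (hx : IsSpacelikeHypersurface c x) (hν : IsUnitNormal c x ν)
    (hr : ∀ p, 3 ≤ numPrincipalCurvatures c x ν p) (i : Fin n) :
    ∃ b : ℝ, ∀ p,
      (principalCurvature c x ν i p - meanCurvature c x ν p) / conformalScale c x p = b := by
  have hn0 : 0 < n := i.pos
  -- These are the indices of the smallest and the largest principal curvature. The two differ at
  -- every point, so the Möbius curvatures `a j` with indices `f, j, l` are defined everywhere and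
  -- `λ_j = λ_f + a_j (λ_l - λ_f)`.
  let f : Fin n := ⟨0, hn0⟩
  let l : Fin n := ⟨n - 1, by omega⟩
  choose a ha using fun j => h f j l
  let μ : ℝ := (∑ j, a j) / n
  -- Both `λ_i - H` and `ρ` are proportional to `d = λ_l - λ_f`, with factors depending only on the
  -- `a j`. The quotient is this constant.
  refine ⟨(a i - μ) / Real.sqrt (n / (n - 1) * ∑ j, (a j - μ) ^ 2), fun p => ?_⟩
  obtain ⟨hmono, -⟩ := exists_principalBasis hx hν p
  have hd : principalCurvature c x ν f p < principalCurvature c x ν l p := by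
    obtain ⟨j, hj⟩ := exists_principalCurvature_ne hx hν (hr p) (principalCurvature c x ν f p)
    have h1 : principalCurvature c x ν f p ≤ principalCurvature c x ν j p :=
      hmono (Fin.mk_le_of_le_val (Nat.zero_le _))
    have h2 : principalCurvature c x ν j p ≤ principalCurvature c x ν l p :=
      hmono (Fin.le_def.2 (Nat.le_sub_one_of_lt j.2))
    exact (lt_of_le_of_ne h1 (Ne.symm hj)).trans_le h2
  set d := principalCurvature c x ν l p - principalCurvature c x ν f p with hddef
  have hd0 : 0 < d := sub_pos.2 hd
  have hl : ∀ j, principalCurvature c x ν j p = principalCurvature c x ν f p + a j * d := by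
    intro j
    have := ha j p hd.ne
    rw [mobiusCurvature, div_eq_iff (sub_ne_zero.2 hd.ne)] at this
    rw [hddef]
    linarith
  have hn : (n : ℝ) ≠ 0 := by positivity
  have hH : meanCurvature c x ν p = principalCurvature c x ν f p + μ * d := by
    rw [meanCurvature, Finset.sum_congr rfl fun j _ => hl j, Finset.sum_add_distrib,
      ← Finset.sum_mul]
    simp only [μ, Finset.sum_const, Finset.card_univ, Fintype.card_fin, nsmul_eq_mul]
    field_simp
  have hdiff : ∀ j, principalCurvature c x ν j p - meanCurvature c x ν p = (a j - μ) * d := by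
    intro j
    rw [hl, hH]
    ring
  have hρ : conformalScale c x p = Real.sqrt (n / (n - 1) * ∑ j, (a j - μ) ^ 2) * d := by
    have hn3 := three_le hx hν (hr p)
    rw [conformalScale, conformalFactor_eq hx hν p (by omega)]
    simp only [hdiff, mul_pow, ← Finset.sum_mul]
    rw [← mul_assoc, Real.sqrt_mul' _ (sq_nonneg d), Real.sqrt_sq hd0.le]
  rw [hdiff, hρ, mul_div_mul_right _ _ hd0.ne']

/-! ### Curvature lines -/

lemma eq_smul_of_simple {V : Type*} [AddCommGroup V] [Module ℝ V]
    {T : Module.End ℝ V} {e : Module.Basis (Fin n) ℝ V} {d : Fin n → ℝ}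
    (h : ∀ i, T (e i) = d i • e i) {i : Fin n} (hi : ∀ j, j ≠ i → d j ≠ d i) {X : V}
    (hX : T X = d i • X) : X = e.repr X i • e i := by
  conv_lhs => rw [← e.sum_repr X]
  refine Finset.sum_eq_single_of_mem i (Finset.mem_univ _) fun j _ hj => ?_
  rw [repr_eq_zero_of_apply_eq_smul h hX (hi j hj), zero_smul]

/-- The eigenspace of a simple eigenvalue is a line, and the velocity `a • X` is a nonzero vector on
it. -/
lemma range_eq_eigenspace {T A : Module.End ℝ (E n)} {J : E n ≃ₗ[ℝ] E n}
    (hJ : ∀ X, T (J X) = J (A X)) {e : Module.Basis (Fin n) ℝ (E n)} {d : Fin n → ℝ}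
    (he : ∀ i, A (e i) = d i • e i) {i : Fin n} (hi : ∀ j, j ≠ i → d j ≠ d i) {X : E n}
    (hX : A X = d i • X) (hX0 : X ≠ 0) {a : ℝ} (ha : a ≠ 0) {F : E 1 →ₗ[ℝ] E n}
    (hF : ∀ Z : E 1, F Z = J (Z 0 • a • X)) : LinearMap.range F = T.eigenspace (d i) := by
  ext Y
  rw [Module.End.mem_eigenspace_iff]
  constructor
  · rintro ⟨Z, rfl⟩
    rw [hF, hJ, ← map_smul J]
    simp only [map_smul A, hX]
    congr 1
    module
  · intro hY
    obtain ⟨Y, rfl⟩ := J.surjective Y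
    have h1 := eq_smul_of_simple he hi
      (J.injective (by rw [← hJ, map_smul, hY]) : A Y = d i • Y)
    have h2 := eq_smul_of_simple he hi hX
    have hx0 : e.repr X i ≠ 0 := fun h => hX0 (by rw [h2, h, zero_smul])
    refine ⟨EuclideanSpace.single 0 (e.repr Y i / (e.repr X i * a)), ?_⟩
    rw [hF]
    refine congrArg J ?_
    rw [h1, h2, smul_smul, smul_smul]
    congr 1
    simp
    field_simp

/-- A curve in a chart that is tangent to the principal directions of a simple principal
curvature is a curvature surface. -/
lemma isCurvatureSurface_curve (hx : IsSpacelikeHypersurface c x) (hν : IsUnitNormal c x ν)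
    {p : M} {i : Fin n} {X : E n → E n} {δ : ℝ → E n}
    (hsimple : ∀ v ∈ (extChartAt 𝓘(ℝ, E n) p).target, ∀ j, j ≠ i →
      inCoords p (principalCurvature c x ν j) v ≠ inCoords p (principalCurvature c x ν i) v)
    (hX : ∀ v ∈ (extChartAt 𝓘(ℝ, E n) p).target,
      coordShape (inCoords p (lift c x)) (inCoords p (normalLift c x ν)) v (X v) =
        inCoords p (principalCurvature c x ν i) v • X v)
    (hδ : ContDiff ℝ ∞ δ) (hδU : ∀ t, δ t ∈ (extChartAt 𝓘(ℝ, E n) p).target)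
    (hX0 : ∀ t, X (δ t) ≠ 0) (hδX : ∀ t, ∃ a : ℝ, a ≠ 0 ∧ HasDerivAt δ (a • X (δ t)) t)
    (hemb : Topology.IsEmbedding δ) :
    IsCurvatureSurface c x ν 1 (fun s : E 1 => (extChartAt 𝓘(ℝ, E n) p).symm (δ (s 0)))
      fun s => principalCurvature c x ν i ((extChartAt 𝓘(ℝ, E n) p).symm (δ (s 0))) := by
  set φ := extChartAt 𝓘(ℝ, E n) p with hφ
  choose a ha0 ha using hδX
  have hproj : ContDiff ℝ ∞ fun s : E 1 => s 0 := contDiff_piLp_apply 2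
  have hg : ContDiff ℝ ∞ fun s : E 1 => δ (s 0) := hδ.comp hproj
  have hgd : ∀ s Z : E 1, fderiv ℝ (fun s : E 1 => δ (s 0)) s Z =
      Z 0 • a (s 0) • X (δ (s 0)) := by
    intro s Z
    have h1 : HasFDerivAt (fun s : E 1 => s 0) (EuclideanSpace.proj (𝕜 := ℝ) 0 : E 1 →L[ℝ] ℝ) s :=
      (EuclideanSpace.proj (𝕜 := ℝ) 0 : E 1 →L[ℝ] ℝ).hasFDerivAt
    have h2 := ((ha (s 0)).hasFDerivAt.comp s h1).fderiv
    refine (congrArg (fun F : E 1 →L[ℝ] E n => F Z) h2).trans ?_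
    simp
  choose J hJm hJ using fun s : E 1 => shapeOperator_apply hx hν (hδU (s 0))
  have hmf : ∀ s Z : E 1, mfderiv 𝓘(ℝ, E 1) 𝓘(ℝ, E n) (fun s : E 1 => φ.symm (δ (s 0))) s Z =
      J s (Z 0 • a (s 0) • X (δ (s 0))) := by
    intro s Z
    have h1 := mfderiv_comp_apply s (mdifferentiableAt_extChartAt_symm (hδU (s 0)))
      ((hg.contMDiff (n := ∞)).mdifferentiableAt (by simp) (x := s)) Z
    rw [mfderiv_eq_fderiv] at h1
    refine h1.trans ((hJm s _).symm.trans ?_)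
    exact congrArg (J s) (hgd s Z)
  have heig : ∀ s : E 1, shapeOperator c x ν (φ.symm (δ (s 0))) (J s (X (δ (s 0)))) =
      principalCurvature c x ν i (φ.symm (δ (s 0))) • J s (X (δ (s 0))) := by
    intro s
    rw [hJ, hX _ (hδU _), map_smul]
    rfl
  refine ⟨inferInstance, ?_, fun s => ?_, ?_, fun s => ?_, fun s => ?_⟩
  · exact (contMDiffOn_extChartAt_symm (n := ∞) p).comp_contMDiff hg.contMDiff fun s => hδU _
  · refine (injective_iff_map_eq_zero _).2 fun (Z : E 1) hZ => ?_
    have h1 : J s (Z 0 • a (s 0) • X (δ (s 0))) = 0 := (hmf s Z).symm.trans hZ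
    have h2 : Z 0 = 0 := by simpa [ha0, hX0] using h1
    exact PiLp.ext fun k => by rw [Subsingleton.elim k 0]; exact h2
  · have h0 : Topology.IsEmbedding fun s : E 1 => δ (s 0) := by
      refine hemb.comp ?_
      have : (fun s : E 1 => s 0) = (Homeomorph.funUnique (Fin 1) ℝ) ∘
          (PiLp.homeomorph 2 fun _ : Fin 1 => ℝ) := rfl
      rw [this]
      exact (Homeomorph.isEmbedding _).comp (Homeomorph.isEmbedding _)
    have htar : ∀ t, δ t ∈ (chartAt (E n) p).target := fun t => by simpa [hφ] using hδU t
    have h1 := h0.codRestrict (chartAt (E n) p).target fun s => htar (s 0)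
    -- The curve is an embedding into the target of the chart, which the chart identifies
    -- homeomorphically with its open source in `M`.
    exact Topology.IsEmbedding.subtypeVal.comp
      ((chartAt (E n) p).toHomeomorphSourceTarget.symm.isEmbedding.comp h1)
  · exact Module.End.hasEigenvalue_of_hasEigenvector (Module.End.hasEigenvector_iff.2
      ⟨Module.End.mem_eigenspace_iff.2 (heig s), fun h => hX0 _ ((J s).map_eq_zero_iff.1 h)⟩)
  · obtain ⟨e, he⟩ := exists_coordBasis hx hν (hδU (s 0))
    exact range_eq_eigenspace (hJ s) he (hsimple _ (hδU _)) (hX _ (hδU _)) (hX0 _) (ha0 (s 0))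
      (hmf s)

/-- For a Dupin hypersurface with constant conformal principal curvatures, the principal
curvatures are stationary along their principal directions. -/
lemma IsDupin.fderiv_principalCurvature (hdupin : IsDupin c x ν)
    (hx : IsSpacelikeHypersurface c x) (hν : IsUnitNormal c x ν)
    (hr : ∀ p, 3 ≤ numPrincipalCurvatures c x ν p) {b : Fin n → ℝ}
    (hb : ∀ i p, principalCurvature c x ν i p =
      meanCurvature c x ν p + conformalScale c x p * b i) (p : M)
    {e : Module.Basis (Fin n) ℝ (E n)}
    (he : ∀ i, coordShape (inCoords p (lift c x)) (inCoords p (normalLift c x ν))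
      (extChartAt 𝓘(ℝ, E n) p p) (e i) = principalCurvature c x ν i p • e i) (i : Fin n) :
    fderiv ℝ (fun v => inCoords p (meanCurvature c x ν) v +
      inCoords p (conformalScale c x) v * b i) (extChartAt 𝓘(ℝ, E n) p p) (e i) = 0 := by
  obtain ⟨L, q₀, q₁, q, κ, h⟩ := exists_isConeModel n c
  obtain ⟨hc, -⟩ := h.isLocalCone_inCoords hx hν p
  have hu := mem_extChartAt_target (I := 𝓘(ℝ, E n)) p
  have hH : ∀ v ∈ (extChartAt 𝓘(ℝ, E n) p).target,
    ContDiffAt ℝ ∞ (inCoords p (meanCurvature c x ν)) v := fun v hv =>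
      contDiffAt_meanCurvature hx hν hv
  have hρ : ∀ v ∈ (extChartAt 𝓘(ℝ, E n) p).target,
    ContDiffAt ℝ ∞ (inCoords p (conformalScale c x)) v := fun v hv =>
      contDiffAt_conformalScale hx hν hr hv
  have h0 : ∀ v ∈ (extChartAt 𝓘(ℝ, E n) p).target, inCoords p (conformalScale c x) v ≠ 0 :=
    fun v _ => (conformalScale_pos hx hν (hr _)).ne'
  have hb' : ∀ (i : Fin n) (v : E n), inCoords p (principalCurvature c x ν i) v =
    inCoords p (meanCurvature c x ν) v + inCoords p (conformalScale c x) v * b i :=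
      fun i v => hb i _
  have hbasis : ∀ v ∈ (extChartAt 𝓘(ℝ, E n) p).target, ∃ e : Module.Basis (Fin n) ℝ (E n), ∀ i,
      coordShape (inCoords p (lift c x)) (inCoords p (normalLift c x ν)) v (e i) =
        (inCoords p (meanCurvature c x ν) v + inCoords p (conformalScale c x) v * b i) • e i := by
    intro v hv
    obtain ⟨e, he⟩ := exists_coordBasis hx hν hv
    exact ⟨e, fun i => by rw [he, hb']⟩
  have he' : ∀ i, coordShape (inCoords p (lift c x)) (inCoords p (normalLift c x ν))
      (extChartAt 𝓘(ℝ, E n) p p) (e i) =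
      (inCoords p (meanCurvature c x ν) (extChartAt 𝓘(ℝ, E n) p p) +
        inCoords p (conformalScale c x) (extChartAt 𝓘(ℝ, E n) p p) * b i) • e i := by
    intro i
    rw [he, ← hb', inCoords_apply_extChartAt]
  by_cases hmult : ∃ j, i ≠ j ∧ b i = b j
  · obtain ⟨j, hij, hbij⟩ := hmult
    exact hc.fderiv_principalCurvature_of_multiple hH hρ h0 hbasis hu he' hij hbij
  · push Not at hmult
    -- As the `b j` are constant, a principal curvature that is simple at `p` is simple on the whole
    -- chart. The integral curve of its principal field is thus a curvature surface throughout.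
    obtain ⟨X, hXs, hXu, hX⟩ := hc.exists_eigenfield hH hρ h0 hbasis hu (b i) (he' i)
    obtain ⟨δ, hδ, hδ0, hδU, hX0, hδX, hemb⟩ :=
      exists_embedded_integralCurve hc.isOpen hXs hu (hXu ▸ e.ne_zero i)
    have hsurf := isCurvatureSurface_curve hx hν (i := i) (fun v hv j hj => by
      rw [hb', hb']
      intro h
      exact hmult j (Ne.symm hj) (mul_left_cancel₀ (h0 v hv) (add_left_cancel h)).symm)
      (fun v hv => by rw [hX v hv, hb']) hδ hδU hX0 hδX hemb
    have hconst := hdupin 1 (E 1) _ _ hsurf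
    obtain ⟨a, ha0, ha⟩ := hδX 0
    have hl : DifferentiableAt ℝ (fun v => inCoords p (meanCurvature c x ν) v +
      inCoords p (conformalScale c x) v * b i) (δ 0) := by
      rw [hδ0]
      exact ((hH _ hu).add ((hρ _ hu).mul contDiffAt_const)).differentiableAt (by simp)
    have h1 := hl.hasFDerivAt.comp_hasDerivAt 0 ha
    have h2 : ((fun v => inCoords p (meanCurvature c x ν) v +
        inCoords p (conformalScale c x) v * b i) ∘ δ) =
        fun _ => principalCurvature c x ν i ((extChartAt 𝓘(ℝ, E n) p).symm (δ 0)) := by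
      funext t
      have := hconst (EuclideanSpace.single 0 t) (EuclideanSpace.single 0 0)
      simp only [PiLp.single_apply, if_true] at this
      rw [← this, hb]
      rfl
    rw [h2] at h1
    -- By the Dupin condition `λ_i` is constant along the curve, whose velocity at `0` is a nonzero
    -- multiple of `e i`.
    have h3 := h1.unique (hasDerivAt_const _ _)
    rw [hδ0, hXu, map_smul, smul_eq_mul] at h3
    exact (mul_eq_zero.1 h3).resolve_left ha0

end Main

end LorentzDupin

theorem mainTheorem3 {n : ℕ} {M : Type*} [TopologicalSpace M] [ChartedSpace (LorentzDupin.E n) M]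
    [IsManifold 𝓘(ℝ, LorentzDupin.E n) ∞ M] (c : SignType)
    (x ν : M → LorentzDupin.Ambient n c) (ξ : M → Fin (n + 3) → ℝ)
    (hx : LorentzDupin.IsSpacelikeHypersurface c x)
    (hν : LorentzDupin.IsUnitNormal c x ν)
    (hξ : LorentzDupin.IsConformalNormal c x ν ξ)
    (hdupin : LorentzDupin.IsDupin c x ν)
    (hr : ∀ p : M, 3 ≤ LorentzDupin.numPrincipalCurvatures c x ν p) :
    LorentzDupin.HasConstantMobiusCurvatures c x ν ↔
      (∀ (p : M) (X : TangentSpace 𝓘(ℝ, LorentzDupin.E n) p),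
        LorentzDupin.conformalOneForm c x ξ p X = 0) ∧
      ∀ i : Fin n, ∃ b : ℝ, ∀ p : M, LorentzDupin.conformalPrincipalCurvature c x ξ i p = b := by
  have hρ : ∀ p, LorentzDupin.conformalScale c x p ≠ 0 := fun p =>
    (LorentzDupin.conformalScale_pos hx hν (hr p)).ne'
  simp only [LorentzDupin.conformalPrincipalCurvature_eq hx hν hr hξ]
  constructor
  · intro h
    have hconst := h.exists_eq hx hν hr
    refine ⟨fun p X => ?_, hconst⟩
    choose b hb using hconst
    have hb' : ∀ i p, LorentzDupin.principalCurvature c x ν i p =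
        LorentzDupin.meanCurvature c x ν p + LorentzDupin.conformalScale c x p * b i := by
      intro i p
      rw [← hb i p, mul_div_cancel₀ _ (hρ p)]
      ring
    obtain ⟨-, e, he⟩ := LorentzDupin.exists_centerBasis hx hν p
    have hu := mem_extChartAt_target (I := 𝓘(ℝ, LorentzDupin.E n)) p
    have hHd := (LorentzDupin.contDiffAt_meanCurvature hx hν hu).differentiableAt (by simp)
    have hρd := (LorentzDupin.contDiffAt_conformalScale hx hν hr hu).differentiableAt (by simp)
    refine (LorentzDupin.conformalOneForm_eq hx hν hr hξ p X).trans ?_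
    -- The right-hand side is linear in `X`, so it suffices to test it on a principal basis. There
    -- it equals `-ρ⁻¹ e_i(λ_i)`.
    have hlin := e.ext (M₁ := ℝ) (f₁ :=
      -((LorentzDupin.conformalScale c x p ^ 2)⁻¹ •
        (fderiv ℝ (LorentzDupin.inCoords p (LorentzDupin.conformalScale c x))
          (extChartAt 𝓘(ℝ, LorentzDupin.E n) p p)).toLinearMap ∘ₗ
          (LorentzDupin.coordShape (LorentzDupin.inCoords p (LorentzDupin.lift c x))
            (LorentzDupin.inCoords p (LorentzDupin.normalLift c x ν))
            (extChartAt 𝓘(ℝ, LorentzDupin.E n) p p) - LorentzDupin.meanCurvature c x ν p • 1))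
      - (LorentzDupin.conformalScale c x p)⁻¹ •
        (fderiv ℝ (LorentzDupin.inCoords p (LorentzDupin.meanCurvature c x ν))
          (extChartAt 𝓘(ℝ, LorentzDupin.E n) p p)).toLinearMap) (f₂ := 0) fun i => ?_
    · exact LinearMap.congr_fun hlin X
    · have h1 := hdupin.fderiv_principalCurvature hx hν hr hb' p he i
      rw [fderiv_fun_add hHd (hρd.mul_const _), fderiv_mul_const hρd] at h1
      have h2 := hρ p
      have h3 : LorentzDupin.coordShape (LorentzDupin.inCoords p (LorentzDupin.lift c x))
          (LorentzDupin.inCoords p (LorentzDupin.normalLift c x ν))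
          (extChartAt 𝓘(ℝ, LorentzDupin.E n) p p) (e i) -
          LorentzDupin.meanCurvature c x ν p • e i =
          (LorentzDupin.conformalScale c x p * b i) • e i := by
        rw [he, hb']
        module
      simp only [add_apply, smul_apply, smul_eq_mul] at h1
      simp only [LinearMap.sub_apply, LinearMap.neg_apply, LinearMap.smul_apply,
        LinearMap.comp_apply, Module.End.one_apply, LinearMap.zero_apply, h3, map_smul,
        ContinuousLinearMap.coe_coe, smul_eq_mul]
      field_simp
      linarith
  · rintro ⟨-, hconst⟩
    choose b hb using hconst
    -- Constant `b_i` mean `λ_i = H + ρ b_i`, an affine image of constants.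
    refine LorentzDupin.hasConstantMobiusCurvatures_of_eq_add_mul
      (H := LorentzDupin.meanCurvature c x ν) (b := b) hρ fun i p => ?_
    rw [← hb i p, mul_div_cancel₀ _ (hρ p)]
    ring
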